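/- **Model.** Types are $\Theta=\{1,\dots,K\}$. Agents $1,2,\dots$ are born one per date, agent $t$ at date $t$; their types $\theta_t$ are i.i.d. with $\mathbb P(\theta_t=k)=p_k$. At date $t$ every agent $i\le t$ meets one other agent; given the links formed before $t$ (and the types) these meetings are independent. Let $\mathcal K$ be the set of followees of followees of $i$, other than $i$ and its followees; everyone else who is neither $i$ nor a followee of $i$ is a stranger. If $\mathcal K\ne\emptyset$, then $i$ meets a member of $\mathcal K$ with probability $\gamma_{\theta_i}+(1-\gamma_{\theta_i})\frac{|\mathcal K|}{t-1}$ and otherwise a stranger, uniformly within the chosen set; if $\mathcal K=\emptyset$, it meets a uniformly chosen stranger. Agent $i$ of type $k$, with $N^s$ same-type and $N^d$ different-type followees, has utility $v_k(\alpha^s_kN^s+\alpha^d_kN^d)-c\,(N^s+N^d)$ and links to the agent it meets exactly if this strictly increases its utility. Here $v_k:[0,\infty)\to\mathbb R$ is $C^2$, increasing and strictly concave, $v_k(0)=0$, $0\le\alpha^d_k\le\alpha^s_k$ and $c>0$. Let $L^*_k(a)=\arg\max_{x\in\mathbb N} v_k(x\alpha^s_k+a)-xc$ and $\bar L^*_k(a)=\arg\max_{x\in\mathbb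 N} v_k(x\alpha^d_k+a)-xc$ (the smallest maximizer), where $x\mapsto v_k(x\alpha_k^s)-xc$ is assumed to attain its maximum, and let $h_k=L^*_k(\alpha^d_k\bar L^*_k(0))/\bigl(L^*_k(\alpha^d_k\bar L^*_k(0))+\bar L^*_k(0)\bigr)$. Let $\deg_i^-(t)$ be the number of agents that have linked to $i$ up to and including date $t$, and write $\mathbb E_k$ for the expectation conditional on $\theta_i=k$, over all realizations of the network process. **Theorem.** Suppose that the society is intolerant: $h_k=1$ for all $k\in\Theta$. 1. If $\gamma_k=0$ for all $k$, then for every type distribution $p$, every type $k$ with $p_k>0$ and every agent $i\ge1$, $$\lim_{t\to\infty}\frac{\mathbb E_k\{\deg_i^-(t)\}}{L^*_k(0)\,\log t}=1 .$$ 2. If $\gamma_k=1$ for all $k$, then there are exponents $0\le b_k<1$ $(k\in\Theta)$, which do not depend on the type distribution or on the agent, with $b_k>b_m$ whenever $L^*_k(0)>L^*_m(0)$, and with $b_k>0$ whenever $L^*_k(0)\ge2$, such that for every type distribution $p$, every type $k$ with $p_k>0$ and every agent $i\ge1$, $$\mathbb E_k\{\deg_i^-(t)\}\ \ge\ t^{\,b_k}\qquad\text{for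 all sufficiently large } t .$$ -/

import Mathlib

open Filter Topology MeasureTheory ProbabilityTheory
open scoped ENNReal NNReal

noncomputable section

/-- Preferences of a society with type set `Fin K`: for every type `k`, a social benefit
aggregation function `v k` and the benefits `αs k`, `αd k` of a same-type and of a different-type
link; `c` is the common cost of a link.  The last field is the standing requirement that the
gregariousness is finite: the net benefit of `x` same-type links is maximal at some `x`. -/
structure Preferences (K : ℕ) where
  v : Fin K → ℝ → ℝ
  αs : Fin K → ℝ
  αd : Fin K → ℝ
  c : ℝ
  v_concave : ∀ k, StrictConcaveOn ℝ (Set.Ici 0) (v k)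
  v_smooth : ∀ k, ContDiffOn ℝ 2 (v k) (Set.Ici 0)
  v_mono : ∀ k, MonotoneOn (v k) (Set.Ici 0)
  v_zero : ∀ k, v k 0 = 0
  αd_nonneg : ∀ k, 0 ≤ αd k
  αd_le_αs : ∀ k, αd k ≤ αs k
  c_pos : 0 < c
  saturates : ∀ k, ∃ x : ℕ, ∀ y : ℕ, v k (y * αs k) - y * c ≤ v k (x * αs k) - x * c

namespace Preferences

variable {K : ℕ} (P : Preferences K)

/-- `L*_k(a) = argmax_x v_k(x αs_k + a) - x c`, over numbers of links `x`.  As a link is formed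
only if it strictly increases utility, ties are broken towards the smaller number. -/
def L (k : Fin K) (a : ℝ) : ℕ :=
  sInf {x : ℕ | ∀ y : ℕ, P.v k (y * P.αs k + a) - y * P.c ≤ P.v k (x * P.αs k + a) - x * P.c}

/-- The same for different-type links: `argmax_x v_k(x αd_k + a) - x c`. -/
def Lbar (k : Fin K) (a : ℝ) : ℕ :=
  sInf {x : ℕ | ∀ y : ℕ, P.v k (y * P.αd k + a) - y * P.c ≤ P.v k (x * P.αd k + a) - x * P.c}

/-- The exogenous homophily index `h_k`. -/
def homophilyIndex (k : Fin K) : ℝ :=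
  (P.L k (P.αd k * P.Lbar k 0) : ℝ) / (P.L k (P.αd k * P.Lbar k 0) + P.Lbar k 0)

/-- Social gregariousness `L*_k(0)`. -/
def gregariousness (k : Fin K) : ℕ := P.L k 0

end Preferences

/-- A network on agents indexed by their birth dates `1, 2, …`, given by the followee sets:
`j ∈ G i` means that `i` has formed a link to `j`. -/
abbrev Network : Type := ℕ → Finset ℕ

namespace Network

/-- Followees of followees of `i`, other than `i` and its followees. -/
def followeesOfFollowees (G : Network) (i : ℕ) : Finset ℕ :=
  ((G i).biUnion G).erase i \ G i

/-- Strangers to `i` among the agents `1, …, t`. -/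
def strangers (G : Network) (i t : ℕ) : Finset ℕ :=
  Finset.Icc 1 t \ (G.followeesOfFollowees i ∪ G i ∪ {i})

/-- Popularity: the number of followers of `i` among the agents `1, …, t`. -/
def indegree (G : Network) (i t : ℕ) : ℕ :=
  ((Finset.Icc 1 t).filter fun j => i ∈ G j).card

/-- A coin showing `true` with probability `q`. -/
def coin (q : ℝ≥0) (hq : q ≤ 1) : PMF Bool :=
  PMF.ofFintype (fun b => if b then (q : ℝ≥0∞) else 1 - q) (by simp [hq])

/-- The law of the agent whom `i` meets at date `t`, where `G` holds the links formed before `t`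
and `g` is the structural opportunism of `i`.  If followees of followees exist, `i` meets one of
them with probability `g + (1 - g) * card / (t - 1)` and otherwise a stranger, uniformly within the
chosen set; if there are none, `i` meets a uniform stranger.  Strangers exist unless `t = 1`,
when nobody can be met (`none`).  The truncation by `1` is never active on networks
that arise, as followees of followees are at most `t - 1` in number. -/
def meetingLaw (G : Network) (g : ℝ≥0) (i t : ℕ) : PMF (Option ℕ) :=
  if hS : (G.strangers i t).Nonempty then
    if hF : (G.followeesOfFollowees i).Nonempty then
      (coin (min 1 (g + (1 - g) * ((G.followeesOfFollowees i).card / (t - 1 : ℕ))))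
        (min_le_left _ _)).bind fun b =>
          if b then (PMF.uniformOfFinset (G.followeesOfFollowees i) hF).map some
          else (PMF.uniformOfFinset (G.strangers i t) hS).map some
    else (PMF.uniformOfFinset (G.strangers i t) hS).map some
  else PMF.pure none

end Network

section Formation

variable {K : ℕ} (P : Preferences K) (γ : Fin K → ℝ≥0) (θ : ℕ → Fin K)

/-- Marginal utility for `i` of a link to `j`, given the links `G` and the types `θ`. -/
def marginalUtility (G : Network) (i j : ℕ) : ℝ :=
  let k := θ i
  let Ns : ℕ := ((G i).filter fun l => θ l = k).card
  let Nd : ℕ := ((G i).filter fun l => θ l ≠ k).card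
  P.v k (P.αs k * (Ns + if θ j = k then 1 else 0) + P.αd k * (Nd + if θ j ≠ k then 1 else 0))
    - P.v k (P.αs k * Ns + P.αd k * Nd) - P.c

/-- Followees of `i` after meeting `m`: the link is formed iff its marginal utility is positive. -/
def afterMeeting (G : Network) (i : ℕ) : Option ℕ → Finset ℕ
  | none => G i
  | some j => open Classical in if 0 < marginalUtility P θ G i j then insert j (G i) else G i

/-- The joint law of the meetings at date `t` of the agents `1, …, n`, which are independent given
the links `G` formed before `t`. -/
def meetings (G : Network) (t : ℕ) : ℕ → PMF (ℕ → Option ℕ)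
  | 0 => PMF.pure fun _ => none
  | n + 1 => (meetings G t n).bind fun m =>
      (G.meetingLaw (γ (θ (n + 1))) (n + 1) t).map fun x => Function.update m (n + 1) x

/-- The law of the network at date `t`, given the sequence `θ` of types.  The network is empty at
date `0`; at date `t` agent `t` is born, all agents `1, …, t` meet one agent each and decide,
simultaneously, whether to link to the agent they meet. -/
def networkLaw : ℕ → PMF Network
  | 0 => PMF.pure fun _ => ∅
  | t + 1 => (networkLaw t).bind fun G =>
      (meetings γ θ G (t + 1) (t + 1)).map fun m => fun i => afterMeeting P θ G i (m i)

/-- The law of the type sequence: types are independent with distribution `p`. -/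
def birthLaw (p : PMF (Fin K)) : Measure (ℕ → Fin K) :=
  Measure.infinitePi fun _ => p.toMeasure

/-- Expected popularity of agent `i` at date `t`, given that `i` has type `k`. -/
def expectedPopularity (p : PMF (Fin K)) (k : Fin K) (i t : ℕ) : ℝ :=
  (∫⁻ θ, ∑' G : Network, networkLaw P γ θ t G * (G.indegree i t : ℝ≥0∞)
    ∂(birthLaw p)[|{θ | θ i = k}]).toReal

end Formation

end

open Filter Topology MeasureTheory ProbabilityTheory
open scoped ENNReal NNReal

noncomputable section

/-! In an intolerant society no different-type link is ever worth its cost, so an agent of type `k`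
links to every same-type agent it meets until it has `L = P.gregariousness k` followees
(`marginalUtility_pos_iff`). The popularity of `i` therefore depends only on how often same-type
agents that still search run into `i`.

Without opportunism every non-followee is met with probability about `1/t`
(`meetingLaw_zero_bounds`), so popularity grows by about `U/t` per date, where `U` is the number of
searchers of type `k`. A balance of links controls `U`: searchers form about `p_k U` links per date,
and about `L p_k t` links at most are formed by date `t`. The share `p_k` cancels, and the Cesàro
means of `U` are asymptotically at most `L` (`eventually_sum_le_of_balance`). For the lower bound,
let `A` count the searchers that do not yet follow `i`, and credit each follower of `i` with all `L`
links at once. This capped count grows only through `A`, at rate about `p_k A`, and reaches `L p_k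
t` up to `L U_t`, which is `o(t)` (`eventually_le_sum_of_balance`). So the Cesàro means of `A` and
`U` both tend to `L`, hence so do their logarithmic means, and popularity is squeezed to `L log t`.

With full opportunism popularity feeds on itself. An agent without followees meets some follower of
`i` with probability `deg/t`; its only followee then follows `i`, so at the next date it meets one
of at most `L` followees of that followee, possibly `i` (`le_popularity_succ_of_secondFollowers`).
Agents of type `k` are born at rate `p_k` but stay without followees for about `1/p_k` dates, so
about one of them is available at any date, whatever `p_k` is (`exists_quarter_le_mul_geom_sum`).
This gives a delayed recursion `g(t+2) ≥ g(t+1) + β g(t-M)/t` with `β = 1/(8L)`, which forces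
polynomial growth (`exists_const_mul_rpow_le`).

Both arguments are run with the type sequence fixed and then averaged over types; Hoeffding's
inequality makes the types with atypical shares negligible. -/

/-! ### Concave benefits and the linking rule -/

theorem ConcaveOn.increment_antitone {f : ℝ → ℝ} (hf : ConcaveOn ℝ (Set.Ici 0) f) {a b h : ℝ}
    (ha : 0 ≤ a) (hab : a ≤ b) (hh : 0 ≤ h) : f (b + h) - f b ≤ f (a + h) - f a := by
  rcases eq_or_lt_of_le hab with rfl | hab'
  · rfl
  have hD : 0 < b + h - a := by linarith
  have hmem : a + (b + h - a) ∈ Set.Ici (0 : ℝ) := by simp; linarith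
  rw [show a + (b + h - a) = b + h by ring] at hmem
  have hp : 0 ≤ (b - a) / (b + h - a) := div_nonneg (by linarith) hD.le
  have hq : 0 ≤ h / (b + h - a) := div_nonneg hh hD.le
  -- The points `a + h` and `b` are convex combinations of `a` and `b + h` with swapped weights;
  -- adding the two concavity inequalities gives the claim.
  have h1 := hf.2 (Set.mem_Ici.2 ha) hmem hp hq (by field_simp; ring)
  have h2 := hf.2 (Set.mem_Ici.2 ha) hmem hq hp (by field_simp; ring)
  have e1 : (b - a) / (b + h - a) * a + h / (b + h - a) * (b + h) = a + h := by
    field_simp; ring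
  have e2 : h / (b + h - a) * a + (b - a) / (b + h - a) * (b + h) = b := by
    field_simp; ring
  have e3 : (b - a) / (b + h - a) + h / (b + h - a) = 1 := by field_simp; ring
  simp only [smul_eq_mul, e1, e2] at h1 h2
  have e4 : h / (b + h - a) = 1 - (b - a) / (b + h - a) := by linarith
  rw [e4] at h1 h2
  linarith

/-- For a sequence with decreasing increments, the increments are positive exactly below the
smallest maximizer. -/
theorem lt_sInf_argmax_iff {f : ℕ → ℝ} (hf : ∀ m n, m ≤ n → f (n + 1) - f n ≤ f (m + 1) - f m)
    (hne : ∃ x, ∀ y, f y ≤ f x) (n : ℕ) :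
    n < sInf {x | ∀ y, f y ≤ f x} ↔ 0 < f (n + 1) - f n := by
  have hmem : sInf {x | ∀ y, f y ≤ f x} ∈ {x | ∀ y, f y ≤ f x} := Nat.sInf_mem hne
  set L := sInf {x | ∀ y, f y ≤ f x} with hL
  constructor
  · intro hn
    by_contra! hc
    -- A nonpositive increment at `n` makes all later ones nonpositive, so `n` would be a maximizer
    -- below the smallest one.
    have hdec : ∀ m, f (n + m) ≤ f n := by
      intro m
      induction m with
      | zero => simp
      | succ m ih =>
        have := hf n (n + m) (by omega)
        rw [← add_assoc]; linarith
    have : n ∈ {x | ∀ y, f y ≤ f x} := by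
      intro y
      have h1 := hdec (L - n)
      rw [Nat.add_sub_cancel' hn.le] at h1
      exact (hmem y).trans h1
    exact absurd (Nat.sInf_le this) (by omega)
  · intro hn
    by_contra! hc
    have := hf L n hc
    have := hmem (L + 1)
    linarith

/-- After a nonpositive increment the sequence never rises again, so a maximum over an initial
segment is global. -/
theorem exists_argmax_of_increment_nonpos {f : ℕ → ℝ}
    (hf : ∀ m n, m ≤ n → f (n + 1) - f n ≤ f (m + 1) - f m)
    {n : ℕ} (hn : f (n + 1) - f n ≤ 0) : ∃ x, ∀ y, f y ≤ f x := by
  obtain ⟨x, hx, hmax⟩ := Finset.exists_max_image (Finset.range (n + 1)) f ⟨0, by simp⟩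
  refine ⟨x, fun y => ?_⟩
  rcases le_total y n with hy | hy
  · exact hmax y (by simp; omega)
  · obtain ⟨m, rfl⟩ := Nat.exists_eq_add_of_le hy
    refine le_trans ?_ (hmax n (by simp))
    clear hy
    induction m with
    | zero => simp
    | succ m ih =>
      have := hf n (n + m) (by omega)
      rw [← add_assoc]; linarith

namespace Preferences

variable {K : ℕ} (P : Preferences K)

theorem increment_antitone (k : Fin K) {a b h : ℝ}
    (ha : 0 ≤ a) (hab : a ≤ b) (hh : 0 ≤ h) :
    P.v k (b + h) - P.v k b ≤ P.v k (a + h) - P.v k a :=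
  (P.v_concave k).concaveOn.increment_antitone ha hab hh

theorem αs_nonneg (k : Fin K) : 0 ≤ P.αs k := (P.αd_nonneg k).trans (P.αd_le_αs k)

theorem netBenefit_increment_antitone (k : Fin K) {α : ℝ} (hα : 0 ≤ α) (m n : ℕ) (hmn : m ≤ n) :
    (P.v k ((n + 1 : ℕ) * α + 0) - (n + 1 : ℕ) * P.c) - (P.v k (n * α + 0) - n * P.c) ≤
      (P.v k ((m + 1 : ℕ) * α + 0) - (m + 1 : ℕ) * P.c) - (P.v k (m * α + 0) - m * P.c) := by
  have hm : (m : ℝ) * α ≤ n * α := mul_le_mul_of_nonneg_right (by exact_mod_cast hmn) hα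
  have := P.increment_antitone k (by positivity) hm hα
  push_cast
  simp only [add_zero, add_mul, one_mul]
  linarith

theorem lt_gregariousness_iff (k : Fin K) (n : ℕ) :
    n < P.gregariousness k ↔ 0 < P.v k (P.αs k * (n + 1)) - P.v k (P.αs k * n) - P.c := by
  have h := lt_sInf_argmax_iff (f := fun x : ℕ => P.v k (x * P.αs k + 0) - x * P.c)
    (P.netBenefit_increment_antitone k (P.αs_nonneg k))
    (by simpa using P.saturates k) n
  unfold gregariousness L
  rw [h]
  push_cast
  simp only [add_zero]
  rw [mul_comm (n + 1 : ℝ), mul_comm (n : ℝ) (P.αs k)]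
  constructor <;> intro h <;> linarith

variable {P}

/-- Needed because `sInf ∅ = 0`: without a maximizer, `Lbar = 0` would say nothing. If every
different-type link were worth more than `c`, compare a point `m * αd` beyond the same-type optimum
`x * αs`: by concavity a step `αd`, and by monotonicity a step `αs`, from `x * αs` would gain more
than `c`, against optimality of `x`. -/
theorem exists_argmax_different (k : Fin K) : ∃ x : ℕ, ∀ y : ℕ,
    P.v k (y * P.αd k + 0) - y * P.c ≤ P.v k (x * P.αd k + 0) - x * P.c := by
  by_contra hcon
  have hanti := P.netBenefit_increment_antitone k (P.αd_nonneg k)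
  have hpos : ∀ n : ℕ, P.c < P.v k ((n + 1) * P.αd k) - P.v k (n * P.αd k) := by
    intro n
    by_contra! hn
    refine hcon (exists_argmax_of_increment_nonpos
      (f := fun x : ℕ => P.v k (x * P.αd k + 0) - x * P.c) hanti (n := n) ?_)
    push_cast
    simp only [add_zero]
    linarith
  have hd : 0 < P.αd k := by
    rcases (P.αd_nonneg k).eq_or_lt with h | h
    · have := hpos 0
      rw [← h] at this
      simp at this
      linarith [P.c_pos]
    · exact h
  obtain ⟨x, hx⟩ := P.saturates k
  obtain ⟨m, hm⟩ := exists_nat_ge (x * P.αs k / P.αd k)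
  have hm' : x * P.αs k ≤ m * P.αd k := by rwa [div_le_iff₀ hd] at hm
  have hxs : 0 ≤ x * P.αs k := mul_nonneg (by positivity) (P.αs_nonneg k)
  have h1 := P.increment_antitone k hxs hm' hd.le
  have h2 := hpos m
  have h3 : P.v k (x * P.αs k + P.αd k) ≤ P.v k (x * P.αs k + P.αs k) :=
    P.v_mono k (by simp; linarith) (by simp; linarith [P.αs_nonneg k]) (by linarith [P.αd_le_αs k])
  have h4 := hx (x + 1)
  push_cast at h4
  rw [add_mul, one_mul] at h4 h2
  linarith

theorem Lbar_eq_zero {k : Fin K} (hk : P.homophilyIndex k = 1) : P.Lbar k 0 = 0 := by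
  unfold homophilyIndex at hk
  -- Division by zero gives `0`, so an index equal to `1` has a nonzero denominator.
  have h0 : (P.L k (P.αd k * P.Lbar k 0) : ℝ) + P.Lbar k 0 ≠ 0 := by
    intro h
    rw [h] at hk
    simp at hk
  rw [div_eq_one_iff_eq h0] at hk
  have : (P.Lbar k 0 : ℝ) = 0 := by linarith
  exact_mod_cast this

theorem one_le_gregariousness {k : Fin K} (hk : P.homophilyIndex k = 1) :
    1 ≤ P.gregariousness k := by
  have h0 := Lbar_eq_zero hk
  unfold homophilyIndex at hk
  rw [h0] at hk
  rw [Nat.one_le_iff_ne_zero]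
  intro h
  simp [show P.L k 0 = 0 from h] at hk

/-- Since `0` maximizes the net benefit of different-type links, already the first one is not worth
`c`; concavity extends this to every later level of benefit. -/
theorem different_increment_le {k : Fin K} (hk : P.homophilyIndex k = 1) {a : ℝ} (ha : 0 ≤ a) :
    P.v k (a + P.αd k) - P.v k a ≤ P.c := by
  have hmem := Nat.sInf_mem (P.exists_argmax_different k)
  have h0 : sInf {x : ℕ | ∀ y : ℕ,
    P.v k (y * P.αd k + 0) - y * P.c ≤ P.v k (x * P.αd k + 0) - x * P.c} = 0 := Lbar_eq_zero hk
  change sInf {x : ℕ | ∀ y : ℕ,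
    P.v k (y * P.αd k + 0) - y * P.c ≤ P.v k (x * P.αd k + 0) - x * P.c} ∈ _ at hmem
  rw [h0] at hmem
  have h1 := hmem 1
  have h2 := P.increment_antitone k le_rfl ha (P.αd_nonneg k)
  simp at h1 h2
  linarith

end Preferences

section Linking

variable {K : ℕ} {P : Preferences K}

/-- The linking rule of an intolerant society. Its hypothesis, that all followees have the agent's
own type, is preserved by the rule itself and becomes part of `Feasible`. -/
theorem marginalUtility_pos_iff (hP : ∀ k, P.homophilyIndex k = 1) {θ : ℕ → Fin K} {G : Network}
    {i : ℕ} (hG : ∀ l ∈ G i, θ l = θ i) (j : ℕ) :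
    0 < marginalUtility P θ G i j ↔ θ j = θ i ∧ (G i).card < P.gregariousness (θ i) := by
  have h1 : (G i).filter (fun l => θ l = θ i) = G i := Finset.filter_true_of_mem hG
  have h2 : (G i).filter (fun l => θ l ≠ θ i) = ∅ :=
    Finset.filter_false_of_mem fun l hl => by simp [hG l hl]
  unfold marginalUtility
  simp only [h1, h2]
  by_cases hj : θ j = θ i
  · simp [hj, P.lt_gregariousness_iff]
  · have := Preferences.different_increment_le (hP (θ i)) (a := P.αs (θ i) * (G i).card)
      (mul_nonneg (P.αs_nonneg _) (by positivity))
    simp [hj]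
    linarith

theorem afterMeeting_some (hP : ∀ k, P.homophilyIndex k = 1) {θ : ℕ → Fin K} {G : Network}
    {i : ℕ} (hG : ∀ l ∈ G i, θ l = θ i) (j : ℕ) :
    afterMeeting P θ G i (some j) =
      if θ j = θ i ∧ (G i).card < P.gregariousness (θ i) then insert j (G i) else G i := by
  simp only [afterMeeting, marginalUtility_pos_iff hP hG]

end Linking

/-! ### Expectations under discrete laws -/

namespace PMF

variable {α β : Type*}

/-- Expectation of an extended nonnegative function. -/
def expect (μ : PMF α) (f : α → ℝ≥0∞) : ℝ≥0∞ := ∑' a, μ a * f a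

theorem expect_bind (μ : PMF α) (κ : α → PMF β) (f : β → ℝ≥0∞) :
    (μ.bind κ).expect f = μ.expect fun a => (κ a).expect f := by
  simp only [expect, bind_apply, ← ENNReal.tsum_mul_left, ← ENNReal.tsum_mul_right]
  rw [ENNReal.tsum_comm]
  simp only [mul_assoc]

theorem expect_pure (a : α) (f : α → ℝ≥0∞) : (PMF.pure a).expect f = f a := by
  rw [expect, tsum_eq_single a]
  · simp
  · intro b hb
    simp [hb]

theorem expect_map (μ : PMF α) (g : α → β) (f : β → ℝ≥0∞) :
    (μ.map g).expect f = μ.expect fun a => f (g a) := by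
  rw [← bind_pure_comp, expect_bind]
  simp [expect_pure]

theorem expect_mono {μ : PMF α} {f g : α → ℝ≥0∞} (h : ∀ a ∈ μ.support, f a ≤ g a) :
    μ.expect f ≤ μ.expect g := by
  refine ENNReal.tsum_le_tsum fun a => ?_
  by_cases ha : a ∈ μ.support
  · exact mul_le_mul_right (h a ha) _
  · rw [mem_support_iff, not_not] at ha
    simp [ha]

theorem expect_congr {μ : PMF α} {f g : α → ℝ≥0∞} (h : ∀ a ∈ μ.support, f a = g a) :
    μ.expect f = μ.expect g :=
  le_antisymm (expect_mono fun a ha => (h a ha).le) (expect_mono fun a ha => (h a ha).ge)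

theorem expect_const (μ : PMF α) (c : ℝ≥0∞) : μ.expect (fun _ => c) = c := by
  rw [expect, ENNReal.tsum_mul_right, μ.tsum_coe, one_mul]

theorem expect_add (μ : PMF α) (f g : α → ℝ≥0∞) :
    μ.expect (fun a => f a + g a) = μ.expect f + μ.expect g := by
  simp only [expect, mul_add, ENNReal.tsum_add]

theorem expect_const_mul (μ : PMF α) (c : ℝ≥0∞) (f : α → ℝ≥0∞) :
    μ.expect (fun a => c * f a) = c * μ.expect f := by
  simp only [expect, mul_left_comm, ENNReal.tsum_mul_left]

theorem expect_mul_const (μ : PMF α) (c : ℝ≥0∞) (f : α → ℝ≥0∞) :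
    μ.expect (fun a => f a * c) = μ.expect f * c := by
  simp only [expect, ← mul_assoc, ENNReal.tsum_mul_right]

theorem expect_sum {ι : Type*} (μ : PMF α) (s : Finset ι) (f : ι → α → ℝ≥0∞) :
    μ.expect (fun a => ∑ i ∈ s, f i a) = ∑ i ∈ s, μ.expect (f i) := by
  classical
  induction s using Finset.induction_on with
  | empty => simp [expect_const]
  | insert i s hi ih => simp only [Finset.sum_insert hi, expect_add, ih]

theorem expect_ite_eq [DecidableEq α] (μ : PMF α) (a : α) (c : ℝ≥0∞) :
    μ.expect (fun x => if x = a then c else 0) = μ a * c := by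
  rw [expect, tsum_eq_single a]
  · simp
  · intro b hb
    simp [hb]

theorem bind_congr_support {μ : PMF α} {f g : α → PMF β} (h : ∀ a ∈ μ.support, f a = g a) :
    μ.bind f = μ.bind g := by
  ext b
  rw [bind_apply, bind_apply]
  refine tsum_congr fun a => ?_
  by_cases ha : a ∈ μ.support
  · rw [h a ha]
  · rw [mem_support_iff, not_not] at ha
    simp [ha]

theorem map_congr_support {μ : PMF α} {f g : α → β} (h : ∀ a ∈ μ.support, f a = g a) :
    μ.map f = μ.map g := by
  rw [← bind_pure_comp, ← bind_pure_comp]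
  exact bind_congr_support fun a ha => by simp [h a ha]

theorem uniformOfFinset_map_some [DecidableEq α] (s : Finset α) (hs : s.Nonempty) (a : α) :
    ((uniformOfFinset s hs).map some) (some a) = if a ∈ s then (s.card : ℝ≥0∞)⁻¹ else 0 := by
  classical
  rw [map_apply, tsum_eq_single a]
  · simp [uniformOfFinset_apply]
  · intro b hb
    simp [Ne.symm hb]

end PMF

/-! ### Feasible networks and meeting probabilities -/

namespace Network

theorem mem_followeesOfFollowees {G : Network} {i l : ℕ} :
    l ∈ G.followeesOfFollowees i ↔ l ≠ i ∧ (∃ m ∈ G i, l ∈ G m) ∧ l ∉ G i := by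
  simp [followeesOfFollowees, and_assoc]

theorem coin_bind_apply {α : Type*} (q : ℝ≥0) (hq : q ≤ 1) (κ : Bool → PMF α) (a : α) :
    ((coin q hq).bind κ) a = q * κ true a + (1 - q) * κ false a := by
  rw [PMF.bind_apply, tsum_bool, add_comm]
  simp [coin, PMF.ofFintype_apply]

end Network

/-- The properties that a network at date `t` has with probability one in an intolerant society. -/
structure Feasible {K : ℕ} (P : Preferences K) (θ : ℕ → Fin K) (t : ℕ) (G : Network) : Prop where
  subset : ∀ j, G j ⊆ Finset.Icc 1 t
  unborn : ∀ j, j ∉ Finset.Icc 1 t → G j = ∅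
  irrefl : ∀ j, j ∉ G j
  same : ∀ j, ∀ l ∈ G j, θ l = θ j
  card_le : ∀ j, (G j).card ≤ P.gregariousness (θ j)

namespace Feasible

variable {K : ℕ} {P : Preferences K} {θ : ℕ → Fin K} {t : ℕ} {G : Network}

theorem followeesOfFollowees_subset (h : Feasible P θ t G) (j : ℕ) :
    G.followeesOfFollowees j ⊆ Finset.Icc 1 t := by
  intro l hl
  obtain ⟨-, ⟨m, -, hm⟩, -⟩ := Network.mem_followeesOfFollowees.1 hl
  exact h.subset m hm

theorem card_followeesOfFollowees_le (h : Feasible P θ t G) (j : ℕ) :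
    (G.followeesOfFollowees j).card ≤ (G j).card * P.gregariousness (θ j) := by
  refine (Finset.card_le_card ?_).trans
    (Finset.card_biUnion_le_card_mul (G j) G (P.gregariousness (θ j)) fun m hm => ?_)
  · exact Finset.sdiff_subset.trans (Finset.erase_subset _ _)
  · rw [← h.same j m hm]
    exact h.card_le m

theorem mem_strangers_iff {j l : ℕ} : l ∈ G.strangers j (t + 1) ↔
    l ∈ Finset.Icc 1 (t + 1) ∧ l ≠ j ∧ l ∉ G j ∧ l ∉ G.followeesOfFollowees j := by
  simp [Network.strangers]
  tauto

/-- Strangers, followees and followees of followees partition the `t` agents other than `j` alive at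
date `t + 1`. -/
theorem card_strangers (h : Feasible P θ t G) {j : ℕ} (hj : j ∈ Finset.Icc 1 (t + 1)) :
    (G.strangers j (t + 1)).card + (G j).card + (G.followeesOfFollowees j).card = t := by
  have hmono : Finset.Icc 1 t ⊆ Finset.Icc 1 (t + 1) := Finset.Icc_subset_Icc_right (by omega)
  have h1 : (G.followeesOfFollowees j ∪ G j ∪ {j}) ⊆ Finset.Icc 1 (t + 1) :=
    Finset.union_subset (Finset.union_subset ((h.followeesOfFollowees_subset j).trans hmono)
      ((h.subset j).trans hmono)) (by simpa using hj)
  have h2 : (G.followeesOfFollowees j ∪ G j ∪ {j}).card =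
      (G.followeesOfFollowees j).card + (G j).card + 1 := by
    rw [Finset.card_union_of_disjoint, Finset.card_union_of_disjoint]
    · simp
    · exact Finset.sdiff_disjoint
    · rw [Finset.disjoint_singleton_right, Finset.mem_union, not_or]
      exact ⟨fun hj => (Network.mem_followeesOfFollowees.1 hj).1 rfl, h.irrefl j⟩
  have h3 := Finset.card_sdiff_add_card_eq_card h1
  rw [h2] at h3
  simp only [Nat.card_Icc] at h3
  unfold Network.strangers
  omega

theorem strangers_nonempty (h : Feasible P θ t G) (ht : 1 ≤ t) {j : ℕ}
    (hj : j ∈ Finset.Icc 1 (t + 1)) : (G.strangers j (t + 1)).Nonempty := by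
  -- For an older agent the newborn `t + 1` is a stranger, as nobody links to it yet; for the
  -- newborn, agent `1` is one.
  by_cases hjt : j ∈ Finset.Icc 1 t
  · refine ⟨t + 1, mem_strangers_iff.2 ⟨by simp, ?_, fun hm => ?_, fun hm => ?_⟩⟩
    · rw [Finset.mem_Icc] at hjt; omega
    · have := h.subset j hm; simp at this
    · have := h.followeesOfFollowees_subset j hm; simp at this
  · have h0 := h.unborn j hjt
    refine ⟨1, mem_strangers_iff.2 ⟨by simp, ?_, by simp [h0], fun hm => ?_⟩⟩
    · rintro rfl; simp at hjt; omega
    · obtain ⟨-, ⟨m, hm, -⟩, -⟩ := Network.mem_followeesOfFollowees.1 hm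
      simp [h0] at hm

theorem mem_support_meetingLaw (h : Feasible P θ t G) {g : ℝ≥0} {j l : ℕ}
    (hl : some l ∈ (G.meetingLaw g j (t + 1)).support) :
    l ∈ Finset.Icc 1 (t + 1) ∧ l ≠ j ∧ l ∉ G j := by
  have hstr : l ∈ G.strangers j (t + 1) → l ∈ Finset.Icc 1 (t + 1) ∧ l ≠ j ∧ l ∉ G j :=
    fun hm => let ⟨a, b, c, _⟩ := mem_strangers_iff.1 hm; ⟨a, b, c⟩
  have hfof : l ∈ G.followeesOfFollowees j → l ∈ Finset.Icc 1 (t + 1) ∧ l ≠ j ∧ l ∉ G j :=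
    fun hm => ⟨Finset.Icc_subset_Icc_right (by omega) (h.followeesOfFollowees_subset j hm),
      (Network.mem_followeesOfFollowees.1 hm).1, (Network.mem_followeesOfFollowees.1 hm).2.2⟩
  unfold Network.meetingLaw at hl
  split_ifs at hl with hS hF
  · rw [PMF.mem_support_bind_iff] at hl
    obtain ⟨b, -, hb⟩ := hl
    split_ifs at hb with hb'
    · simp at hb; exact hfof hb
    · simp at hb; exact hstr hb
  · simp at hl; exact hstr hl
  · simp at hl

theorem meetingLaw_apply (h : Feasible P θ t G) (ht : 1 ≤ t) (g : ℝ≥0) {j : ℕ}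
    (hj : j ∈ Finset.Icc 1 (t + 1)) (l : ℕ) (hF : (G.followeesOfFollowees j).Nonempty) :
    G.meetingLaw g j (t + 1) (some l) =
      ((min 1 (g + (1 - g) * ((G.followeesOfFollowees j).card / (t : ℕ))) : ℝ≥0) : ℝ≥0∞) *
        (if l ∈ G.followeesOfFollowees j then
          ((G.followeesOfFollowees j).card : ℝ≥0∞)⁻¹ else 0) +
      (1 - ((min 1 (g + (1 - g) * ((G.followeesOfFollowees j).card / (t : ℕ))) : ℝ≥0) : ℝ≥0∞)) *
        (if l ∈ G.strangers j (t + 1) then ((G.strangers j (t + 1)).card : ℝ≥0∞)⁻¹ else 0) := by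
  unfold Network.meetingLaw
  rw [dif_pos (h.strangers_nonempty ht hj), dif_pos hF, Network.coin_bind_apply]
  simp only [if_true, Bool.false_eq_true, if_false, PMF.uniformOfFinset_map_some,
    Nat.add_sub_cancel]

theorem meetingLaw_apply_of_empty (h : Feasible P θ t G) (ht : 1 ≤ t) (g : ℝ≥0) {j : ℕ}
    (hj : j ∈ Finset.Icc 1 (t + 1)) (l : ℕ) (hF : ¬ (G.followeesOfFollowees j).Nonempty) :
    G.meetingLaw g j (t + 1) (some l) =
        (if l ∈ G.strangers j (t + 1) then ((G.strangers j (t + 1)).card : ℝ≥0∞)⁻¹ else 0) := by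
  unfold Network.meetingLaw
  rw [dif_pos (h.strangers_nonempty ht hj), dif_neg hF, PMF.uniformOfFinset_map_some]

/-- Without followees everybody else is a stranger, so opportunism plays no role. This makes agents
without followees tractable for every value of `γ`. -/
theorem meetingLaw_of_no_followees (h : Feasible P θ t G) (ht : 1 ≤ t) (g : ℝ≥0) {j l : ℕ}
    (hj : j ∈ Finset.Icc 1 (t + 1)) (h0 : G j = ∅) (hl : l ∈ Finset.Icc 1 (t + 1)) (hlj : l ≠ j) :
    G.meetingLaw g j (t + 1) (some l) = (t : ℝ≥0∞)⁻¹ := by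
  have hF : G.followeesOfFollowees j = ∅ := by
    ext l
    simp [Network.mem_followeesOfFollowees, h0]
  rw [h.meetingLaw_apply_of_empty ht g hj l (by simp [hF]), if_pos]
  · have := h.card_strangers hj
    rw [hF, h0] at this
    simp at this
    rw [this]
  · exact mem_strangers_iff.2 ⟨hl, hlj, by simp [h0], by simp [hF]⟩

theorem meetingLaw_one_of_mem (h : Feasible P θ t G) (ht : 1 ≤ t) {j l : ℕ}
    (hj : j ∈ Finset.Icc 1 (t + 1)) (hl : l ∈ G.followeesOfFollowees j) :
    G.meetingLaw 1 j (t + 1) (some l) = ((G.followeesOfFollowees j).card : ℝ≥0∞)⁻¹ := by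
  rw [h.meetingLaw_apply ht 1 hj l ⟨l, hl⟩, if_pos hl]
  simp

/-- Under `γ = 0` everybody who is not yet a followee is met with probability about `1 / t`. -/
theorem meetingLaw_zero_bounds (h : Feasible P θ t G) (ht : 1 ≤ t) {j l : ℕ}
    (hj : j ∈ Finset.Icc 1 (t + 1)) (hl : l ∈ Finset.Icc 1 (t + 1)) (hlj : l ≠ j) (hlG : l ∉ G j) :
    (t : ℝ≥0∞)⁻¹ ≤ G.meetingLaw 0 j (t + 1) (some l) ∧
    G.meetingLaw 0 j (t + 1) (some l) ≤
      ((t - (P.gregariousness (θ j) + P.gregariousness (θ j) * P.gregariousness (θ j)) : ℕ) :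
        ℝ≥0∞)⁻¹ := by
  have hcard := h.card_strangers hj
  have hf := h.card_followeesOfFollowees_le j
  have hd := h.card_le j
  have hS := (h.strangers_nonempty ht hj).card_pos
  have hfL := hf.trans (Nat.mul_le_mul_right _ hd)
  set s := (G.strangers j (t + 1)).card with hs
  set d := (G j).card
  set f := (G.followeesOfFollowees j).card with hfdef
  -- At most `L` followees and `L * L` followees of followees are missing from the strangers.
  set C := P.gregariousness (θ j) + P.gregariousness (θ j) * P.gregariousness (θ j)
  have ht0 : (t : ℝ≥0∞) ≠ 0 := by simp; omega
  have ht1 : (t : ℝ≥0∞) ≠ ⊤ := by simp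
  have hle : ((t : ℝ≥0∞))⁻¹ ≤ ((t - C : ℕ) : ℝ≥0∞)⁻¹ := by
    rw [ENNReal.inv_le_inv]; exact_mod_cast Nat.sub_le _ _
  have hsle : ((s : ℝ≥0∞))⁻¹ ≤ ((t - C : ℕ) : ℝ≥0∞)⁻¹ := by
    rw [ENNReal.inv_le_inv]; exact_mod_cast (by omega)
  have hts : ((t : ℝ≥0∞))⁻¹ ≤ (s : ℝ≥0∞)⁻¹ := by
    rw [ENNReal.inv_le_inv]; exact_mod_cast (by omega)
  by_cases hF : (G.followeesOfFollowees j).Nonempty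
  · have hf0 : (f : ℝ≥0∞) ≠ 0 := by simpa [hfdef, Finset.card_eq_zero] using hF.ne_empty
    have hq : ((min 1 ((0 : ℝ≥0) + (1 - 0) * ((f : ℝ≥0) / (t : ℕ))) : ℝ≥0) : ℝ≥0∞) = f / t := by
      rw [zero_add, tsub_zero, one_mul, min_eq_right]
      · rw [ENNReal.coe_div (by simp; omega)]; simp
      · rw [div_le_one₀ (by simp; omega)]; exact_mod_cast (by omega)
    rw [h.meetingLaw_apply ht 0 hj l hF, hq]
    by_cases hlF : l ∈ G.followeesOfFollowees j
    · have hlS : l ∉ G.strangers j (t + 1) := fun hm => (mem_strangers_iff.1 hm).2.2.2 hlF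
      -- The set is chosen with probability `f / t` and its member with probability `1 / f`: exactly
      -- `1 / t`.
      have he : (f : ℝ≥0∞) / t * (f : ℝ≥0∞)⁻¹ = (t : ℝ≥0∞)⁻¹ := by
        rw [div_eq_mul_inv, mul_right_comm, ENNReal.mul_inv_cancel hf0 (by simp), one_mul]
      simp only [if_pos hlF, if_neg hlS, mul_zero, add_zero, ← hfdef, he]
      exact ⟨le_rfl, hle⟩
    · have hlS : l ∈ G.strangers j (t + 1) := mem_strangers_iff.2 ⟨hl, hlj, hlG, hlF⟩
      -- A given stranger is met with probability `(s + d) / (t * s)`, which lies between `1 / t`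
      -- and `1 / s`; the excess over `1 / t` comes from the followees, who are never met.
      have hsum : (1 : ℝ≥0∞) - f / t = (s + d : ℕ) / t := by
        refine ENNReal.sub_eq_of_eq_add (ENNReal.div_ne_top (by simp) ht0) ?_
        rw [← ENNReal.add_div, ← Nat.cast_add, hcard, ENNReal.div_self ht0 ht1]
      simp only [if_pos hlS, if_neg hlF, mul_zero, zero_add, hsum, ← hs]
      constructor
      · calc (t : ℝ≥0∞)⁻¹ = s / t * (s : ℝ≥0∞)⁻¹ := by
              rw [div_eq_mul_inv, mul_right_comm, ENNReal.mul_inv_cancel (by simp; omega) (by simp),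
                one_mul]
          _ ≤ _ := by gcongr; omega
      · calc ((s + d : ℕ) : ℝ≥0∞) / t * (s : ℝ≥0∞)⁻¹ ≤ 1 * (s : ℝ≥0∞)⁻¹ := by
              gcongr
              refine ENNReal.div_le_of_le_mul ?_
              rw [one_mul]; exact_mod_cast (by omega)
          _ ≤ _ := by rw [one_mul]; exact hsle
  · have hlF : l ∉ G.followeesOfFollowees j := fun hm => hF ⟨l, hm⟩
    rw [h.meetingLaw_apply_of_empty ht 0 hj l hF,
      if_pos (mem_strangers_iff.2 ⟨hl, hlj, hlG, hlF⟩)]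
    exact ⟨hts, hsle⟩

end Feasible

/-! ### Evolution over one date -/

section Dynamics

variable {K : ℕ} {P : Preferences K} {γ : Fin K → ℝ≥0} {θ : ℕ → Fin K} {t : ℕ} {G : Network}

/-- The network after the meetings `m`. -/
def afterMeetings (P : Preferences K) (θ : ℕ → Fin K) (G : Network) (m : ℕ → Option ℕ) : Network :=
  fun j => afterMeeting P θ G j (m j)

theorem mem_support_meetings {s n : ℕ} {m : ℕ → Option ℕ}
    (hm : m ∈ (meetings γ θ G s n).support) :
    (∀ j, j ∉ Finset.Icc 1 n → m j = none) ∧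
      ∀ j ∈ Finset.Icc 1 n, m j ∈ (G.meetingLaw (γ (θ j)) j s).support := by
  induction n generalizing m with
  | zero =>
    simp only [meetings, PMF.support_pure, Set.mem_singleton_iff] at hm
    subst hm
    simp
  | succ n ih =>
    simp only [meetings, PMF.mem_support_bind_iff, PMF.mem_support_map_iff] at hm
    obtain ⟨m', hm', x, hx, rfl⟩ := hm
    obtain ⟨h1, h2⟩ := ih hm'
    constructor
    · intro j hj
      rw [Function.update_of_ne]
      · refine h1 j fun h => hj ?_
        simp at h ⊢; omega
      · rintro rfl; simp at hj
    · intro j hj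
      by_cases hjn : j = n + 1
      · subst hjn; simpa using hx
      · rw [Function.update_of_ne hjn]
        refine h2 j ?_
        simp at hj ⊢; omega

/-- Only these one-agent marginals of the joint law are used: the functionals to be estimated are
reduced by linearity to single agents' meetings. -/
theorem expect_meetings {s n j : ℕ} (hj : j ∈ Finset.Icc 1 n) (h : Option ℕ → ℝ≥0∞) :
    (meetings γ θ G s n).expect (fun m => h (m j)) =
      (G.meetingLaw (γ (θ j)) j s).expect h := by
  induction n with
  | zero => simp at hj
  | succ n ih =>
    simp only [meetings, PMF.expect_bind, PMF.expect_map]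
    by_cases hjn : j = n + 1
    · subst hjn
      simp [PMF.expect_const]
    · simp only [Function.update_of_ne hjn, PMF.expect_const]
      refine ih ?_
      simp at hj ⊢; omega

theorem expect_networkLaw_succ (f : Network → ℝ≥0∞) :
    (networkLaw P γ θ (t + 1)).expect f = (networkLaw P γ θ t).expect fun G =>
      (meetings γ θ G (t + 1) (t + 1)).expect fun m => f (afterMeetings P θ G m) := by
  rw [networkLaw, PMF.expect_bind]
  simp only [PMF.expect_map]
  rfl

theorem subset_afterMeeting (j : ℕ) (x : Option ℕ) : G j ⊆ afterMeeting P θ G j x := by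
  cases x with
  | none => rfl
  | some l =>
    simp only [afterMeeting]
    split_ifs
    · exact Finset.subset_insert _ _
    · rfl

theorem Feasible.afterMeetings (hP : ∀ k, P.homophilyIndex k = 1) (h : Feasible P θ t G)
    {m : ℕ → Option ℕ} (hm : m ∈ (meetings γ θ G (t + 1) (t + 1)).support) :
    Feasible P θ (t + 1) (afterMeetings P θ G m) := by
  obtain ⟨hm1, hm2⟩ := mem_support_meetings hm
  -- Each followee set either stays or gains one new same-type member while below the cap; every
  -- clause of feasibility follows from this dichotomy.
  have key : ∀ j, afterMeeting P θ G j (m j) = G j ∨ ∃ l, l ∈ Finset.Icc 1 (t + 1) ∧ l ≠ j ∧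
      θ l = θ j ∧ (G j).card < P.gregariousness (θ j) ∧ l ∉ G j ∧
      afterMeeting P θ G j (m j) = insert l (G j) := by
    intro j
    by_cases hj : j ∈ Finset.Icc 1 (t + 1)
    · have hs := hm2 j hj
      cases hx : m j with
      | none => left; rfl
      | some l =>
        rw [hx] at hs
        obtain ⟨hl, hlj, hlG⟩ := h.mem_support_meetingLaw hs
        rw [afterMeeting_some hP (h.same j)]
        split_ifs with hc
        · exact Or.inr ⟨l, hl, hlj, hc.1, hc.2, hlG, rfl⟩
        · exact Or.inl rfl
    · rw [hm1 j hj]; left; rfl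
  have hmono : Finset.Icc 1 t ⊆ Finset.Icc 1 (t + 1) := Finset.Icc_subset_Icc_right (by omega)
  constructor
  · intro j
    change afterMeeting P θ G j (m j) ⊆ _
    rcases key j with h' | ⟨l, hl, -, -, -, -, h'⟩ <;> rw [h']
    · exact (h.subset j).trans hmono
    · exact Finset.insert_subset hl ((h.subset j).trans hmono)
  · intro j hj
    change afterMeeting P θ G j (m j) = _
    rw [hm1 j hj]
    exact h.unborn j fun hj' => hj (hmono hj')
  · intro j
    change j ∉ afterMeeting P θ G j (m j)
    rcases key j with h' | ⟨l, -, hl, -, -, -, h'⟩ <;> rw [h']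
    · exact h.irrefl j
    · simp [hl.symm, h.irrefl j]
  · intro j
    change ∀ l ∈ afterMeeting P θ G j (m j), _
    rcases key j with h' | ⟨l, -, -, hl, -, -, h'⟩ <;> rw [h']
    · exact h.same j
    · simpa [hl] using h.same j
  · intro j
    change (afterMeeting P θ G j (m j)).card ≤ _
    rcases key j with h' | ⟨l, -, -, -, hc, hl, h'⟩ <;> rw [h']
    · exact h.card_le j
    · rw [Finset.card_insert_of_notMem hl]; omega

theorem feasible_of_mem_support (hP : ∀ k, P.homophilyIndex k = 1)
    (hG : G ∈ (networkLaw P γ θ t).support) : Feasible P θ t G := by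
  induction t generalizing G with
  | zero =>
    simp only [networkLaw, PMF.support_pure, Set.mem_singleton_iff] at hG
    subst hG
    constructor <;> simp
  | succ t ih =>
    simp only [networkLaw, PMF.mem_support_bind_iff, PMF.mem_support_map_iff] at hG
    obtain ⟨G', hG', m, hm, rfl⟩ := hG
    exact (ih hG').afterMeetings hP hm

theorem meetings_congr {θ' : ℕ → Fin K} {s n : ℕ} (h : ∀ j ≤ n, θ j = θ' j) :
    meetings γ θ G s n = meetings γ θ' G s n := by
  induction n with
  | zero => rfl
  | succ n ih => rw [meetings, meetings, ih fun j hj => h j (by omega), h (n + 1) le_rfl]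

theorem Feasible.afterMeeting_congr (h : Feasible P θ t G) {θ' : ℕ → Fin K} {s j l : ℕ}
    (hts : t ≤ s) (hθ : ∀ j ≤ s, θ j = θ' j) (hj : j ≤ s) (hl : l ≤ s) :
    afterMeeting P θ G j (some l) = afterMeeting P θ' G j (some l) := by
  have hf : ∀ l ∈ G j, θ l = θ' l := fun l hl => hθ l (by
    have := h.subset j hl
    rw [Finset.mem_Icc] at this; omega)
  have h1 : marginalUtility P θ G j l = marginalUtility P θ' G j l := by
    unfold marginalUtility
    simp only [hθ j hj, hθ l hl]
    rw [Finset.filter_congr fun l hl => by rw [hf l hl],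
      Finset.filter_congr (s := G j) (p := fun l => θ l ≠ θ' j) fun l hl => by rw [hf l hl]]
  simp only [afterMeeting, h1]

/-- The network at date `t` depends on the types of the agents born until then only. -/
theorem networkLaw_congr (hP : ∀ k, P.homophilyIndex k = 1) {θ' : ℕ → Fin K}
    (hθ : ∀ j ≤ t, θ j = θ' j) : networkLaw P γ θ t = networkLaw P γ θ' t := by
  induction t with
  | zero => rfl
  | succ t ih =>
    rw [networkLaw, networkLaw, ← ih fun j hj => hθ j (by omega)]
    refine PMF.bind_congr_support fun G hG => ?_
    have hfeas := feasible_of_mem_support hP hG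
    rw [← meetings_congr hθ]
    refine PMF.map_congr_support fun m hm => ?_
    obtain ⟨hm1, hm2⟩ := mem_support_meetings hm
    funext j
    cases hx : m j with
    | none => rfl
    | some l =>
      by_cases hj : j ∈ Finset.Icc 1 (t + 1)
      · have hl := (hfeas.mem_support_meetingLaw (hx ▸ hm2 j hj)).1
        rw [Finset.mem_Icc] at hj hl
        exact hfeas.afterMeeting_congr (Nat.le_succ t) hθ hj.2 hl.2
      · rw [hm1 j hj] at hx
        cases hx

end Dynamics

/-! ### Expected one-date changes of sums over agents -/

section Step

variable {K : ℕ} {P : Preferences K} {γ : Fin K → ℝ≥0} {θ : ℕ → Fin K} {t : ℕ} {G : Network}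

/-- The agents born until date `t` to whom `j` would link on meeting them, unless saturated. -/
def linkable (θ : ℕ → Fin K) (G : Network) (t j : ℕ) : Finset ℕ :=
  ((Finset.Icc 1 t).filter fun l => θ l = θ j) \ insert j (G j)

theorem mem_linkable {j l : ℕ} :
    l ∈ linkable θ G t j ↔ (l ∈ Finset.Icc 1 t ∧ θ l = θ j) ∧ l ≠ j ∧ l ∉ G j := by
  simp [linkable]

/-- The agents born until date `t` who still accept links. -/
def unsaturated (P : Preferences K) (θ : ℕ → Fin K) (G : Network) (t : ℕ) : Finset ℕ :=
  (Finset.Icc 1 t).filter fun j => (G j).card < P.gregariousness (θ j)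

theorem mem_unsaturated {j : ℕ} : j ∈ unsaturated P θ G t ↔
    j ∈ Finset.Icc 1 t ∧ (G j).card < P.gregariousness (θ j) := by
  simp [unsaturated]

/-- The number of agents of type `k` born until date `t`. -/
def typeCount (θ : ℕ → Fin K) (k : Fin K) (t : ℕ) : ℕ :=
  ((Finset.Icc 1 t).filter fun j => θ j = k).card

theorem card_linkable_le (j : ℕ) : (linkable θ G t j).card ≤ typeCount θ (θ j) t :=
  Finset.card_le_card Finset.sdiff_subset

theorem le_card_linkable (j : ℕ) :
    typeCount θ (θ j) t - (1 + (G j).card) ≤ (linkable θ G t j).card := by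
  have h1 := Finset.le_card_sdiff (insert j (G j)) ((Finset.Icc 1 t).filter fun l => θ l = θ j)
  have h2 := Finset.card_insert_le j (G j)
  unfold typeCount linkable
  omega

theorem afterMeeting_of_notMem_unsaturated (hP : ∀ k, P.homophilyIndex k = 1)
    (h : Feasible P θ t G) {j s : ℕ} (hj : j ∈ Finset.Icc 1 s) (hu : j ∉ unsaturated P θ G s)
    (x : Option ℕ) : afterMeeting P θ G j x = G j := by
  cases x with
  | none => rfl
  | some l =>
    rw [afterMeeting_some hP (h.same j), if_neg]
    rintro ⟨-, hc⟩
    exact hu (mem_unsaturated.2 ⟨hj, hc⟩)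

theorem afterMeeting_cases (hP : ∀ k, P.homophilyIndex k = 1)
    (h : Feasible P θ t G) {j : ℕ} {g : ℝ≥0} (hu : j ∈ unsaturated P θ G (t + 1))
    {x : Option ℕ} (hx : x ∈ (G.meetingLaw g j (t + 1)).support) :
    (afterMeeting P θ G j x = G j ∧ ∀ l ∈ linkable θ G (t + 1) j, x ≠ some l) ∨
    ∃ l ∈ linkable θ G (t + 1) j, x = some l ∧ afterMeeting P θ G j x = insert l (G j) := by
  cases x with
  | none => left; exact ⟨rfl, by simp⟩
  | some l =>
    obtain ⟨hl, hlj, hlG⟩ := h.mem_support_meetingLaw hx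
    rw [afterMeeting_some hP (h.same j)]
    have hc := (mem_unsaturated.1 hu).2
    by_cases hθ : θ l = θ j
    · right
      exact ⟨l, mem_linkable.2 ⟨⟨hl, hθ⟩, hlj, hlG⟩, rfl, if_pos ⟨hθ, hc⟩⟩
    · left
      refine ⟨if_neg fun h => hθ h.1, ?_⟩
      rintro l' hl' h'
      simp only [Option.some.injEq] at h'
      subst h'
      exact hθ (mem_linkable.1 hl').1.2

theorem sum_ite_some_eq {s : Finset ℕ} {l : ℕ} (hl : l ∈ s) (c : ℕ → ℝ≥0∞) :
    ∑ l' ∈ s, (if some l = some l' then c l' else 0) = c l := by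
  simp [hl]

theorem sum_ite_some_eq_zero {s : Finset ℕ} {x : Option ℕ} (hx : ∀ l ∈ s, x ≠ some l)
    (c : ℕ → ℝ≥0∞) : ∑ l ∈ s, (if x = some l then c l else 0) = 0 :=
  Finset.sum_eq_zero fun l hl => if_neg (hx l hl)

theorem expect_add_sum_ite (μ : PMF (Option ℕ)) (a : ℝ≥0∞) (s : Finset ℕ) (c : ℕ → ℝ≥0∞) :
    μ.expect (fun x => a + ∑ l ∈ s, (if x = some l then c l else 0)) =
      a + ∑ l ∈ s, μ (some l) * c l := by
  rw [PMF.expect_add, PMF.expect_const, PMF.expect_sum]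
  simp only [PMF.expect_ite_eq]

/-- The followee set of an unsaturated agent changes only by inserting a linkable agent, and does so
whenever that agent is met. Hence the drift of `φ` is a sum of meeting probabilities times gains. -/
theorem le_expect_afterMeeting (hP : ∀ k, P.homophilyIndex k = 1)
    (h : Feasible P θ t G) {j : ℕ} {g : ℝ≥0} (hu : j ∈ unsaturated P θ G (t + 1))
    {φ : Finset ℕ → ℝ≥0∞} {c : ℕ → ℝ≥0∞}
    (hφ : ∀ l ∈ linkable θ G (t + 1) j, φ (G j) + c l ≤ φ (insert l (G j))) :
    φ (G j) + ∑ l ∈ linkable θ G (t + 1) j, G.meetingLaw g j (t + 1) (some l) * c l ≤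
      (G.meetingLaw g j (t + 1)).expect fun x => φ (afterMeeting P θ G j x) := by
  rw [← expect_add_sum_ite]
  refine PMF.expect_mono fun x hx => ?_
  rcases afterMeeting_cases hP h hu hx with ⟨h1, h2⟩ | ⟨l, hl, rfl, h2⟩
  · rw [h1, sum_ite_some_eq_zero h2, add_zero]
  · rw [h2, sum_ite_some_eq hl]
    exact hφ l hl

theorem expect_afterMeeting_le (hP : ∀ k, P.homophilyIndex k = 1)
    (h : Feasible P θ t G) {j : ℕ} {g : ℝ≥0} (hu : j ∈ unsaturated P θ G (t + 1))
    {φ : Finset ℕ → ℝ≥0∞} {c : ℕ → ℝ≥0∞}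
    (hφ : ∀ l ∈ linkable θ G (t + 1) j, φ (insert l (G j)) ≤ φ (G j) + c l) :
    ((G.meetingLaw g j (t + 1)).expect fun x => φ (afterMeeting P θ G j x)) ≤
    φ (G j) + ∑ l ∈ linkable θ G (t + 1) j, G.meetingLaw g j (t + 1) (some l) * c l := by
  rw [← expect_add_sum_ite]
  refine PMF.expect_mono fun x hx => ?_
  rcases afterMeeting_cases hP h hu hx with ⟨h1, h2⟩ | ⟨l, hl, rfl, h2⟩
  · rw [h1, sum_ite_some_eq_zero h2, add_zero]
  · rw [h2, sum_ite_some_eq hl]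
    exact hφ l hl

theorem sum_Icc_succ_of_feasible (h : Feasible P θ t G) {φ : ℕ → Finset ℕ → ℝ≥0∞}
    (h0 : ∀ j, φ j ∅ = 0) :
    ∑ j ∈ Finset.Icc 1 (t + 1), φ j (G j) = ∑ j ∈ Finset.Icc 1 t, φ j (G j) := by
  rw [Finset.sum_Icc_succ_top (by omega), h.unborn (t + 1) (by simp), h0, add_zero]

theorem sum_unsaturated_eq (f : ℕ → ℝ≥0∞) :
    ∑ j ∈ unsaturated P θ G t, f j =
      ∑ j ∈ Finset.Icc 1 t, if j ∈ unsaturated P θ G t then f j else 0 := by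
  rw [← Finset.sum_filter]
  refine Finset.sum_congr ?_ fun _ _ => rfl
  ext j
  simp +contextual [mem_unsaturated]

theorem expect_sum_afterMeetings (φ : ℕ → Finset ℕ → ℝ≥0∞) :
    ((meetings γ θ G (t + 1) (t + 1)).expect fun m =>
      ∑ j ∈ Finset.Icc 1 (t + 1), φ j (afterMeetings P θ G m j)) =
    ∑ j ∈ Finset.Icc 1 (t + 1), (G.meetingLaw (γ (θ j)) j (t + 1)).expect fun x =>
      φ j (afterMeeting P θ G j x) := by
  rw [PMF.expect_sum]
  exact Finset.sum_congr rfl fun j hj =>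
    expect_meetings hj fun x => φ j (afterMeeting P θ G j x)

/-- The drift principle summed over agents: saturated agents do not move, and `φ j ∅ = 0` makes the
arrival of the newborn free. The choice of `φ` yields total links or popularity. -/
theorem le_expect_sum_afterMeetings (hP : ∀ k, P.homophilyIndex k = 1)
    (h : Feasible P θ t G) {φ : ℕ → Finset ℕ → ℝ≥0∞} (h0 : ∀ j, φ j ∅ = 0) {c : ℕ → ℕ → ℝ≥0∞}
    (hφ : ∀ j, ∀ l ∈ linkable θ G (t + 1) j, φ j (G j) + c j l ≤ φ j (insert l (G j))) :
    ∑ j ∈ Finset.Icc 1 t, φ j (G j) + ∑ j ∈ unsaturated P θ G (t + 1),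
      ∑ l ∈ linkable θ G (t + 1) j, G.meetingLaw (γ (θ j)) j (t + 1) (some l) * c j l ≤
    (meetings γ θ G (t + 1) (t + 1)).expect fun m =>
      ∑ j ∈ Finset.Icc 1 (t + 1), φ j (afterMeetings P θ G m j) := by
  rw [expect_sum_afterMeetings, ← sum_Icc_succ_of_feasible h h0, sum_unsaturated_eq,
    ← Finset.sum_add_distrib]
  refine Finset.sum_le_sum fun j hj => ?_
  split_ifs with hu
  · exact le_expect_afterMeeting hP h hu (hφ j)
  · simp only [afterMeeting_of_notMem_unsaturated hP h hj hu, PMF.expect_const, add_zero, le_refl]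

theorem expect_sum_afterMeetings_le (hP : ∀ k, P.homophilyIndex k = 1)
    (h : Feasible P θ t G) {φ : ℕ → Finset ℕ → ℝ≥0∞} (h0 : ∀ j, φ j ∅ = 0) {c : ℕ → ℕ → ℝ≥0∞}
    (hφ : ∀ j, ∀ l ∈ linkable θ G (t + 1) j, φ j (insert l (G j)) ≤ φ j (G j) + c j l) :
    ((meetings γ θ G (t + 1) (t + 1)).expect fun m =>
      ∑ j ∈ Finset.Icc 1 (t + 1), φ j (afterMeetings P θ G m j)) ≤
    ∑ j ∈ Finset.Icc 1 t, φ j (G j) + ∑ j ∈ unsaturated P θ G (t + 1),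
      ∑ l ∈ linkable θ G (t + 1) j, G.meetingLaw (γ (θ j)) j (t + 1) (some l) * c j l := by
  rw [expect_sum_afterMeetings, ← sum_Icc_succ_of_feasible h h0, sum_unsaturated_eq,
    ← Finset.sum_add_distrib]
  refine Finset.sum_le_sum fun j hj => ?_
  split_ifs with hu
  · exact expect_afterMeeting_le hP h hu (hφ j)
  · simp only [afterMeeting_of_notMem_unsaturated hP h hj hu, PMF.expect_const, add_zero, le_refl]

theorem indegree_eq_sum (G : Network) (i t : ℕ) :
    (G.indegree i t : ℝ≥0∞) = ∑ j ∈ Finset.Icc 1 t, if i ∈ G j then 1 else 0 := by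
  simp [Network.indegree]

/-- The number of links that the agents of type `k` have formed. -/
def outLinks (θ : ℕ → Fin K) (k : Fin K) (t : ℕ) (G : Network) : ℝ≥0∞ :=
  ∑ j ∈ Finset.Icc 1 t, if θ j = k then ((G j).card : ℝ≥0∞) else 0

/-- The links formed by the same-type agents of `i`, counting a follower of `i` as saturated. -/
def cappedLinks (P : Preferences K) (θ : ℕ → Fin K) (i t : ℕ) (G : Network) : ℝ≥0∞ :=
  ∑ j ∈ Finset.Icc 1 t, if θ j = θ i ∧ j ≠ i then
    (if i ∈ G j then (P.gregariousness (θ i) : ℝ≥0∞) else (G j).card) else 0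

/-- The unsaturated agents of type `k`. -/
def searchers (P : Preferences K) (θ : ℕ → Fin K) (k : Fin K) (t : ℕ) (G : Network) : Finset ℕ :=
  (unsaturated P θ G t).filter fun j => θ j = k

/-- The unsaturated agents that would link to `i`. -/
def admirers (P : Preferences K) (θ : ℕ → Fin K) (i t : ℕ) (G : Network) : Finset ℕ :=
  (unsaturated P θ G t).filter fun j => θ j = θ i ∧ j ≠ i ∧ i ∉ G j

/-- A searcher can link to all agents of its type but itself and its at most `L` followees, each met
with probability at least `1 / t`. -/
theorem expect_outLinks_step (hP : ∀ k, P.homophilyIndex k = 1) (h : Feasible P θ t G)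
    (ht : 1 ≤ t) (k : Fin K) :
    outLinks θ k t G + (searchers P θ k (t + 1) G).card *
      ((typeCount θ k (t + 1) - (1 + P.gregariousness k) : ℕ) * (t : ℝ≥0∞)⁻¹) ≤
    (meetings (fun _ => 0) θ G (t + 1) (t + 1)).expect fun m =>
      outLinks θ k (t + 1) (afterMeetings P θ G m) := by
  refine le_trans ?_ (le_expect_sum_afterMeetings hP h (γ := fun _ => 0)
    (φ := fun j A => if θ j = k then (A.card : ℝ≥0∞) else 0) (by simp)
    (c := fun j l => if θ j = k then 1 else 0) ?_)
  · refine add_le_add le_rfl ?_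
    rw [← nsmul_eq_mul, ← Finset.sum_const, searchers, Finset.sum_filter]
    refine Finset.sum_le_sum fun j hj => ?_
    split_ifs with hθ
    · subst hθ
      have hj' := mem_unsaturated.1 hj
      calc _ ≤ ((linkable θ G (t + 1) j).card : ℝ≥0∞) * (t : ℝ≥0∞)⁻¹ := by
            have := le_card_linkable (θ := θ) (G := G) (t := t + 1) j
            gcongr
            omega
        _ = ∑ l ∈ linkable θ G (t + 1) j, (t : ℝ≥0∞)⁻¹ := by simp
        _ ≤ _ := by
            refine Finset.sum_le_sum fun l hl => ?_
            rw [mul_one]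
            obtain ⟨⟨hl1, hl2⟩, hl3, hl4⟩ := mem_linkable.1 hl
            exact (h.meetingLaw_zero_bounds ht hj'.1 hl1 hl3 hl4).1
    · exact zero_le
  · intro j l hl
    have := (mem_linkable.1 hl).2.2
    simp only [Finset.card_insert_of_notMem this]
    split_ifs <;> simp

/-- Followers of `i` already count as full, so only admirers add to the sum: at most `1` for each
possible link, and at most `L` more if the link goes to `i`. This is the source of the factor
`typeCount + L`. -/
theorem expect_cappedLinks_step (hP : ∀ k, P.homophilyIndex k = 1) (h : Feasible P θ t G)
    (ht : 1 ≤ t) (i : ℕ) :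
    ((meetings (fun _ => 0) θ G (t + 1) (t + 1)).expect fun m =>
      cappedLinks P θ i (t + 1) (afterMeetings P θ G m)) ≤
    cappedLinks P θ i t G + (admirers P θ i (t + 1) G).card *
      ((typeCount θ (θ i) (t + 1) + P.gregariousness (θ i) : ℕ) *
        ((t - (P.gregariousness (θ i) + P.gregariousness (θ i) * P.gregariousness (θ i)) : ℕ) :
          ℝ≥0∞)⁻¹) := by
  set L := P.gregariousness (θ i) with hL
  set q := ((t - (L + L * L) : ℕ) : ℝ≥0∞)⁻¹ with hq
  refine (expect_sum_afterMeetings_le hP h (γ := fun _ => 0)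
    (φ := fun j A => if θ j = θ i ∧ j ≠ i then
      (if i ∈ A then (L : ℝ≥0∞) else A.card) else 0) (by simp)
    (c := fun j l => if θ j = θ i ∧ j ≠ i ∧ i ∉ G j then 1 + (if l = i then (L : ℝ≥0∞) else 0)
      else 0) ?_).trans ?_
  · intro j l hl
    have hl' := (mem_linkable.1 hl).2.2
    by_cases hj : θ j = θ i ∧ j ≠ i
    · by_cases hi : i ∈ G j
      · simp [hj, hi]
      · by_cases hli : l = i
        · subst hli
          rw [if_pos hj, if_pos hj, if_neg hi, if_pos (Finset.mem_insert_self _ _),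
            if_pos ⟨hj.1, hj.2, hi⟩, if_pos rfl, ← add_assoc]
          exact le_add_self
        · simp [hj, hi, hli, Ne.symm hli, Finset.card_insert_of_notMem hl']
    · rw [if_neg hj]; exact zero_le
  · refine add_le_add le_rfl ?_
    rw [← nsmul_eq_mul, ← Finset.sum_const, admirers, Finset.sum_filter]
    refine Finset.sum_le_sum fun j hj => ?_
    split_ifs with hc
    · have hj' := mem_unsaturated.1 hj
      calc _ ≤ ∑ l ∈ linkable θ G (t + 1) j, q * (1 + if l = i then (L : ℝ≥0∞) else 0) := by
            refine Finset.sum_le_sum fun l hl => ?_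
            obtain ⟨⟨hl1, hl2⟩, hl3, hl4⟩ := mem_linkable.1 hl
            have := (h.meetingLaw_zero_bounds ht hj'.1 hl1 hl3 hl4).2
            rw [hc.1, ← hL] at this
            gcongr
        _ = q * ((linkable θ G (t + 1) j).card +
              ∑ l ∈ linkable θ G (t + 1) j, if l = i then (L : ℝ≥0∞) else 0) := by
            rw [← Finset.mul_sum, Finset.sum_add_distrib]; simp
        _ ≤ q * (typeCount θ (θ i) (t + 1) + L) := by
            gcongr
            · rw [← hc.1]; exact card_linkable_le j
            · rw [Finset.sum_ite_eq']; split_ifs <;> simp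
        _ = _ := by push_cast; ring
    · simp

theorem le_expect_indegree_step (hP : ∀ k, P.homophilyIndex k = 1) (h : Feasible P θ t G)
    (ht : 1 ≤ t) {i : ℕ} (hi : i ∈ Finset.Icc 1 (t + 1)) :
    (G.indegree i t : ℝ≥0∞) + (admirers P θ i (t + 1) G).card * (t : ℝ≥0∞)⁻¹ ≤
    (meetings (fun _ => 0) θ G (t + 1) (t + 1)).expect fun m =>
      ((afterMeetings P θ G m).indegree i (t + 1) : ℝ≥0∞) := by
  simp only [indegree_eq_sum]
  refine le_trans ?_ (le_expect_sum_afterMeetings hP h (γ := fun _ => 0)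
    (φ := fun j A => if i ∈ A then 1 else 0) (by simp)
    (c := fun j l => if l = i then 1 else 0) ?_)
  · refine add_le_add le_rfl ?_
    rw [← nsmul_eq_mul, ← Finset.sum_const, admirers, Finset.sum_filter]
    refine Finset.sum_le_sum fun j hj => ?_
    split_ifs with hc
    · have hj' := mem_unsaturated.1 hj
      have hil : i ∈ linkable θ G (t + 1) j :=
        mem_linkable.2 ⟨⟨hi, hc.1.symm⟩, hc.2.1.symm, hc.2.2⟩
      simp only [mul_ite, mul_one, mul_zero, Finset.sum_ite_eq', if_pos hil]
      exact (h.meetingLaw_zero_bounds ht hj'.1 hi hc.2.1.symm hc.2.2).1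
    · exact zero_le
  · intro j l hl
    have := (mem_linkable.1 hl).2.2
    by_cases hli : l = i
    · subst hli; simp [this]
    · simp [hli, Ne.symm hli]

theorem expect_indegree_step_le (hP : ∀ k, P.homophilyIndex k = 1) (h : Feasible P θ t G)
    (ht : 1 ≤ t) (i : ℕ) :
    ((meetings (fun _ => 0) θ G (t + 1) (t + 1)).expect fun m =>
      ((afterMeetings P θ G m).indegree i (t + 1) : ℝ≥0∞)) ≤
    (G.indegree i t : ℝ≥0∞) + (searchers P θ (θ i) (t + 1) G).card *
      ((t - (P.gregariousness (θ i) + P.gregariousness (θ i) * P.gregariousness (θ i)) : ℕ) :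
          ℝ≥0∞)⁻¹ := by
  simp only [indegree_eq_sum]
  refine (expect_sum_afterMeetings_le hP h (γ := fun _ => 0)
    (φ := fun j A => if i ∈ A then 1 else 0) (by simp)
    (c := fun j l => if l = i then 1 else 0) ?_).trans ?_
  · intro j l hl
    by_cases hli : l = i
    · subst hli; simp
    · simp [Ne.symm hli]
  · refine add_le_add le_rfl ?_
    rw [← nsmul_eq_mul, ← Finset.sum_const, searchers, Finset.sum_filter]
    refine Finset.sum_le_sum fun j hj => ?_
    simp only [mul_ite, mul_one, mul_zero, Finset.sum_ite_eq']
    split_ifs with hil hθ hθ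
    · obtain ⟨⟨hl1, hl2⟩, hl3, hl4⟩ := mem_linkable.1 hil
      have := (h.meetingLaw_zero_bounds ht (mem_unsaturated.1 hj).1 hl1 hl3 hl4).2
      rwa [hθ] at this
    · exact absurd (mem_linkable.1 hil).1.2.symm hθ
    · exact zero_le
    · exact zero_le

end Step

/-! ### Cesàro means, logarithmic means and balance inequalities -/

section Cesaro

theorem tendsto_harmonic_div_log :
    Tendsto (fun n : ℕ => (∑ s ∈ Finset.range n, (1 : ℝ) / (s + 1)) / Real.log (n + 1)) atTop
      (𝓝 1) := by
  have hlog : Tendsto (fun n : ℕ => Real.log (n + 1)) atTop atTop := by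
    have := (Real.tendsto_log_atTop.comp tendsto_natCast_atTop_atTop).comp (tendsto_add_atTop_nat 1)
    refine this.congr fun n => by simp
  have h1 := Real.tendsto_harmonic_sub_log_add_one.div_atTop hlog
  have h2 := h1.add_const 1
  rw [zero_add] at h2
  refine h2.congr' ?_
  filter_upwards [hlog.eventually_gt_atTop 0] with n hn
  have : ((harmonic n : ℚ) : ℝ) = ∑ s ∈ Finset.range n, (1 : ℝ) / (s + 1) := by
    simp [harmonic]
  rw [← this]
  field_simp
  ring

/-- If the Cesàro means of `a` converge, so do its logarithmic means. -/
theorem tendsto_sum_div_log {a : ℕ → ℝ} {L : ℝ}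
    (h : Tendsto (fun t : ℕ => (∑ s ∈ Finset.range t, a s) / t) atTop (𝓝 L)) :
    Tendsto (fun t : ℕ => (∑ s ∈ Finset.range t, a s / s) / Real.log t) atTop (𝓝 L) := by
  rw [← tendsto_add_atTop_iff_nat 1]
  set c : ℕ → ℝ := fun t => (∑ s ∈ Finset.range t, a s) / t with hc
  -- Abel summation based on `a (n + 1) = (n + 2) * c (n + 2) - (n + 1) * c (n + 1)`, with `c` split
  -- into `c - L` and `L`. The term `s = 0` vanishes because division by zero gives `0`.
  have hS : ∀ n, ∑ s ∈ Finset.range (n + 1), a s / s =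
      c (n + 1) - c 1 + (∑ s ∈ Finset.range n, (c (s + 2) - L) * (1 / (s + 1)) +
        L * ∑ s ∈ Finset.range n, (1 : ℝ) / (s + 1)) := by
    intro n
    induction n with
    | zero => simp
    | succ n ih =>
      rw [Finset.sum_range_succ, ih, Finset.sum_range_succ (n := n), Finset.sum_range_succ (n := n)]
      have : a (n + 1) = c (n + 2) * (n + 2) - c (n + 1) * (n + 1) := by
        simp only [hc]
        rw [Finset.sum_range_succ a (n + 1)]
        push_cast
        field_simp
        ring
      rw [this]
      push_cast
      field_simp
      ring
  have hlog : Tendsto (fun n : ℕ => Real.log ((n + 1 : ℕ) : ℝ)) atTop atTop :=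
    (Real.tendsto_log_atTop.comp tendsto_natCast_atTop_atTop).comp (tendsto_add_atTop_nat 1)
  have hH : Tendsto (fun n : ℕ => (∑ s ∈ Finset.range n, (1 : ℝ) / (s + 1)) /
      Real.log ((n + 1 : ℕ) : ℝ)) atTop (𝓝 1) := by
    simpa using tendsto_harmonic_div_log
  have hHtop : Tendsto (fun n : ℕ => ∑ s ∈ Finset.range n, (1 : ℝ) / (s + 1)) atTop atTop :=
    Real.tendsto_sum_range_one_div_nat_succ_atTop
  have hlit : (fun n : ℕ => ∑ s ∈ Finset.range n, (c (s + 2) - L) * (1 / ((s : ℝ) + 1))) =o[atTop]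
      fun n => ∑ s ∈ Finset.range n, (1 : ℝ) / (s + 1) := by
    refine Asymptotics.IsLittleO.sum_range ?_ (fun s => by positivity) hHtop
    have h2 : Tendsto (fun s : ℕ => c (s + 2) - L) atTop (𝓝 0) := by
      have := (h.comp (tendsto_add_atTop_nat 2)).sub_const L
      simpa [hc] using this
    simpa using (Asymptotics.isLittleO_one_iff ℝ |>.2 h2).mul_isBigO
      (Asymptotics.isBigO_refl (fun s : ℕ => 1 / ((s : ℝ) + 1)) atTop)
  have hlit' := hlit.tendsto_div_nhds_zero
  have h1 : Tendsto (fun n : ℕ => (c (n + 1) - c 1) / Real.log ((n + 1 : ℕ) : ℝ)) atTop (𝓝 0) :=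
    (((h.comp (tendsto_add_atTop_nat 1)).sub_const (c 1))).div_atTop hlog
  have h2 := h1.add ((hlit'.mul hH).add (hH.const_mul L))
  simp only [zero_add, mul_one] at h2
  refine h2.congr' ?_
  filter_upwards [hHtop.eventually_gt_atTop 0] with n hn
  rw [hS, div_mul_div_cancel₀ hn.ne']
  ring

variable {a a' x x' n : ℕ → ℝ} {L p : ℝ}

/-- Up to `ε`, `p * ∑ a ≤ ∑ x ≤ L * n t` and `n t` is about `p * t`; the factor `p` cancels. -/
theorem eventually_sum_le_of_balance (hL : 0 ≤ L) (hp : 0 < p)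
    (hbal : ∀ᶠ T in atTop, ∀ t ≥ T, ∑ s ∈ Finset.Ico T t, x s ≤ L * n t)
    (hx : ∀ ε > 0, ∀ᶠ s in atTop, (p - ε) * a s ≤ x s + ε)
    (hn : Tendsto (fun t : ℕ => n t / t) atTop (𝓝 p)) {M : ℝ} (hM : L < M) :
    ∀ᶠ t : ℕ in atTop, ∑ s ∈ Finset.range t, a s ≤ M * t := by
  -- Fixes `ε` so small that all error terms together still leave a slope below `M`.
  have hcont : Tendsto (fun ε : ℝ => (L * (p + ε) + ε) / (p - ε)) (𝓝[>] 0) (𝓝 L) := by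
    have : ContinuousAt (fun ε : ℝ => (L * (p + ε) + ε) / (p - ε)) 0 :=
      ContinuousAt.div (by fun_prop) (by fun_prop) (by simpa using hp.ne')
    have := this.tendsto
    simp only [add_zero, sub_zero, mul_div_cancel_right₀ _ hp.ne'] at this
    exact this.mono_left nhdsWithin_le_nhds
  have hIoo : ∀ᶠ ε in 𝓝[>] (0 : ℝ), ε ∈ Set.Ioo 0 p := Ioo_mem_nhdsGT hp
  obtain ⟨ε, hε1, hε2⟩ := ((hcont.eventually_lt_const hM).and hIoo).exists
  rw [div_lt_iff₀ (by linarith [hε2.2])] at hε1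
  have hε := hε2.1
  obtain ⟨T, hT1, hT2⟩ := (hbal.and (eventually_forall_ge_atTop.2 (hx ε hε))).exists
  have hn' : ∀ᶠ t : ℕ in atTop, n t ≤ (p + ε) * t := by
    filter_upwards [hn.eventually_lt_const (show p < p + ε by linarith), eventually_gt_atTop 0]
      with t ht ht0
    rw [div_lt_iff₀ (by exact_mod_cast ht0)] at ht
    exact ht.le
  have hbig : ∀ᶠ t : ℕ in atTop, (p - ε) * ∑ s ∈ Finset.range T, a s ≤
      (M * (p - ε) - (L * (p + ε) + ε)) * t :=
    (tendsto_natCast_atTop_atTop.const_mul_atTop (by linarith)).eventually_ge_atTop _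
  filter_upwards [hn', hbig, eventually_ge_atTop T] with t h1 h2 h3
  have h4 : (p - ε) * ∑ s ∈ Finset.Ico T t, a s ≤ L * n t + ε * t := by
    rw [Finset.mul_sum]
    calc _ ≤ ∑ s ∈ Finset.Ico T t, (x s + ε) :=
          Finset.sum_le_sum fun s hs => hT2 s (Finset.mem_Ico.1 hs).1
      _ ≤ _ := by
          rw [Finset.sum_add_distrib, Finset.sum_const, Nat.card_Ico, nsmul_eq_mul]
          have : ((t - T : ℕ) : ℝ) * ε ≤ ε * t := by
            rw [mul_comm]; gcongr; omega
          linarith [hT1 t h3]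
  have h5 := Finset.sum_range_add_sum_Ico a h3
  have h6 : (p - ε) * ∑ s ∈ Finset.range t, a s ≤ (p - ε) * (M * t) := by
    rw [← h5, mul_add]
    have := mul_le_mul_of_nonneg_left h1 hL
    linarith
  exact le_of_mul_le_mul_left h6 (by linarith [hε2.2])

/-- A sequence that rises by at most `1` per date and is large at `t` was large during the preceding
`m` dates, so `m * (a t - m) ≤ M * t`. With `m` about `t / q` this gives `a t ≤ |M| * t / m + m`,
and both terms are below `ε * t / 2` for large `q` and `t`. -/
theorem tendsto_div_zero_of_increment_le_one (ha0 : ∀ s, 0 ≤ a s) (ha : ∀ s, a (s + 1) ≤ a s + 1)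
    {M : ℝ} (hM : ∀ᶠ t : ℕ in atTop, ∑ s ∈ Finset.range t, a s ≤ M * t) :
    Tendsto (fun t : ℕ => a t / t) atTop (𝓝 0) := by
  have hstep : ∀ m s, a (s + m) ≤ a s + m := by
    intro m s
    induction m with
    | zero => simp
    | succ m ih =>
      have := ha (s + m)
      rw [← add_assoc]; push_cast; linarith
  refine tendsto_order.2 ⟨fun b hb => Eventually.of_forall fun t =>
    hb.trans_le (div_nonneg (ha0 t) (by positivity)), fun ε hε => ?_⟩
  obtain ⟨q, hq⟩ := exists_nat_gt (2 / ε)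
  have hq0 : (0 : ℝ) < q := lt_trans (by positivity) hq
  have hdiv : Tendsto (fun t : ℕ => t / q) atTop atTop :=
    Nat.tendsto_div_const_atTop (by exact_mod_cast hq0.ne')
  have hM' : Tendsto (fun t : ℕ => |M| / ((t / q : ℕ) : ℝ)) atTop (𝓝 0) :=
    tendsto_const_nhds.div_atTop (tendsto_natCast_atTop_atTop.comp hdiv)
  filter_upwards [hM, hM'.eventually_lt_const (show 0 < ε / 2 by linarith),
    hdiv.eventually_ge_atTop 1, eventually_gt_atTop 0] with t h1 h2 h3 h4
  have hmt : t / q ≤ t := Nat.div_le_self _ _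
  have hmq : ((t / q : ℕ) : ℝ) ≤ t / q := Nat.cast_div_le
  set m := t / q with hm
  have hm0 : (0 : ℝ) < m := by exact_mod_cast h3
  have ht0 : (0 : ℝ) < t := by exact_mod_cast h4
  have h5 : (m : ℝ) * (a t - m) ≤ M * t := by
    calc (m : ℝ) * (a t - m) = ∑ s ∈ Finset.Ico (t - m) t, (a t - m) := by
          rw [Finset.sum_const, Nat.card_Ico, nsmul_eq_mul, Nat.sub_sub_self hmt]
      _ ≤ ∑ s ∈ Finset.Ico (t - m) t, a s := by
          refine Finset.sum_le_sum fun s hs => ?_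
          rw [Finset.mem_Ico] at hs
          have := hstep (t - s) s
          rw [Nat.add_sub_cancel' hs.2.le] at this
          have hc : ((t - s : ℕ) : ℝ) ≤ m := by exact_mod_cast (by omega)
          linarith
      _ ≤ ∑ s ∈ Finset.range t, a s := by
          rw [Finset.range_eq_Ico]
          exact Finset.sum_le_sum_of_subset_of_nonneg
            (Finset.Ico_subset_Ico_left (Nat.zero_le _)) fun s _ _ => ha0 s
      _ ≤ M * t := h1
  have h6 : a t ≤ |M| / m * t + m := by
    have : M * t ≤ |M| * t := by gcongr; exact le_abs_self M
    have h7 : a t - m ≤ |M| * t / m := by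
      rw [le_div_iff₀ hm0]; linarith
    rw [mul_div_right_comm] at h7
    linarith
  have h8 : (t : ℝ) / q < ε / 2 * t := by
    rw [div_lt_iff₀ hq0]
    rw [div_lt_iff₀ hε] at hq
    nlinarith
  rw [div_lt_iff₀ ht0]
  nlinarith

/-- The reverse balance. The links still missing at date `t` amount to at most `L * a t`, which is
`o(t)`. -/
theorem eventually_le_sum_of_balance (hL : 0 ≤ L) (hp : 0 < p)
    (hbal : ∀ᶠ T : ℕ in atTop, ∀ t ≥ T, L * n t ≤ L * T + L + ∑ s ∈ Finset.Ico T t, x' s + L * a t)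
    (hx : ∀ ε > 0, ∀ᶠ s in atTop, x' s ≤ (p + ε) * a' s + ε) (ha' : ∀ s, 0 ≤ a' s)
    (hn : Tendsto (fun t : ℕ => n t / t) atTop (𝓝 p))
    (ha : Tendsto (fun t : ℕ => a t / t) atTop (𝓝 0)) {M : ℝ} (hM : M < L) :
    ∀ᶠ t : ℕ in atTop, M * t ≤ ∑ s ∈ Finset.range t, a' s := by
  have hcont : Tendsto (fun ε : ℝ => (L * (p - ε) - ε - L * ε) / (p + ε)) (𝓝[>] 0) (𝓝 L) := by
    have : ContinuousAt (fun ε : ℝ => (L * (p - ε) - ε - L * ε) / (p + ε)) 0 :=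
      ContinuousAt.div (by fun_prop) (by fun_prop) (by simpa using hp.ne')
    have := this.tendsto
    simp only [add_zero, sub_zero, mul_zero, mul_div_cancel_right₀ _ hp.ne'] at this
    exact this.mono_left nhdsWithin_le_nhds
  have hIoo : ∀ᶠ ε in 𝓝[>] (0 : ℝ), ε ∈ Set.Ioo 0 p := Ioo_mem_nhdsGT hp
  obtain ⟨ε, hε1, hε, hε2⟩ := ((hcont.eventually_const_lt hM).and hIoo).exists
  rw [lt_div_iff₀ (by linarith)] at hε1
  obtain ⟨T, hT1, hT2⟩ := (hbal.and (eventually_forall_ge_atTop.2 (hx ε hε))).exists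
  have hn' : ∀ᶠ t : ℕ in atTop, (p - ε) * t ≤ n t := by
    filter_upwards [hn.eventually_const_lt (show p - ε < p by linarith), eventually_gt_atTop 0]
      with t ht ht0
    rw [lt_div_iff₀ (by exact_mod_cast ht0)] at ht
    exact ht.le
  have hat : ∀ᶠ t : ℕ in atTop, a t ≤ ε * t := by
    filter_upwards [ha.eventually_lt_const hε, eventually_gt_atTop 0] with t ht ht0
    rw [div_lt_iff₀ (by exact_mod_cast ht0)] at ht
    exact ht.le
  have hbig : ∀ᶠ t : ℕ in atTop, L * T + L ≤ (L * (p - ε) - ε - L * ε - M * (p + ε)) * t :=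
    (tendsto_natCast_atTop_atTop.const_mul_atTop (by linarith)).eventually_ge_atTop _
  filter_upwards [hn', hat, hbig, eventually_ge_atTop T] with t h1 h2 h3 h4
  have h5 : ∑ s ∈ Finset.Ico T t, x' s ≤ (p + ε) * ∑ s ∈ Finset.range t, a' s + ε * t := by
    calc _ ≤ ∑ s ∈ Finset.Ico T t, ((p + ε) * a' s + ε) :=
          Finset.sum_le_sum fun s hs => hT2 s (Finset.mem_Ico.1 hs).1
      _ ≤ _ := by
          rw [Finset.sum_add_distrib, Finset.sum_const, Nat.card_Ico, nsmul_eq_mul, Finset.range_eq_Ico,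
            ← Finset.mul_sum]
          have : ((t - T : ℕ) : ℝ) * ε ≤ ε * t := by
            rw [mul_comm]; gcongr; omega
          have h6 : ∑ s ∈ Finset.Ico T t, a' s ≤ ∑ s ∈ Finset.Ico 0 t, a' s :=
            Finset.sum_le_sum_of_subset_of_nonneg
              (Finset.Ico_subset_Ico_left (Nat.zero_le _)) fun s _ _ => ha' s
          gcongr
  have h6 := hT1 t h4
  have h7 := mul_le_mul_of_nonneg_left h1 hL
  have h8 := mul_le_mul_of_nonneg_left h2 hL
  have h9 : (p + ε) * (M * t) ≤ (p + ε) * ∑ s ∈ Finset.range t, a' s := by linarith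
  exact le_of_mul_le_mul_left h9 (by linarith)

theorem tendsto_cesaro_of_bounds {b b' : ℕ → ℝ} (hb : ∀ t, b' t ≤ b t)
    (h1 : ∀ M, L < M → ∀ᶠ t : ℕ in atTop, b t ≤ M * t)
    (h2 : ∀ M, M < L → ∀ᶠ t : ℕ in atTop, M * t ≤ b' t) :
    Tendsto (fun t : ℕ => b t / t) atTop (𝓝 L) ∧ Tendsto (fun t : ℕ => b' t / t) atTop (𝓝 L) := by
  have key : ∀ f : ℕ → ℝ, (∀ t, f t ≤ b t) → (∀ t, b' t ≤ f t) →
      Tendsto (fun t : ℕ => f t / t) atTop (𝓝 L) := by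
    intro f hf hf'
    refine tendsto_order.2 ⟨fun M hM => ?_, fun M hM => ?_⟩
    · obtain ⟨M', hM1, hM2⟩ := exists_between hM
      filter_upwards [h2 M' hM2, eventually_gt_atTop 0] with t ht ht0
      refine hM1.trans_le ?_
      rw [le_div_iff₀ (by exact_mod_cast ht0)]
      exact ht.trans (hf' t)
    · obtain ⟨M', hM1, hM2⟩ := exists_between hM
      filter_upwards [h1 M' hM1, eventually_gt_atTop 0] with t ht ht0
      refine lt_of_le_of_lt ?_ hM2
      rw [div_le_iff₀ (by exact_mod_cast ht0)]
      exact (hf t).trans ht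
  exact ⟨key b (fun _ => le_rfl) hb, key b' hb fun _ => le_rfl⟩

/-- The squeeze for a sequence whose increments lie between `a' t / t` and roughly `a t / t`. -/
theorem tendsto_div_log_of_increments {e : ℕ → ℝ} (hL : 0 < L)
    (h1 : Tendsto (fun t : ℕ => (∑ s ∈ Finset.range t, a s) / t) atTop (𝓝 L))
    (h2 : Tendsto (fun t : ℕ => (∑ s ∈ Finset.range t, a' s) / t) atTop (𝓝 L))
    (hup : ∀ ε > 0, ∀ᶠ t in atTop, e (t + 1) ≤ e t + (1 + ε) * (a t / t))
    (hlow : ∀ᶠ t in atTop, e t + a' t / t ≤ e (t + 1)) :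
    Tendsto (fun t : ℕ => e t / (L * Real.log t)) atTop (𝓝 1) := by
  have hlog : Tendsto (fun n : ℕ => Real.log n) atTop atTop :=
    Real.tendsto_log_atTop.comp tendsto_natCast_atTop_atTop
  have g1 := tendsto_sum_div_log h1
  have g2 := tendsto_sum_div_log h2
  suffices h : Tendsto (fun t : ℕ => e t / Real.log t) atTop (𝓝 L) by
    have := h.div_const L
    rw [div_self hL.ne'] at this
    refine this.congr fun t => ?_
    rw [div_div, mul_comm]
  -- Telescoping from the date at which the increment bound starts to hold; the earlier dates go
  -- into the constant and disappear after division by `log t`.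
  have up : ∀ ε > 0, ∃ c : ℝ, ∀ᶠ t : ℕ in atTop,
      e t ≤ c + (1 + ε) * ∑ s ∈ Finset.range t, a s / s := by
    intro ε hε
    obtain ⟨T, hT⟩ := eventually_atTop.1 (hup ε hε)
    refine ⟨e T - (1 + ε) * ∑ s ∈ Finset.range T, a s / s, eventually_atTop.2 ⟨T, fun t ht => ?_⟩⟩
    induction t, ht using Nat.le_induction with
    | base => linarith
    | succ t ht ih =>
      rw [Finset.sum_range_succ, mul_add]
      linarith [hT t ht]
  have low : ∃ c : ℝ, ∀ᶠ t : ℕ in atTop, c + ∑ s ∈ Finset.range t, a' s / s ≤ e t := by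
    obtain ⟨T, hT⟩ := eventually_atTop.1 hlow
    refine ⟨e T - ∑ s ∈ Finset.range T, a' s / s, eventually_atTop.2 ⟨T, fun t ht => ?_⟩⟩
    induction t, ht using Nat.le_induction with
    | base => linarith
    | succ t ht ih =>
      rw [Finset.sum_range_succ]
      linarith [hT t ht]
  refine tendsto_order.2 ⟨fun M hM => ?_, fun M hM => ?_⟩
  · obtain ⟨c, hc⟩ := low
    have h3 := (tendsto_const_nhds (x := c).div_atTop hlog).add g2
    rw [zero_add] at h3
    filter_upwards [hc, h3.eventually_const_lt hM, hlog.eventually_gt_atTop 0] with t h4 h5 h6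
    rw [← add_div] at h5
    exact h5.trans_le (by gcongr)
  · have hcont : Tendsto (fun ε : ℝ => (1 + ε) * L) (𝓝[>] 0) (𝓝 L) := by
      have : Tendsto (fun ε : ℝ => (1 + ε) * L) (𝓝 0) (𝓝 ((1 + 0) * L)) :=
        Continuous.tendsto (by fun_prop) 0
      rw [add_zero, one_mul] at this
      exact this.mono_left nhdsWithin_le_nhds
    have hpos : ∀ᶠ ε in 𝓝[>] (0 : ℝ), 0 < ε := self_mem_nhdsWithin
    obtain ⟨ε, hε1, hε⟩ := ((hcont.eventually_lt_const hM).and hpos).exists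
    obtain ⟨c, hc⟩ := up ε hε
    have h3 := (tendsto_const_nhds (x := c).div_atTop hlog).add (g1.const_mul (1 + ε))
    rw [zero_add] at h3
    filter_upwards [hc, h3.eventually_lt_const hε1, hlog.eventually_gt_atTop 0] with t h4 h5 h6
    rw [← mul_div_assoc, ← add_div] at h5
    exact lt_of_le_of_lt (by gcongr) h5

end Cesaro

/-! ### Expected popularity and links for given types -/

section Quenched

variable {K : ℕ} {P : Preferences K} {γ : Fin K → ℝ≥0} {θ : ℕ → Fin K} {t : ℕ} {G : Network}

theorem expect_networkLaw_le (hP : ∀ k, P.homophilyIndex k = 1) {f : Network → ℝ≥0∞} {c : ℝ≥0∞}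
    (h : ∀ G, Feasible P θ t G → f G ≤ c) : (networkLaw P γ θ t).expect f ≤ c := by
  rw [← PMF.expect_const (networkLaw P γ θ t) c]
  exact PMF.expect_mono fun G hG => h G (feasible_of_mem_support hP hG)

/-- Expected popularity given the types. -/
def popularity (P : Preferences K) (γ : Fin K → ℝ≥0) (i t : ℕ) (θ : ℕ → Fin K) : ℝ≥0∞ :=
  (networkLaw P γ θ t).expect fun G => (G.indegree i t : ℝ≥0∞)

/-- The expected number of unsaturated agents of type `k` at date `t + 1`, given the types. -/
def searcherCount (P : Preferences K) (k : Fin K) (t : ℕ) (θ : ℕ → Fin K) : ℝ≥0∞ :=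
  (networkLaw P (fun _ => 0) θ t).expect fun G => ((searchers P θ k (t + 1) G).card : ℝ≥0∞)

/-- The expected number of agents that would link to `i` at date `t + 1`, given the types. -/
def admirerCount (P : Preferences K) (i t : ℕ) (θ : ℕ → Fin K) : ℝ≥0∞ :=
  (networkLaw P (fun _ => 0) θ t).expect fun G => ((admirers P θ i (t + 1) G).card : ℝ≥0∞)

theorem popularity_le (i : ℕ) : popularity P γ i t θ ≤ t := by
  rw [← PMF.expect_const (networkLaw P γ θ t) (t : ℝ≥0∞)]
  refine PMF.expect_mono fun G _ => ?_
  have := Finset.card_filter_le (Finset.Icc 1 t) fun j => i ∈ G j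
  rw [Nat.card_Icc, Nat.add_sub_cancel] at this
  exact_mod_cast this

theorem searcherCount_le (k : Fin K) : searcherCount P k t θ ≤ (t + 1 : ℕ) := by
  rw [← PMF.expect_const (networkLaw P (fun _ => 0) θ t) ((t + 1 : ℕ) : ℝ≥0∞)]
  refine PMF.expect_mono fun G _ => ?_
  have h1 : searchers P θ k (t + 1) G ⊆ Finset.Icc 1 (t + 1) :=
    (Finset.filter_subset _ _).trans (Finset.filter_subset _ _)
  have := Finset.card_le_card h1
  rw [Nat.card_Icc, Nat.add_sub_cancel] at this
  exact_mod_cast this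

theorem admirerCount_le_searcherCount (i : ℕ) :
    admirerCount P i t θ ≤ searcherCount P (θ i) t θ := by
  refine PMF.expect_mono fun G _ => ?_
  have : admirers P θ i (t + 1) G ⊆ searchers P θ (θ i) (t + 1) G := by
    intro j
    simp +contextual [admirers, searchers]
  exact_mod_cast Finset.card_le_card this

theorem typeCount_le (k : Fin K) : typeCount θ k t ≤ t := by
  simpa [typeCount] using Finset.card_filter_le (Finset.Icc 1 t) fun j => θ j = k

theorem typeCount_mono (k : Fin K) {s : ℕ} (h : s ≤ t) : typeCount θ k s ≤ typeCount θ k t :=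
  Finset.card_le_card (Finset.filter_subset_filter _ (Finset.Icc_subset_Icc_right h))

/-- Followee sets only grow, so nobody becomes unsaturated again and the newborn is the only
possible new searcher. -/
theorem searcherCount_succ_le (k : Fin K) :
    searcherCount P k (t + 1) θ ≤ searcherCount P k t θ + 1 := by
  unfold searcherCount
  rw [expect_networkLaw_succ, ← PMF.expect_const (networkLaw P (fun _ => 0) θ t) 1,
    ← PMF.expect_add]
  refine PMF.expect_mono fun G _ => ?_
  refine (PMF.expect_mono (g := fun _ => ((searchers P θ k (t + 1) G).card : ℝ≥0∞) + 1)
    fun m _ => ?_).trans (PMF.expect_const _ _).le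
  have hsub : searchers P θ k (t + 1 + 1) (afterMeetings P θ G m) ⊆
      insert (t + 2) (searchers P θ k (t + 1) G) := by
    intro j hj
    simp only [searchers, Finset.mem_filter, mem_unsaturated, Finset.mem_Icc,
      Finset.mem_insert] at hj ⊢
    have := Finset.card_le_card (subset_afterMeeting (P := P) (θ := θ) (G := G) j (m j))
    have h2 : (afterMeetings P θ G m j).card = (afterMeeting P θ G j (m j)).card := rfl
    obtain ⟨⟨⟨h3, h4⟩, h5⟩, h6⟩ := hj
    rcases eq_or_ne j (t + 2) with h7 | h7
    · exact Or.inl h7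
    · exact Or.inr ⟨⟨⟨h3, by omega⟩, by omega⟩, h6⟩
  have := (Finset.card_le_card hsub).trans (Finset.card_insert_le _ _)
  exact_mod_cast this

theorem outLinks_le (h : Feasible P θ t G) (k : Fin K) :
    outLinks θ k t G ≤ (P.gregariousness k * typeCount θ k t : ℕ) := by
  unfold outLinks typeCount
  rw [← Finset.sum_filter, mul_comm]
  push_cast
  rw [← nsmul_eq_mul, ← Finset.sum_const]
  refine Finset.sum_le_sum fun j hj => ?_
  have := h.card_le j
  rw [(Finset.mem_filter.1 hj).2] at this
  exact_mod_cast this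

/-- The drift of `outLinks` telescopes from `T` to `t`, and no agent ever has more than `L` links.
-/
theorem sum_searcherCount_le (hP : ∀ k, P.homophilyIndex k = 1) (k : Fin K) {T : ℕ} (hT : 1 ≤ T)
    (hTt : T ≤ t) :
    ∑ s ∈ Finset.Ico T t, searcherCount P k s θ *
      ((typeCount θ k (s + 1) - (1 + P.gregariousness k) : ℕ) * (s : ℝ≥0∞)⁻¹) ≤
    (P.gregariousness k * typeCount θ k t : ℕ) := by
  refine le_trans ?_ (expect_networkLaw_le (γ := fun _ => 0) hP fun G h => outLinks_le h k)
  induction t, hTt using Nat.le_induction with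
  | base => simp
  | succ t ht ih =>
    rw [Finset.sum_Ico_succ_top ht, expect_networkLaw_succ]
    refine (add_le_add_left ih _).trans ?_
    rw [searcherCount, ← PMF.expect_mul_const, ← PMF.expect_add]
    exact PMF.expect_mono fun G hG =>
      expect_outLinks_step hP (feasible_of_mem_support hP hG) (hT.trans ht) k

theorem cappedLinks_le (h : Feasible P θ t G) (i : ℕ) :
    cappedLinks P θ i t G ≤ (P.gregariousness (θ i) * t : ℕ) := by
  have : (P.gregariousness (θ i) * t : ℕ) =
      ∑ j ∈ Finset.Icc 1 t, (P.gregariousness (θ i) : ℝ≥0∞) := by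
    simp [mul_comm]
  rw [this]
  refine Finset.sum_le_sum fun j _ => ?_
  split_ifs with h1 h2
  · exact le_rfl
  · have := h.card_le j
    rw [h1.1] at this
    exact_mod_cast this
  · exact zero_le

/-- Each agent of the type of `i` contributes `L` to the capped count, as a follower of `i` or as a
saturated agent, unless it is a searcher or `i` itself. The last two terms pay for these exceptions.
-/
theorem le_cappedLinks (i : ℕ) :
    ((P.gregariousness (θ i) * typeCount θ (θ i) t : ℕ) : ℝ≥0∞) ≤ cappedLinks P θ i t G +
      P.gregariousness (θ i) * (searchers P θ (θ i) (t + 1) G).card + P.gregariousness (θ i) := by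
  set L := P.gregariousness (θ i) with hL
  have h1 : ((L * typeCount θ (θ i) t : ℕ) : ℝ≥0∞) =
      ∑ j ∈ Finset.Icc 1 t, if θ j = θ i then (L : ℝ≥0∞) else 0 := by
    unfold typeCount
    rw [← Finset.sum_filter]
    simp [mul_comm]
  have h2 : (L : ℝ≥0∞) * ((searchers P θ (θ i) (t + 1) G).card : ℝ≥0∞) =
      ∑ j ∈ Finset.Icc 1 (t + 1), if j ∈ searchers P θ (θ i) (t + 1) G then (L : ℝ≥0∞) else 0 := by
    have hsub : searchers P θ (θ i) (t + 1) G ⊆ Finset.Icc 1 (t + 1) :=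
      (Finset.filter_subset _ _).trans (Finset.filter_subset _ _)
    rw [← Finset.sum_filter, Finset.filter_mem_eq_inter, Finset.inter_eq_right.2 hsub]
    simp [mul_comm]
  have h3 : ∑ j ∈ Finset.Icc 1 t, (if j = i then (L : ℝ≥0∞) else 0) ≤ L := by
    rw [Finset.sum_ite_eq']
    split_ifs <;> simp
  have h4 : ∑ j ∈ Finset.Icc 1 t, (if j ∈ searchers P θ (θ i) (t + 1) G then (L : ℝ≥0∞) else 0) ≤
      (L : ℝ≥0∞) * ((searchers P θ (θ i) (t + 1) G).card : ℝ≥0∞) := by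
    rw [h2]
    exact Finset.sum_le_sum_of_subset (Finset.Icc_subset_Icc_right (by omega))
  refine le_trans ?_ (add_le_add (add_le_add le_rfl h4) h3)
  rw [h1, cappedLinks, ← Finset.sum_add_distrib, ← Finset.sum_add_distrib]
  refine Finset.sum_le_sum fun j hj => ?_
  by_cases hθ : θ j = θ i
  · rw [if_pos hθ]
    by_cases hji : j = i
    · rw [if_pos hji]; exact le_add_self
    · by_cases hs : j ∈ searchers P θ (θ i) (t + 1) G
      · rw [if_pos hs]; exact le_add_self.trans le_self_add
      · rw [if_pos ⟨hθ, hji⟩]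
        refine le_trans ?_ (le_self_add.trans le_self_add)
        split_ifs with hi
        · exact le_rfl
        · have : L ≤ (G j).card := by
            by_contra! hc
            refine hs (Finset.mem_filter.2 ⟨mem_unsaturated.2 ⟨?_, by rwa [hθ]⟩, hθ⟩)
            exact Finset.Icc_subset_Icc_right (by omega) hj
          exact_mod_cast this
  · rw [if_neg hθ]; exact zero_le

theorem le_sum_admirerCount (hP : ∀ k, P.homophilyIndex k = 1) (i : ℕ) {T : ℕ} (hT : 1 ≤ T)
    (hTt : T ≤ t) :
    ((P.gregariousness (θ i) * typeCount θ (θ i) t : ℕ) : ℝ≥0∞) ≤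
    (P.gregariousness (θ i) * T : ℕ) + ∑ s ∈ Finset.Ico T t, admirerCount P i s θ *
      ((typeCount θ (θ i) (s + 1) + P.gregariousness (θ i) : ℕ) *
        ((s - (P.gregariousness (θ i) + P.gregariousness (θ i) * P.gregariousness (θ i)) : ℕ) :
          ℝ≥0∞)⁻¹) +
      P.gregariousness (θ i) * searcherCount P (θ i) t θ + P.gregariousness (θ i) := by
  have h1 : ((P.gregariousness (θ i) * typeCount θ (θ i) t : ℕ) : ℝ≥0∞) ≤
      (networkLaw P (fun _ => 0) θ t).expect (cappedLinks P θ i t) +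
      P.gregariousness (θ i) * searcherCount P (θ i) t θ + P.gregariousness (θ i) := by
    rw [searcherCount, ← PMF.expect_const_mul, ← PMF.expect_add,
      ← PMF.expect_const (networkLaw P (fun _ => 0) θ t) (P.gregariousness (θ i) : ℝ≥0∞),
      ← PMF.expect_add, ← PMF.expect_const (networkLaw P (fun _ => 0) θ t)
        ((P.gregariousness (θ i) * typeCount θ (θ i) t : ℕ) : ℝ≥0∞)]
    refine PMF.expect_mono fun G _ => ?_
    rw [PMF.expect_const]
    exact le_cappedLinks i
  refine h1.trans (add_le_add (add_le_add ?_ le_rfl) le_rfl)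
  clear h1
  induction t, hTt using Nat.le_induction with
  | base =>
    simpa using expect_networkLaw_le (γ := fun _ => 0) hP fun G h => cappedLinks_le h i
  | succ t ht ih =>
    rw [Finset.sum_Ico_succ_top ht, expect_networkLaw_succ, ← add_assoc]
    refine le_trans ?_ (add_le_add_left ih _)
    rw [admirerCount, ← PMF.expect_mul_const, ← PMF.expect_add]
    exact PMF.expect_mono fun G hG =>
      expect_cappedLinks_step hP (feasible_of_mem_support hP hG) (hT.trans ht) i

theorem le_popularity_succ (hP : ∀ k, P.homophilyIndex k = 1) (ht : 1 ≤ t) {i : ℕ}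
    (hi : i ∈ Finset.Icc 1 (t + 1)) :
    popularity P (fun _ => 0) i t θ + admirerCount P i t θ * (t : ℝ≥0∞)⁻¹ ≤
      popularity P (fun _ => 0) i (t + 1) θ := by
  rw [popularity, popularity, expect_networkLaw_succ, admirerCount, ← PMF.expect_mul_const,
    ← PMF.expect_add]
  exact PMF.expect_mono fun G hG =>
    le_expect_indegree_step hP (feasible_of_mem_support hP hG) ht hi

theorem popularity_succ_le (hP : ∀ k, P.homophilyIndex k = 1) (ht : 1 ≤ t) (i : ℕ) :
    popularity P (fun _ => 0) i (t + 1) θ ≤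
    popularity P (fun _ => 0) i t θ + searcherCount P (θ i) t θ *
      ((t - (P.gregariousness (θ i) + P.gregariousness (θ i) * P.gregariousness (θ i)) : ℕ) :
          ℝ≥0∞)⁻¹ := by
  rw [popularity, popularity, expect_networkLaw_succ, searcherCount, ← PMF.expect_mul_const,
    ← PMF.expect_add]
  exact PMF.expect_mono fun G hG =>
    expect_indegree_step_le hP (feasible_of_mem_support hP hG) ht i

theorem dependsOn_popularity (hP : ∀ k, P.homophilyIndex k = 1) (i : ℕ) :
    DependsOn (popularity P γ i t) (Set.Iic t) := by
  intro θ θ' h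
  rw [popularity, popularity, networkLaw_congr hP fun j hj => h j hj]

theorem searchers_congr {θ' : ℕ → Fin K} (h : ∀ j ≤ t, θ j = θ' j) (k : Fin K) :
    searchers P θ k t G = searchers P θ' k t G := by
  ext j
  simp only [searchers, Finset.mem_filter, mem_unsaturated, Finset.mem_Icc]
  by_cases hj : j ≤ t
  · rw [h j hj]
  · simp [hj]

theorem admirers_congr {θ' : ℕ → Fin K} {i : ℕ} (h : ∀ j ≤ t + i, θ j = θ' j) :
    admirers P θ i t G = admirers P θ' i t G := by
  ext j
  simp only [admirers, Finset.mem_filter, mem_unsaturated, Finset.mem_Icc]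
  by_cases hj : j ≤ t
  · rw [h j (by omega), h i (by omega)]
  · simp [hj]

theorem dependsOn_searcherCount (hP : ∀ k, P.homophilyIndex k = 1) (k : Fin K) :
    DependsOn (searcherCount P k t) (Set.Iic (t + 1)) := by
  intro θ θ' h
  rw [searcherCount, searcherCount, networkLaw_congr hP fun j hj => h j (by simp; omega)]
  simp only [searchers_congr h]

theorem dependsOn_admirerCount (hP : ∀ k, P.homophilyIndex k = 1) (i : ℕ) :
    DependsOn (admirerCount P i t) (Set.Iic (t + 1 + i)) := by
  intro θ θ' h
  rw [admirerCount, admirerCount, networkLaw_congr hP fun j hj => h j (by simp; omega)]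
  simp only [admirers_congr h]

theorem dependsOn_typeCount (k : Fin K) :
    DependsOn (fun θ : ℕ → Fin K => typeCount θ k t) (Set.Iic t) := by
  intro θ θ' h
  simp only [typeCount]
  congr 1
  ext j
  simp only [Finset.mem_filter, Finset.mem_Icc]
  by_cases hj : j ≤ t
  · rw [h j hj]
  · simp [hj]

end Quenched

/-! ### The law of types: independence and concentration -/

section Types

variable {K : ℕ}

/-- A function of finitely many coordinates in a finite type set takes finitely many values, so
measurability and boundedness are automatic. -/
theorem integrable_of_dependsOn {f : (ℕ → Fin K) → ℝ} {n : ℕ} (h : DependsOn f (Set.Iic n))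
    (μ : Measure (ℕ → Fin K)) [IsFiniteMeasure μ] : Integrable f μ := by
  obtain ⟨g, rfl⟩ := dependsOn_iff_exists_comp.1 h
  have hrestr : Measurable ((Set.Iic n).domRestrict (π := fun _ : ℕ => Fin K)) :=
    measurable_pi_lambda _ fun i => measurable_pi_apply (i : ℕ)
  have hmeas := (measurable_of_finite g).comp hrestr
  obtain ⟨C, hC⟩ := (Set.finite_range fun x => ‖g x‖).bddAbove
  exact Integrable.of_bound hmeas.aestronglyMeasurable C
    (Eventually.of_forall fun θ => hC ⟨_, rfl⟩)

variable (p : PMF (Fin K)) (k : Fin K) (i : ℕ)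

instance : IsProbabilityMeasure (birthLaw p) := by
  unfold birthLaw; infer_instance

/-- The law of the types given that agent `i` has type `k`. -/
abbrev condLaw : Measure (ℕ → Fin K) := (birthLaw p)[|{θ | θ i = k}]

theorem measurableSet_type : MeasurableSet {θ : ℕ → Fin K | θ i = k} :=
  measurableSet_preimage (measurable_pi_apply (X := fun _ : ℕ => Fin K) i)
    (measurableSet_singleton k)

theorem birthLaw_type : birthLaw p {θ | θ i = k} = p k := by
  have h : (birthLaw p).map (fun θ => θ i) = p.toMeasure :=
    Measure.infinitePi_map_eval (fun _ : ℕ => p.toMeasure) i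
  have h2 : {θ : ℕ → Fin K | θ i = k} = (fun θ => θ i) ⁻¹' {k} := rfl
  rw [h2, ← Measure.map_apply (measurable_pi_apply i) (measurableSet_singleton k), h,
    PMF.toMeasure_apply_singleton _ _ (measurableSet_singleton k)]

variable {p k}

theorem isProbabilityMeasure_condLaw (hp : p k ≠ 0) : IsProbabilityMeasure (condLaw p k i) :=
  cond_isProbabilityMeasure (by rwa [birthLaw_type])

theorem toReal_pos_of_ne_zero (hp : p k ≠ 0) : 0 < (p k).toReal :=
  ENNReal.toReal_pos hp (p.apply_ne_top k)

theorem condLaw_type : ∀ᵐ θ ∂(condLaw p k i), θ i = k :=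
  ae_cond_mem (measurableSet_type k i)

/-- Conditioning on an event of probability `p k` inflates probabilities by at most `1 / p k`, so
concentration may be proved under the product law. -/
theorem condLaw_real_le (s : Set (ℕ → Fin K)) :
    (condLaw p k i).real s ≤ (p k).toReal⁻¹ * (birthLaw p).real s := by
  rw [measureReal_def, condLaw, cond_apply (measurableSet_type k i), ENNReal.toReal_mul,
    birthLaw_type, ENNReal.toReal_inv]
  gcongr
  exact measureReal_mono Set.inter_subset_right

theorem iIndepFun_types : iIndepFun (fun (j : ℕ) (θ : ℕ → Fin K) => θ j) (birthLaw p) :=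
  iIndepFun_infinitePi (P := fun _ : ℕ => p.toMeasure) (X := fun _ x => x) fun _ => measurable_id

variable (p k) in
/-- The centred indicator of the event that `j` has type `k`. -/
def typeDeviation (j : ℕ) (θ : ℕ → Fin K) : ℝ := (if θ j = k then 1 else 0) - (p k).toReal

theorem measurable_typeIndicator (j : ℕ) :
    Measurable fun θ : ℕ → Fin K => if θ j = k then (1 : ℝ) else 0 :=
  Measurable.ite (measurableSet_type k j) measurable_const measurable_const

theorem integral_typeIndicator (j : ℕ) :
    ∫ θ, (if θ j = k then (1 : ℝ) else 0) ∂(birthLaw p) = (p k).toReal := by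
  have : (fun θ : ℕ → Fin K => if θ j = k then (1 : ℝ) else 0) =
      Set.indicator {θ | θ j = k} 1 := by
    ext θ; simp [Set.indicator_apply]
  rw [this, integral_indicator_one (measurableSet_type k j), measureReal_def, birthLaw_type]

theorem hasSubgaussianMGF_typeDeviation (j : ℕ) :
    HasSubgaussianMGF (typeDeviation p k j) ((‖(1 : ℝ) - 0‖₊ / 2) ^ 2) (birthLaw p) := by
  have := hasSubgaussianMGF_of_mem_Icc (μ := birthLaw p) (a := 0) (b := 1)
    (X := fun θ : ℕ → Fin K => if θ j = k then (1 : ℝ) else 0)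
    (measurable_typeIndicator j).aemeasurable
    (Eventually.of_forall fun θ => by split_ifs <;> simp)
  rwa [integral_typeIndicator] at this

theorem iIndepFun_typeDeviation : iIndepFun (typeDeviation p k) (birthLaw p) :=
  (iIndepFun_types (p := p)).comp (fun _ x => (if x = k then (1 : ℝ) else 0) - (p k).toReal)
    fun _ => measurable_of_finite _

theorem sum_typeDeviation (t : ℕ) (θ : ℕ → Fin K) :
    ∑ j ∈ Finset.Icc 1 t, typeDeviation p k j θ = typeCount θ k t - (p k).toReal * t := by
  simp [typeDeviation, typeCount, mul_comm]

variable (p k) in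
/-- The event that the share of type `k` at date `t` deviates from its mean by more than `ε`. -/
def deviation (ε : ℝ) (t : ℕ) : Set (ℕ → Fin K) :=
  {θ | ε * t < |(typeCount θ k t : ℝ) - (p k).toReal * t|}

theorem notMem_deviation {ε : ℝ} {t : ℕ} {θ : ℕ → Fin K} : θ ∉ deviation p k ε t ↔
    |(typeCount θ k t : ℝ) - (p k).toReal * t| ≤ ε * t := by
  simp [deviation]

/-- Hoeffding's inequality applied to the centred indicators and to their negatives; the variance
proxy of each is `1/4`. -/
theorem birthLaw_deviation_le {ε : ℝ} (hε : 0 < ε) (t : ℕ) :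
    (birthLaw p).real (deviation p k ε t) ≤
      2 * Real.exp (-(2 * ε ^ 2) * t) := by
  have hc : ((∑ _j ∈ Finset.Icc 1 t, (‖(1 : ℝ) - 0‖₊ / 2) ^ 2 : ℝ≥0) : ℝ) = t / 4 := by
    simp
    ring
  have hexp : Real.exp (-(ε * t) ^ 2 / (2 * ((∑ _j ∈ Finset.Icc 1 t,
      (‖(1 : ℝ) - 0‖₊ / 2) ^ 2 : ℝ≥0) : ℝ))) ≤ Real.exp (-(2 * ε ^ 2) * t) := by
    rw [hc]
    rcases Nat.eq_zero_or_pos t with rfl | ht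
    · simp
    · refine (congrArg Real.exp ?_).le
      have : (t : ℝ) ≠ 0 := by positivity
      field_simp
      ring
  have h1 := HasSubgaussianMGF.measure_sum_ge_le_of_iIndepFun (iIndepFun_typeDeviation (p := p) (k := k))
    (s := Finset.Icc 1 t) (c := fun _ => (‖(1 : ℝ) - 0‖₊ / 2) ^ 2)
    (fun j _ => hasSubgaussianMGF_typeDeviation j) (ε := ε * t) (by positivity)
  have h2 := HasSubgaussianMGF.measure_sum_ge_le_of_iIndepFun ((iIndepFun_typeDeviation (p := p) (k := k)).comp
    (fun _ x => -x) fun _ => measurable_neg)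
    (s := Finset.Icc 1 t) (c := fun _ => (‖(1 : ℝ) - 0‖₊ / 2) ^ 2)
    (fun j _ => (hasSubgaussianMGF_typeDeviation j).neg) (ε := ε * t) (by positivity)
  have hsub : deviation p k ε t ⊆
      {θ | ε * t ≤ ∑ j ∈ Finset.Icc 1 t, typeDeviation p k j θ} ∪
      {θ | ε * t ≤ ∑ j ∈ Finset.Icc 1 t, ((fun x => -x) ∘ typeDeviation p k j) θ} := by
    intro θ hθ
    simp only [deviation, Set.mem_ofPred_eq, Set.mem_union, Function.comp_apply, Finset.sum_neg_distrib,
      sum_typeDeviation] at hθ ⊢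
    rcases lt_abs.1 hθ with h | h
    · exact Or.inl h.le
    · exact Or.inr h.le
  calc _ ≤ _ := measureReal_mono hsub
    _ ≤ _ := measureReal_union_le _ _
    _ ≤ _ := by linarith [h1.trans hexp, h2.trans hexp]

/-- The factor `t` is included because the integrands below can be of order `t` on the atypical
event; exponential decay absorbs it. -/
theorem tendsto_condLaw_deviation {ε : ℝ} (hε : 0 < ε) :
    Tendsto (fun t : ℕ => (t : ℝ) * (condLaw p k i).real (deviation p k ε t)) atTop (𝓝 0) := by
  have hlim : Tendsto (fun t : ℕ => (p k).toReal⁻¹ * 2 *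
      ((t : ℝ) * Real.exp (-(2 * ε ^ 2) * t))) atTop (𝓝 0) := by
    have h := (Real.tendsto_pow_mul_exp_neg_atTop_nhds_zero 1).comp
      (tendsto_natCast_atTop_atTop.const_mul_atTop (show 0 < 2 * ε ^ 2 by positivity))
    have h2 := h.const_mul ((p k).toReal⁻¹ * 2 * (2 * ε ^ 2)⁻¹)
    rw [mul_zero] at h2
    refine h2.congr fun t => ?_
    simp only [Function.comp_apply, pow_one, neg_mul]
    field_simp
  refine squeeze_zero (fun t => by positivity) (fun t => ?_) hlim
  calc _ ≤ (t : ℝ) * ((p k).toReal⁻¹ * (2 * Real.exp (-(2 * ε ^ 2) * t))) := by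
        gcongr
        refine (condLaw_real_le i _).trans ?_
        gcongr
        exact birthLaw_deviation_le hε t
    _ = _ := by ring

/-- Under the conditional law, the type of a later agent is independent of the past. -/
theorem integral_condLaw_type_mul {i n j : ℕ} (hin : i ≤ n) (hnj : n < j)
    {f : (ℕ → Fin K) → ℝ} (hf : DependsOn f (Set.Iic n)) :
    ∫ θ, (if θ j = k then 1 else 0) * f θ ∂(condLaw p k i) =
      (p k).toReal * ∫ θ, f θ ∂(condLaw p k i) := by
  have hcond : ∀ g : (ℕ → Fin K) → ℝ, ∫ θ, g θ ∂(condLaw p k i) =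
      (p k).toReal⁻¹ * ∫ θ, (if θ i = k then 1 else 0) * g θ ∂(birthLaw p) := by
    intro g
    rw [condLaw, ProbabilityTheory.cond, integral_smul_measure, birthLaw_type,
      ENNReal.toReal_inv, smul_eq_mul, ← integral_indicator (measurableSet_type k i)]
    congr 2
    ext θ
    simp [Set.indicator_apply]
  -- The conditioning on the type of `i` is absorbed into the integrand. As `i ≤ n`, the product
  -- still depends on coordinates up to `n` only and is independent of the type of `j`.
  set F : (ℕ → Fin K) → ℝ := fun θ => (if θ i = k then 1 else 0) * f θ with hF
  have hFdep : DependsOn F (Finset.Iic n : Finset ℕ) := by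
    intro θ θ' h
    simp only [hF]
    rw [hf fun j hj => h j (by simpa using hj), h i (by simpa using hin)]
  obtain ⟨g, hg⟩ := dependsOn_iff_exists_comp.1 hFdep
  have hdisj : Disjoint (Finset.Iic n) ({j} : Finset ℕ) := by
    simp; omega
  have hind := (iIndepFun_types (p := p)).indepFun_finset (Finset.Iic n) {j} hdisj
    fun j => measurable_pi_apply j
  have hind2 : IndepFun F (fun θ : ℕ → Fin K => if θ j = k then (1 : ℝ) else 0) (birthLaw p) := by
    have := hind.comp (φ := g)
      (ψ := fun x => if x ⟨j, by simp⟩ = k then (1 : ℝ) else 0)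
      (measurable_of_finite _) (measurable_of_finite _)
    rw [hg]
    exact this
  have hmul := hind2.integral_fun_mul_eq_mul_integral
    (integrable_of_dependsOn (n := n) (by simpa using hFdep) _).aestronglyMeasurable
    (measurable_typeIndicator j).aestronglyMeasurable
  rw [integral_typeIndicator] at hmul
  rw [hcond, hcond]
  have : ∀ θ : ℕ → Fin K, (if θ i = k then (1 : ℝ) else 0) * ((if θ j = k then 1 else 0) * f θ) =
      F θ * (if θ j = k then 1 else 0) := fun θ => by simp only [hF]; ring
  simp only [this]
  rw [hmul]
  ring

end Types

/-! ### The bounds for given types as real inequalities -/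

section Unbiased

variable {K : ℕ} {P : Preferences K} {γ : Fin K → ℝ≥0} {θ : ℕ → Fin K} {t : ℕ}

theorem popularity_ne_top (i : ℕ) : popularity P γ i t θ ≠ ⊤ :=
  ne_top_of_le_ne_top (ENNReal.natCast_ne_top t) (popularity_le i)

theorem searcherCount_ne_top (k : Fin K) : searcherCount P k t θ ≠ ⊤ :=
  ne_top_of_le_ne_top (ENNReal.natCast_ne_top (t + 1)) (searcherCount_le k)

theorem admirerCount_ne_top (i : ℕ) : admirerCount P i t θ ≠ ⊤ :=
  ne_top_of_le_ne_top (searcherCount_ne_top (θ i)) (admirerCount_le_searcherCount i)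

theorem toReal_searcherCount_le (k : Fin K) : (searcherCount P k t θ).toReal ≤ t + 1 := by
  have := ENNReal.toReal_mono (ENNReal.natCast_ne_top (t + 1)) (searcherCount_le (P := P) (θ := θ) k)
  rw [ENNReal.toReal_natCast] at this
  exact_mod_cast this

theorem natCast_sub_le (m n : ℕ) : (m : ℝ) - n ≤ ((m - n : ℕ) : ℝ) := by
  rw [sub_le_iff_le_add]
  exact_mod_cast (by omega : m ≤ m - n + n)

theorem toReal_sum_searcherCount_le (hP : ∀ k, P.homophilyIndex k = 1) (k : Fin K) {T : ℕ}
    (hT : 1 ≤ T) (hTt : T ≤ t) :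
    ∑ s ∈ Finset.Ico T t, (searcherCount P k s θ).toReal *
      (((typeCount θ k (s + 1) : ℝ) - (1 + P.gregariousness k)) / s) ≤
    P.gregariousness k * typeCount θ k t := by
  have h := ENNReal.toReal_mono (ENNReal.natCast_ne_top _)
    (sum_searcherCount_le (θ := θ) hP k hT hTt)
  rw [ENNReal.toReal_sum, ENNReal.toReal_natCast, Nat.cast_mul] at h
  · refine le_trans (Finset.sum_le_sum fun s hs => ?_) h
    rw [ENNReal.toReal_mul, ENNReal.toReal_mul, ENNReal.toReal_inv, ENNReal.toReal_natCast,
      ENNReal.toReal_natCast, div_eq_mul_inv]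
    gcongr
    have := natCast_sub_le (typeCount θ k (s + 1)) (1 + P.gregariousness k)
    push_cast at this
    exact this
  · intro s hs
    rw [Finset.mem_Ico] at hs
    refine ENNReal.mul_ne_top (searcherCount_ne_top k) (ENNReal.mul_ne_top (by simp) ?_)
    simp; omega

theorem toReal_le_sum_admirerCount (hP : ∀ k, P.homophilyIndex k = 1) (i : ℕ) {T : ℕ}
    (hT : P.gregariousness (θ i) + P.gregariousness (θ i) * P.gregariousness (θ i) < T)
    (hTt : T ≤ t) :
    (P.gregariousness (θ i) : ℝ) * typeCount θ (θ i) t ≤ P.gregariousness (θ i) * T +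
      P.gregariousness (θ i) + ∑ s ∈ Finset.Ico T t, (admirerCount P i s θ).toReal *
      (((typeCount θ (θ i) (s + 1) : ℝ) + P.gregariousness (θ i)) / ((s : ℝ) -
        (P.gregariousness (θ i) + P.gregariousness (θ i) * P.gregariousness (θ i) : ℕ))) +
      P.gregariousness (θ i) * (searcherCount P (θ i) t θ).toReal := by
  set L := P.gregariousness (θ i) with hL
  have hfin : ∀ s ∈ Finset.Ico T t, admirerCount P i s θ *
      ((typeCount θ (θ i) (s + 1) + L : ℕ) * ((s - (L + L * L) : ℕ) : ℝ≥0∞)⁻¹) ≠ ⊤ := by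
    intro s hs
    rw [Finset.mem_Ico] at hs
    refine ENNReal.mul_ne_top (admirerCount_ne_top i) (ENNReal.mul_ne_top (by simp) ?_)
    rw [ENNReal.inv_ne_top, Nat.cast_ne_zero]; omega
  have h1 : ((L * T : ℕ) : ℝ≥0∞) ≠ ⊤ := ENNReal.natCast_ne_top _
  have h2 := ENNReal.sum_ne_top.2 hfin
  have h3 : (L : ℝ≥0∞) * searcherCount P (θ i) t θ ≠ ⊤ :=
    ENNReal.mul_ne_top (by simp) (searcherCount_ne_top _)
  have h := ENNReal.toReal_mono (ENNReal.add_ne_top.2 ⟨ENNReal.add_ne_top.2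
    ⟨ENNReal.add_ne_top.2 ⟨h1, h2⟩, h3⟩, ENNReal.natCast_ne_top L⟩)
    (le_sum_admirerCount (θ := θ) hP i (show 1 ≤ T by omega) hTt)
  rw [ENNReal.toReal_add (ENNReal.add_ne_top.2 ⟨ENNReal.add_ne_top.2 ⟨h1, h2⟩, h3⟩) (by simp),
    ENNReal.toReal_add (ENNReal.add_ne_top.2 ⟨h1, h2⟩) h3, ENNReal.toReal_add h1 h2,
    ENNReal.toReal_sum hfin, ENNReal.toReal_mul, ENNReal.toReal_natCast, ENNReal.toReal_natCast,
    ENNReal.toReal_natCast] at h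
  have h4 : ∀ s ∈ Finset.Ico T t, (admirerCount P i s θ *
      ((typeCount θ (θ i) (s + 1) + L : ℕ) * ((s - (L + L * L) : ℕ) : ℝ≥0∞)⁻¹)).toReal =
      (admirerCount P i s θ).toReal *
      (((typeCount θ (θ i) (s + 1) : ℝ) + L) / ((s : ℝ) - (L + L * L : ℕ))) := by
    intro s hs
    rw [Finset.mem_Ico] at hs
    rw [ENNReal.toReal_mul, ENNReal.toReal_mul, ENNReal.toReal_inv, ENNReal.toReal_natCast,
      ENNReal.toReal_natCast, div_eq_mul_inv, Nat.cast_sub (by omega), Nat.cast_add]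
  rw [Finset.sum_congr rfl h4] at h
  push_cast at h ⊢
  linarith

theorem toReal_le_popularity_succ (hP : ∀ k, P.homophilyIndex k = 1) (ht : 1 ≤ t) {i : ℕ}
    (hi : i ∈ Finset.Icc 1 (t + 1)) :
    (popularity P (fun _ => 0) i t θ).toReal + (admirerCount P i t θ).toReal / t ≤
      (popularity P (fun _ => 0) i (t + 1) θ).toReal := by
  have h := ENNReal.toReal_mono (popularity_ne_top i) (le_popularity_succ (θ := θ) hP ht hi)
  rwa [ENNReal.toReal_add (popularity_ne_top i) (ENNReal.mul_ne_top (admirerCount_ne_top i)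
    (by simp; omega)), ENNReal.toReal_mul, ENNReal.toReal_inv, ENNReal.toReal_natCast,
    ← div_eq_mul_inv] at h

theorem toReal_popularity_succ_le (hP : ∀ k, P.homophilyIndex k = 1) {i : ℕ}
    (ht : P.gregariousness (θ i) + P.gregariousness (θ i) * P.gregariousness (θ i) < t) :
    (popularity P (fun _ => 0) i (t + 1) θ).toReal ≤
      (popularity P (fun _ => 0) i t θ).toReal + (searcherCount P (θ i) t θ).toReal / ((t : ℝ) -
        (P.gregariousness (θ i) + P.gregariousness (θ i) * P.gregariousness (θ i) : ℕ)) := by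
  have hfin : searcherCount P (θ i) t θ * ((t - (P.gregariousness (θ i) +
      P.gregariousness (θ i) * P.gregariousness (θ i)) : ℕ) : ℝ≥0∞)⁻¹ ≠ ⊤ := by
    refine ENNReal.mul_ne_top (searcherCount_ne_top _) ?_
    rw [ENNReal.inv_ne_top, Nat.cast_ne_zero]; omega
  have h := ENNReal.toReal_mono (ENNReal.add_ne_top.2 ⟨popularity_ne_top i, hfin⟩)
    (popularity_succ_le (θ := θ) hP (show 1 ≤ t by omega) i)
  rwa [ENNReal.toReal_add (popularity_ne_top i) hfin, ENNReal.toReal_mul, ENNReal.toReal_inv,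
    ENNReal.toReal_natCast, ← div_eq_mul_inv, Nat.cast_sub ht.le] at h

end Unbiased

/-! ### Averaging over types: logarithmic growth without opportunism -/

section Averages

variable {K : ℕ} {P : Preferences K} {p : PMF (Fin K)} {k : Fin K} {γ : Fin K → ℝ≥0}

theorem expectedPopularity_eq_integral (hP : ∀ k, P.homophilyIndex k = 1) (hp : p k ≠ 0)
    (i t : ℕ) : expectedPopularity P γ p k i t =
      ∫ θ, (popularity P γ i t θ).toReal ∂(condLaw p k i) := by
  have := isProbabilityMeasure_condLaw i hp
  have hint : Integrable (fun θ => (popularity P γ i t θ).toReal) (condLaw p k i) :=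
    integrable_of_dependsOn (n := t) (fun θ θ' h => by
      simp only [dependsOn_popularity hP i h]) _
  have hae : ∫⁻ θ, popularity P γ i t θ ∂(condLaw p k i) =
      ∫⁻ θ, ENNReal.ofReal (popularity P γ i t θ).toReal ∂(condLaw p k i) :=
    lintegral_congr fun θ => (ENNReal.ofReal_toReal (popularity_ne_top i)).symm
  rw [integral_eq_lintegral_of_nonneg_ae (Eventually.of_forall fun θ => ENNReal.toReal_nonneg)
    hint.aestronglyMeasurable, ← hae]
  rfl

theorem integrable_typeCount (μ : Measure (ℕ → Fin K)) [IsFiniteMeasure μ] (t : ℕ) :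
    Integrable (fun θ => (typeCount θ k t : ℝ)) μ :=
  integrable_of_dependsOn (n := t) (fun θ θ' h => by
    have := dependsOn_typeCount k h
    dsimp only at this ⊢
    rw [this]) μ

theorem measurable_typeCount (t : ℕ) :
    Measurable (fun θ : ℕ → Fin K => (typeCount θ k t : ℝ)) := by
  have : (fun θ : ℕ → Fin K => (typeCount θ k t : ℝ)) =
      fun θ => ∑ j ∈ Finset.Icc 1 t, if θ j = k then (1 : ℝ) else 0 := by
    ext θ; simp [typeCount]
  rw [this]
  exact Finset.measurable_sum _ fun j _ => measurable_typeIndicator j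

theorem measurableSet_deviation (ε : ℝ) (t : ℕ) : MeasurableSet (deviation p k ε t) :=
  measurableSet_lt measurable_const (((measurable_typeCount t).sub_const _).abs)

theorem integrable_indicator_deviation (μ : Measure (ℕ → Fin K)) [IsFiniteMeasure μ] (ε : ℝ)
    (t : ℕ) : Integrable ((deviation p k ε t).indicator (1 : (ℕ → Fin K) → ℝ)) μ :=
  (integrable_const (1 : ℝ)).indicator (measurableSet_deviation ε t)

theorem toReal_le_one : (p k).toReal ≤ 1 := by
  simpa using ENNReal.toReal_mono ENNReal.one_ne_top (p.coe_le_one k)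

theorem tendsto_integral_typeCount (hp : p k ≠ 0) (i : ℕ) :
    Tendsto (fun t : ℕ => (∫ θ, (typeCount θ k t : ℝ) ∂(condLaw p k i)) / t) atTop
      (𝓝 (p k).toReal) := by
  have := isProbabilityMeasure_condLaw i hp
  set q := (p k).toReal with hq
  have hq1 : q ≤ 1 := toReal_le_one
  have hq0 : 0 ≤ q := ENNReal.toReal_nonneg
  rw [Metric.tendsto_atTop']
  intro ε hε
  have hlim := (tendsto_condLaw_deviation (p := p) (k := k) i
    (show 0 < ε / 3 by linarith)).eventually_lt_const (show 0 < ε / 3 by linarith)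
  obtain ⟨T, hT⟩ := eventually_atTop.1 hlim
  refine ⟨T + 1, fun t ht => ?_⟩
  have ht1 : (1 : ℝ) ≤ t := by exact_mod_cast (show 1 ≤ t by omega)
  -- Off the atypical event the error is at most `ε / 3 * t`; on it the trivial bound `t` is used.
  have hpt : ∀ θ : ℕ → Fin K, |(typeCount θ k t : ℝ) - q * t| ≤
      ε / 3 * t + t * (deviation p k (ε / 3) t).indicator 1 θ := by
    intro θ
    by_cases hθ : θ ∈ deviation p k (ε / 3) t
    · rw [Set.indicator_of_mem hθ, Pi.one_apply, mul_one]
      have h1 : (typeCount θ k t : ℝ) ≤ t := by exact_mod_cast typeCount_le k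
      have h2 : (0 : ℝ) ≤ typeCount θ k t := by positivity
      have h3 : q * t ≤ t := mul_le_of_le_one_left (by linarith) hq1
      have h4 : 0 ≤ q * t := by positivity
      have h5 : 0 ≤ ε / 3 * t := by positivity
      rw [abs_le]; constructor <;> linarith
    · rw [Set.indicator_of_notMem hθ, mul_zero, add_zero]
      exact notMem_deviation.1 hθ
  have hint := (integrable_typeCount (k := k) (condLaw p k i) t)
  have hmain : |(∫ θ, (typeCount θ k t : ℝ) ∂(condLaw p k i)) - q * t| ≤
      ε / 3 * t + t * (condLaw p k i).real (deviation p k (ε / 3) t) := by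
    calc _ = |∫ θ, ((typeCount θ k t : ℝ) - q * t) ∂(condLaw p k i)| := by
          rw [integral_sub hint (integrable_const _), integral_const]; simp
      _ ≤ ∫ θ, |(typeCount θ k t : ℝ) - q * t| ∂(condLaw p k i) := abs_integral_le_integral_abs
      _ ≤ ∫ θ, (ε / 3 * t + t * (deviation p k (ε / 3) t).indicator 1 θ) ∂(condLaw p k i) :=
          integral_mono (hint.sub (integrable_const _)).abs
            ((integrable_const _).add ((integrable_indicator_deviation _ _ _).const_mul _)) hpt
      _ = _ := by
          rw [integral_add (integrable_const _)
            ((integrable_indicator_deviation _ _ _).const_mul _), integral_const,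
            integral_const_mul, integral_indicator_one (measurableSet_deviation _ _)]
          simp
  have h6 := hT t (by omega)
  rw [Real.dist_eq, div_sub' (by positivity), abs_div, abs_of_pos (show (0 : ℝ) < t by linarith),
    div_lt_iff₀ (by linarith), mul_comm (t : ℝ) q]
  nlinarith

variable (P p k) in
/-- The expected number of unsaturated agents of type `k`. -/
def meanSearchers (i s : ℕ) : ℝ := ∫ θ, (searcherCount P k s θ).toReal ∂(condLaw p k i)

variable (P p k) in
/-- The expected number of agents that would link to `i`. -/
def meanAdmirers (i s : ℕ) : ℝ := ∫ θ, (admirerCount P i s θ).toReal ∂(condLaw p k i)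

variable (P p k) in
/-- A lower bound for the expected number of links formed by agents of type `k`. -/
def meanLinksLower (i s : ℕ) : ℝ := ∫ θ, (searcherCount P k s θ).toReal *
  (((typeCount θ k (s + 1) : ℝ) - (1 + P.gregariousness k)) / s) ∂(condLaw p k i)

variable (P p k) in
/-- An upper bound for the expected increment of the capped number of links. -/
def meanLinksUpper (i s : ℕ) : ℝ := ∫ θ, (admirerCount P i s θ).toReal *
  (((typeCount θ k (s + 1) : ℝ) + P.gregariousness k) / ((s : ℝ) -
    (P.gregariousness k + P.gregariousness k * P.gregariousness k : ℕ))) ∂(condLaw p k i)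

theorem integrable_searcherCount (hP : ∀ k, P.homophilyIndex k = 1) (μ : Measure (ℕ → Fin K))
    [IsFiniteMeasure μ] (s : ℕ) : Integrable (fun θ => (searcherCount P k s θ).toReal) μ :=
  integrable_of_dependsOn (n := s + 1) (fun θ θ' h => by
    simp only [dependsOn_searcherCount hP k h]) μ

theorem integrable_admirerCount (hP : ∀ k, P.homophilyIndex k = 1) (μ : Measure (ℕ → Fin K))
    [IsFiniteMeasure μ] (i s : ℕ) : Integrable (fun θ => (admirerCount P i s θ).toReal) μ :=
  integrable_of_dependsOn (n := s + 1 + i) (fun θ θ' h => by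
    simp only [dependsOn_admirerCount hP i h]) μ

theorem integrable_searcherCount_mul (hP : ∀ k, P.homophilyIndex k = 1) (μ : Measure (ℕ → Fin K))
    [IsFiniteMeasure μ] (s : ℕ) (F : ℕ → ℝ) : Integrable (fun θ => (searcherCount P k s θ).toReal *
      F (typeCount θ k (s + 1))) μ :=
  integrable_of_dependsOn (n := s + 1) (fun θ θ' h => by
    have := dependsOn_typeCount k h
    dsimp only at this
    simp only [dependsOn_searcherCount hP k h, this]) μ

theorem integrable_admirerCount_mul (hP : ∀ k, P.homophilyIndex k = 1) (μ : Measure (ℕ → Fin K))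
    [IsFiniteMeasure μ] (i s : ℕ) (F : ℕ → ℝ) : Integrable (fun θ => (admirerCount P i s θ).toReal *
      F (typeCount θ k (s + 1))) μ :=
  integrable_of_dependsOn (n := s + 1 + i) (fun θ θ' h => by
    have := dependsOn_typeCount k fun j hj => h j
      (Set.Iic_subset_Iic.2 (Nat.le_add_right (s + 1) i) hj)
    dsimp only at this
    simp only [dependsOn_admirerCount hP i h, this]) μ

theorem integrable_popularity (hP : ∀ k, P.homophilyIndex k = 1) (μ : Measure (ℕ → Fin K))
    [IsFiniteMeasure μ] (i t : ℕ) : Integrable (fun θ => (popularity P γ i t θ).toReal) μ :=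
  integrable_of_dependsOn (n := t) (fun θ θ' h => by
    simp only [dependsOn_popularity hP i h]) μ

theorem meanAdmirers_nonneg (i s : ℕ) : 0 ≤ meanAdmirers P p k i s :=
  integral_nonneg fun _ => ENNReal.toReal_nonneg

theorem meanSearchers_nonneg (i s : ℕ) : 0 ≤ meanSearchers P p k i s :=
  integral_nonneg fun _ => ENNReal.toReal_nonneg

theorem meanAdmirers_le_meanSearchers (hP : ∀ k, P.homophilyIndex k = 1) (hp : p k ≠ 0) (i s : ℕ) :
    meanAdmirers P p k i s ≤ meanSearchers P p k i s := by
  have := isProbabilityMeasure_condLaw i hp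
  refine integral_mono_ae (integrable_admirerCount hP _ i s) (integrable_searcherCount hP _ s) ?_
  filter_upwards [condLaw_type i] with θ hθ
  have := admirerCount_le_searcherCount (P := P) (t := s) (θ := θ) i
  rw [hθ] at this
  exact ENNReal.toReal_mono (searcherCount_ne_top k) this

theorem meanSearchers_succ_le (hP : ∀ k, P.homophilyIndex k = 1) (hp : p k ≠ 0) (i s : ℕ) :
    meanSearchers P p k i (s + 1) ≤ meanSearchers P p k i s + 1 := by
  have := isProbabilityMeasure_condLaw i hp
  have h1 : ∫ θ, ((searcherCount P k s θ).toReal + 1) ∂(condLaw p k i) =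
      meanSearchers P p k i s + 1 := by
    rw [integral_add (integrable_searcherCount hP _ s) (integrable_const _)]
    simp [meanSearchers]
  rw [← h1]
  refine integral_mono (integrable_searcherCount hP _ _)
    ((integrable_searcherCount hP _ s).add (integrable_const _)) fun θ => ?_
  have := ENNReal.toReal_mono (ENNReal.add_ne_top.2 ⟨searcherCount_ne_top k, ENNReal.one_ne_top⟩)
    (searcherCount_succ_le (P := P) (t := s) (θ := θ) k)
  rwa [ENNReal.toReal_add (searcherCount_ne_top k) ENNReal.one_ne_top, ENNReal.toReal_one] at this

theorem sum_meanLinksLower_le (hP : ∀ k, P.homophilyIndex k = 1) (hp : p k ≠ 0) (i : ℕ) {T t : ℕ}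
    (hT : 1 ≤ T) (hTt : T ≤ t) : ∑ s ∈ Finset.Ico T t, meanLinksLower P p k i s ≤
      P.gregariousness k * ∫ θ, (typeCount θ k t : ℝ) ∂(condLaw p k i) := by
  have := isProbabilityMeasure_condLaw i hp
  have hint : ∀ s, Integrable (fun θ => (searcherCount P k s θ).toReal *
      (((typeCount θ k (s + 1) : ℝ) - (1 + P.gregariousness k)) / s)) (condLaw p k i) := fun s =>
    integrable_searcherCount_mul hP _ s fun n => ((n : ℝ) - (1 + P.gregariousness k)) / s
  unfold meanLinksLower
  rw [← integral_finsetSum _ fun s _ => hint s, ← integral_const_mul]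
  exact integral_mono (integrable_finsetSum _ fun s _ => hint s)
    ((integrable_typeCount _ t).const_mul _) fun θ => toReal_sum_searcherCount_le hP k hT hTt

theorem le_sum_meanLinksUpper (hP : ∀ k, P.homophilyIndex k = 1) (hp : p k ≠ 0) (i : ℕ) {T t : ℕ}
    (hT : P.gregariousness k + P.gregariousness k * P.gregariousness k < T) (hTt : T ≤ t) :
    P.gregariousness k * ∫ θ, (typeCount θ k t : ℝ) ∂(condLaw p k i) ≤ P.gregariousness k * T +
      P.gregariousness k + ∑ s ∈ Finset.Ico T t, meanLinksUpper P p k i s +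
      P.gregariousness k * meanSearchers P p k i t := by
  have := isProbabilityMeasure_condLaw i hp
  have hint : ∀ s, Integrable (fun θ => (admirerCount P i s θ).toReal *
      (((typeCount θ k (s + 1) : ℝ) + P.gregariousness k) / ((s : ℝ) -
      (P.gregariousness k + P.gregariousness k * P.gregariousness k : ℕ)))) (condLaw p k i) :=
    fun s => integrable_admirerCount_mul hP _ i s fun n => ((n : ℝ) + P.gregariousness k) /
      ((s : ℝ) - (P.gregariousness k + P.gregariousness k * P.gregariousness k : ℕ))
  have hint' := integrable_finsetSum (Finset.Ico T t) fun s _ => hint s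
  unfold meanLinksUpper meanSearchers
  rw [← integral_finsetSum _ fun s _ => hint s, ← integral_const_mul, ← integral_const_mul]
  have hc : (P.gregariousness k * T + P.gregariousness k : ℝ) =
      ∫ _θ, (P.gregariousness k * T + P.gregariousness k : ℝ) ∂(condLaw p k i) := by simp
  have hs := (integrable_searcherCount (k := k) hP (condLaw p k i) t).const_mul
    (P.gregariousness k : ℝ)
  have hsum := (integrable_const (P.gregariousness k * T + P.gregariousness k : ℝ)).add hint'
  simp only [Pi.add_def] at hsum
  rw [hc, ← integral_add (integrable_const _) hint', ← integral_add hsum hs]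
  refine integral_mono_ae ((integrable_typeCount _ t).const_mul _) (hsum.add hs) ?_
  filter_upwards [condLaw_type i] with θ hθ
  have := toReal_le_sum_admirerCount (P := P) (θ := θ) hP i (by rwa [hθ]) hTt
  rw [hθ] at this
  exact this

theorem eventually_le_meanLinksLower (hP : ∀ k, P.homophilyIndex k = 1) (hp : p k ≠ 0) (i : ℕ)
    {ε : ℝ} (hε : 0 < ε) : ∀ᶠ s : ℕ in atTop,
      ((p k).toReal - ε) * meanSearchers P p k i s ≤ meanLinksLower P p k i s + ε := by
  have := isProbabilityMeasure_condLaw i hp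
  set q := (p k).toReal with hq
  set L : ℝ := (P.gregariousness k : ℝ) with hL
  have hL0 : 0 ≤ L := by positivity
  have hq1 : q ≤ 1 := toReal_le_one
  have hq0 : 0 ≤ q := ENNReal.toReal_nonneg
  have hlim := ((tendsto_condLaw_deviation (p := p) (k := k) i
    (show 0 < ε / 2 by linarith)).comp (tendsto_add_atTop_nat 1)).eventually_lt_const
    (show 0 < ε / (2 + L) by positivity)
  have hbig : ∀ᶠ s : ℕ in atTop, ε / 2 + 1 + L ≤ ε / 2 * s :=
    (tendsto_natCast_atTop_atTop.const_mul_atTop (by linarith)).eventually_ge_atTop _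
  filter_upwards [hlim, hbig, eventually_ge_atTop 1] with s h1 h2 h3
  have hs1 : (1 : ℝ) ≤ s := by exact_mod_cast h3
  -- On the atypical event the left side is at most `u` and the product on the right at least `-(1 +
  -- L) * u`; as `u ≤ s + 1`, the correction `(2 + L) * (s + 1)` covers the gap.
  have hpt : ∀ θ : ℕ → Fin K, (q - ε) * (searcherCount P k s θ).toReal ≤
      (searcherCount P k s θ).toReal * (((typeCount θ k (s + 1) : ℝ) - (1 + L)) / s) +
      (2 + L) * (s + 1) * (deviation p k (ε / 2) (s + 1)).indicator 1 θ := by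
    intro θ
    have hu0 : 0 ≤ (searcherCount P k s θ).toReal := ENNReal.toReal_nonneg
    have hu1 := toReal_searcherCount_le (P := P) (t := s) (θ := θ) k
    set u := (searcherCount P k s θ).toReal
    by_cases hθ : θ ∈ deviation p k (ε / 2) (s + 1)
    · rw [Set.indicator_of_mem hθ, Pi.one_apply, mul_one]
      have h4 : -(1 + L) ≤ ((typeCount θ k (s + 1) : ℝ) - (1 + L)) / s := by
        rw [le_div_iff₀ (by linarith)]
        have : (0 : ℝ) ≤ typeCount θ k (s + 1) := by positivity
        nlinarith
      have h5 := mul_le_mul_of_nonneg_left h4 hu0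
      have h6 : (q - ε) * u ≤ 1 * u := by gcongr; linarith
      have h7 : (2 + L) * u ≤ (2 + L) * (s + 1) := by gcongr
      linarith
    · rw [Set.indicator_of_notMem hθ, mul_zero, add_zero, mul_comm]
      refine mul_le_mul_of_nonneg_left ?_ hu0
      have h4 := (abs_le.1 (notMem_deviation.1 hθ)).1
      rw [le_div_iff₀ (by linarith)]
      push_cast at h4
      linarith
  have hint := integrable_searcherCount_mul (k := k) hP (condLaw p k i) s
    fun n => ((n : ℝ) - (1 + L)) / s
  have hdev := (integrable_indicator_deviation (p := p) (k := k) (condLaw p k i) (ε / 2)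
    (s + 1)).const_mul ((2 + L) * (s + 1))
  have hmono := integral_mono ((integrable_searcherCount (k := k) hP _ s).const_mul (q - ε))
    (hint.add hdev) hpt
  rw [integral_const_mul, integral_add' hint hdev, integral_const_mul,
    integral_indicator_one (measurableSet_deviation _ _)] at hmono
  refine hmono.trans (add_le_add le_rfl ?_)
  simp only [Function.comp_apply] at h1
  rw [lt_div_iff₀ (by positivity)] at h1
  push_cast at h1
  linarith

theorem eventually_meanLinksUpper_le (hP : ∀ k, P.homophilyIndex k = 1) (hp : p k ≠ 0) (i : ℕ)
    {ε : ℝ} (hε : 0 < ε) : ∀ᶠ s : ℕ in atTop,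
      meanLinksUpper P p k i s ≤ ((p k).toReal + ε) * meanAdmirers P p k i s + ε := by
  have := isProbabilityMeasure_condLaw i hp
  set q := (p k).toReal with hq
  set L : ℝ := (P.gregariousness k : ℝ) with hL
  set C : ℝ := ((P.gregariousness k + P.gregariousness k * P.gregariousness k : ℕ) : ℝ) with hC
  have hL0 : 0 ≤ L := by positivity
  have hC0 : 0 ≤ C := by positivity
  have hq0 : 0 ≤ q := ENNReal.toReal_nonneg
  have hlim := ((tendsto_condLaw_deviation (p := p) (k := k) i
    (show 0 < ε / 2 by linarith)).comp (tendsto_add_atTop_nat 1)).eventually_lt_const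
    (show 0 < ε / 2 by linarith)
  have hbig : ∀ᶠ s : ℕ in atTop, q + ε / 2 + L + (q + ε) * C ≤ ε / 2 * s :=
    (tendsto_natCast_atTop_atTop.const_mul_atTop (by linarith)).eventually_ge_atTop _
  have hbig' : ∀ᶠ s : ℕ in atTop, 2 * C + 1 + L ≤ (s : ℝ) :=
    tendsto_natCast_atTop_atTop.eventually_ge_atTop _
  filter_upwards [hlim, hbig, hbig'] with s h1 h2 h3
  have hsC : 0 < (s : ℝ) - C := by linarith
  -- On the atypical event the quotient is at most `2` once `s ≥ 2 * C + 1 + L`, and there are at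
  -- most `s + 1` admirers.
  have hpt : ∀ᵐ θ ∂(condLaw p k i), (admirerCount P i s θ).toReal *
      (((typeCount θ k (s + 1) : ℝ) + L) / ((s : ℝ) - C)) ≤
      (q + ε) * (admirerCount P i s θ).toReal +
      2 * (s + 1) * (deviation p k (ε / 2) (s + 1)).indicator 1 θ := by
    filter_upwards [condLaw_type i] with θ hi
    have hu0 : 0 ≤ (admirerCount P i s θ).toReal := ENNReal.toReal_nonneg
    have hu1 : (admirerCount P i s θ).toReal ≤ s + 1 :=
      (ENNReal.toReal_mono (searcherCount_ne_top _) (admirerCount_le_searcherCount i)).trans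
        (toReal_searcherCount_le _)
    set u := (admirerCount P i s θ).toReal
    by_cases hθ : θ ∈ deviation p k (ε / 2) (s + 1)
    · rw [Set.indicator_of_mem hθ, Pi.one_apply, mul_one]
      have h4 : ((typeCount θ k (s + 1) : ℝ) + L) / ((s : ℝ) - C) ≤ 2 := by
        rw [div_le_iff₀ hsC]
        have : (typeCount θ k (s + 1) : ℝ) ≤ (s + 1 : ℕ) := by exact_mod_cast typeCount_le k
        push_cast at this
        linarith
      have h5 := mul_le_mul_of_nonneg_left h4 hu0
      have h6 : 0 ≤ (q + ε) * u := by positivity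
      linarith
    · rw [Set.indicator_of_notMem hθ, mul_zero, add_zero, mul_comm (q + ε)]
      refine mul_le_mul_of_nonneg_left ?_ hu0
      have h4 := (abs_le.1 (notMem_deviation.1 hθ)).2
      rw [div_le_iff₀ hsC]
      push_cast at h4
      linarith
  have hint := integrable_admirerCount_mul (k := k) hP (condLaw p k i) i s
    fun n => ((n : ℝ) + L) / ((s : ℝ) - C)
  have hdev := (integrable_indicator_deviation (p := p) (k := k) (condLaw p k i) (ε / 2)
    (s + 1)).const_mul (2 * ((s : ℝ) + 1))
  have hadm := (integrable_admirerCount hP (condLaw p k i) i s).const_mul (q + ε)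
  have hmono := integral_mono_ae hint (hadm.add hdev) hpt
  rw [integral_add' hadm hdev, integral_const_mul, integral_const_mul,
    integral_indicator_one (measurableSet_deviation _ _)] at hmono
  refine hmono.trans (add_le_add le_rfl ?_)
  simp only [Function.comp_apply] at h1
  push_cast at h1
  linarith

/-- If meetings are not opportunistic, popularity grows logarithmically. -/
theorem tendsto_expectedPopularity_div_log (hP : ∀ k, P.homophilyIndex k = 1) (hp : p k ≠ 0) {i : ℕ}
    (hi : 1 ≤ i) : Tendsto (fun t : ℕ => expectedPopularity P (fun _ => 0) p k i t /
        ((P.gregariousness k : ℝ) * Real.log t)) atTop (𝓝 1) := by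
  have := isProbabilityMeasure_condLaw i hp
  set L : ℝ := (P.gregariousness k : ℝ) with hL
  set C : ℕ := P.gregariousness k + P.gregariousness k * P.gregariousness k with hC
  have hL0 : 0 < L := Nat.cast_pos.2 (Preferences.one_le_gregariousness (hP k))
  have hq0 := toReal_pos_of_ne_zero hp
  have hn := tendsto_integral_typeCount hp i
  have hup : ∀ M, L < M → ∀ᶠ t : ℕ in atTop,
      ∑ s ∈ Finset.range t, meanSearchers P p k i s ≤ M * t := fun M hM =>
    eventually_sum_le_of_balance (x := meanLinksLower P p k i) hL0.le hq0
      ((eventually_ge_atTop 1).mono fun T hT t ht => sum_meanLinksLower_le hP hp i hT ht)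
      (fun ε hε => eventually_le_meanLinksLower hP hp i hε) hn hM
  -- Any slope above `L` serves here: a linear bound on the sums already makes the number of
  -- searchers `o(t)`, as the lower bound requires.
  have hsmall := tendsto_div_zero_of_increment_le_one (meanSearchers_nonneg (P := P) (p := p)
    (k := k) i) (meanSearchers_succ_le hP hp i) (hup (L + 1) (by linarith))
  have hlow : ∀ M, M < L → ∀ᶠ t : ℕ in atTop,
      M * t ≤ ∑ s ∈ Finset.range t, meanAdmirers P p k i s := fun M hM =>
    eventually_le_sum_of_balance (x' := meanLinksUpper P p k i) hL0.le hq0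
      ((eventually_gt_atTop C).mono fun T hT t ht => le_sum_meanLinksUpper hP hp i hT ht)
      (fun ε hε => eventually_meanLinksUpper_le hP hp i hε) (meanAdmirers_nonneg i) hn hsmall hM
  obtain ⟨h1, h2⟩ := tendsto_cesaro_of_bounds (fun t => Finset.sum_le_sum fun s _ =>
    meanAdmirers_le_meanSearchers hP hp i s) hup hlow
  simp only [expectedPopularity_eq_integral hP hp]
  refine tendsto_div_log_of_increments hL0 h1 h2 (fun ε hε => ?_) ?_
  · have hbig : ∀ᶠ s : ℕ in atTop, (1 + ε) * C ≤ ε * (s : ℝ) :=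
      (tendsto_natCast_atTop_atTop.const_mul_atTop hε).eventually_ge_atTop _
    filter_upwards [hbig, eventually_gt_atTop C] with t h3 h4
    have ht0 : (0 : ℝ) < t := by exact_mod_cast (by omega : 0 < t)
    have htC : (0 : ℝ) < t - C := by rw [sub_pos]; exact_mod_cast h4
    have hpt : ∀ᵐ θ ∂(condLaw p k i), (popularity P (fun _ => 0) i (t + 1) θ).toReal ≤
        (popularity P (fun _ => 0) i t θ).toReal +
          (1 + ε) / t * (searcherCount P k t θ).toReal := by
      filter_upwards [condLaw_type i] with θ hθ
      have h5 := toReal_popularity_succ_le (P := P) (θ := θ) (i := i) (t := t) hP (by rwa [hθ])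
      rw [hθ] at h5
      refine h5.trans (add_le_add le_rfl ?_)
      rw [div_eq_inv_mul]
      refine mul_le_mul_of_nonneg_right ?_ ENNReal.toReal_nonneg
      rw [inv_eq_one_div, div_le_div_iff₀ htC ht0]
      linarith
    have hs := (integrable_searcherCount (k := k) hP (condLaw p k i) t).const_mul ((1 + ε) / t)
    have hmono := integral_mono_ae (integrable_popularity hP _ i (t + 1))
      ((integrable_popularity hP _ i t).add hs) hpt
    rw [integral_add' (integrable_popularity hP _ i t) hs, integral_const_mul] at hmono
    rw [mul_div_assoc', mul_div_right_comm]
    exact hmono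
  · filter_upwards [eventually_ge_atTop i] with t ht
    have hs := (integrable_admirerCount hP (condLaw p k i) i t).div_const (t : ℝ)
    have hmono := integral_mono ((integrable_popularity hP (condLaw p k i) i t).add hs)
      (integrable_popularity hP _ i (t + 1)) fun θ => toReal_le_popularity_succ (P := P) (θ := θ) hP
        (hi.trans ht) (Finset.mem_Icc.2 ⟨hi, by omega⟩)
    rw [integral_add' (integrable_popularity hP _ i t) hs, integral_div] at hmono
    exact hmono

end Averages

/-! ### Full opportunism: popularity generates followers -/

section Opportunism

variable {K : ℕ} {P : Preferences K} {θ : ℕ → Fin K} {t : ℕ} {G : Network}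

theorem indegree_mono_afterMeetings (i : ℕ) (m : ℕ → Option ℕ) :
    G.indegree i t ≤ (afterMeetings P θ G m).indegree i (t + 1) := by
  refine Finset.card_le_card fun j hj => ?_
  simp only [Finset.mem_filter, Finset.mem_Icc] at hj ⊢
  exact ⟨by omega, subset_afterMeeting j (m j) hj.2⟩

theorem popularity_mono {γ : Fin K → ℝ≥0} (i : ℕ) :
    popularity P γ i t θ ≤ popularity P γ i (t + 1) θ := by
  rw [popularity, popularity, expect_networkLaw_succ]
  refine PMF.expect_mono fun G _ => ?_
  refine (PMF.expect_const (meetings γ θ G (t + 1) (t + 1)) (G.indegree i t : ℝ≥0∞)).ge.trans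
    (PMF.expect_mono fun m _ => ?_)
  exact_mod_cast indegree_mono_afterMeetings i m

theorem le_expect_indegree {γ : Fin K → ℝ≥0} (hP : ∀ k, P.homophilyIndex k = 1)
    (h : Feasible P θ t G) {i : ℕ} {S : Finset ℕ}
    (hS : ∀ j ∈ S, j ∈ unsaturated P θ G (t + 1) ∧ i ∈ linkable θ G (t + 1) j) :
    (G.indegree i t : ℝ≥0∞) + ∑ j ∈ S, G.meetingLaw (γ (θ j)) j (t + 1) (some i) ≤
    (meetings γ θ G (t + 1) (t + 1)).expect fun m =>
      ((afterMeetings P θ G m).indegree i (t + 1) : ℝ≥0∞) := by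
  simp only [indegree_eq_sum]
  refine le_trans ?_ (le_expect_sum_afterMeetings hP h (γ := γ)
    (φ := fun j A => if i ∈ A then 1 else 0) (by simp)
    (c := fun j l => if l = i then 1 else 0) ?_)
  · refine add_le_add le_rfl (le_trans ?_ (Finset.sum_le_sum_of_subset fun j hj => (hS j hj).1))
    refine Finset.sum_le_sum fun j hj => ?_
    simp [(hS j hj).2]
  · intro j l hl
    have := (mem_linkable.1 hl).2.2
    by_cases hli : l = i
    · subst hli; simp [this]
    · simp [hli, Ne.symm hli]

/-- A newborn agent of the type of `i` meets `i` with probability `1 / t`. -/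
theorem le_popularity_succ_of_newborn {γ : Fin K → ℝ≥0} (hP : ∀ k, P.homophilyIndex k = 1)
    {i : ℕ} (hi : 1 ≤ i) (hit : i ≤ t) (hθ : θ (t + 1) = θ i) :
    popularity P γ i t θ + (t : ℝ≥0∞)⁻¹ ≤ popularity P γ i (t + 1) θ := by
  rw [popularity, popularity, expect_networkLaw_succ,
    ← PMF.expect_const (networkLaw P γ θ t) (t : ℝ≥0∞)⁻¹, ← PMF.expect_add]
  refine PMF.expect_mono fun G hG => ?_
  have h := feasible_of_mem_support hP hG
  have h0 : G (t + 1) = ∅ := h.unborn _ (by simp)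
  have hmem : t + 1 ∈ Finset.Icc 1 (t + 1) := by simp
  have hmem' : i ∈ Finset.Icc 1 (t + 1) := by simp; omega
  refine le_trans ?_ (le_expect_indegree hP h (S := {t + 1}) fun j hj => ?_)
  · rw [Finset.sum_singleton, h.meetingLaw_of_no_followees (hi.trans hit) _ hmem h0 hmem' (by omega)]
  · rw [Finset.mem_singleton] at hj
    subst hj
    refine ⟨mem_unsaturated.2 ⟨hmem, ?_⟩, mem_linkable.2 ⟨⟨hmem', hθ.symm⟩, by omega, by simp [h0]⟩⟩
    rw [h0]
    exact Preferences.one_le_gregariousness (hP _)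

/-- The agents whose only followee follows `i`. -/
def secondFollowers (i t : ℕ) (G : Network) : Finset ℕ :=
  (Finset.Icc 1 t).filter fun j => j ≠ i ∧ ∃ l ∈ G j, G j = {l} ∧ i ∈ G l

theorem mem_secondFollowers {i j : ℕ} : j ∈ secondFollowers i t G ↔
    j ∈ Finset.Icc 1 t ∧ j ≠ i ∧ ∃ l, G j = {l} ∧ i ∈ G l := by
  simp only [secondFollowers, Finset.mem_filter]
  refine and_congr_right fun _ => and_congr_right fun _ => exists_congr fun l =>
    and_iff_right_of_imp fun h => ?_
  rw [h.1]
  exact Finset.mem_singleton_self l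

/-- The expected number of second followers, given the types. -/
def secondFollowerCount (P : Preferences K) (i t : ℕ) (θ : ℕ → Fin K) : ℝ≥0∞ :=
  (networkLaw P (fun _ => 1) θ t).expect fun G => ((secondFollowers i t G).card : ℝ≥0∞)

/-- A second follower has one followee, hence at most `L` followees of followees, and `i` is among
them. With `γ = 1` it surely meets one of these, uniformly, and it still accepts a link because `2 ≤
L`. -/
theorem le_popularity_succ_of_secondFollowers (hP : ∀ k, P.homophilyIndex k = 1)
    {i : ℕ} (hL : 2 ≤ P.gregariousness (θ i)) (ht : 1 ≤ t) :
    popularity P (fun _ => 1) i t θ +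
      secondFollowerCount P i t θ * (P.gregariousness (θ i) : ℝ≥0∞)⁻¹ ≤
      popularity P (fun _ => 1) i (t + 1) θ := by
  rw [popularity, popularity, expect_networkLaw_succ, secondFollowerCount,
    ← PMF.expect_mul_const, ← PMF.expect_add]
  refine PMF.expect_mono fun G hG => ?_
  have h := feasible_of_mem_support hP hG
  have hsub : Finset.Icc 1 t ⊆ Finset.Icc 1 (t + 1) := Finset.Icc_subset_Icc_right (by omega)
  have key : ∀ j ∈ secondFollowers i t G, j ∈ Finset.Icc 1 (t + 1) ∧ θ j = θ i ∧
      (G j).card = 1 ∧ i ∈ Finset.Icc 1 (t + 1) ∧ i ∈ G.followeesOfFollowees j := by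
    intro j hj
    obtain ⟨hj1, hji, l, hl, hil⟩ := mem_secondFollowers.1 hj
    refine ⟨hsub hj1, ?_, by simp [hl], hsub (h.subset l hil), ?_⟩
    · rw [h.same l i hil, ← h.same j l (by simp [hl])]
    · refine Network.mem_followeesOfFollowees.2 ⟨hji.symm, ⟨l, by simp [hl], hil⟩, ?_⟩
      rw [hl, Finset.mem_singleton]
      rintro rfl
      exact h.irrefl i hil
  refine le_trans ?_ (le_expect_indegree hP h (S := secondFollowers i t G) fun j hj => ?_)
  · rw [← nsmul_eq_mul, ← Finset.sum_const]
    refine add_le_add le_rfl (Finset.sum_le_sum fun j hj => ?_)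
    obtain ⟨h1, h2, h3, h4, h5⟩ := key j hj
    rw [h.meetingLaw_one_of_mem ht h1 h5, ENNReal.inv_le_inv]
    have := h.card_followeesOfFollowees_le j
    rw [h3, one_mul, h2] at this
    exact_mod_cast this
  · obtain ⟨h1, h2, h3, h4, h5⟩ := key j hj
    obtain ⟨h6, -, h7⟩ := Network.mem_followeesOfFollowees.1 h5
    exact ⟨mem_unsaturated.2 ⟨h1, by rw [h2, h3]; omega⟩, mem_linkable.2 ⟨⟨h4, h2.symm⟩, h6, h7⟩⟩

/-- The expected popularity of `i` on the event that `j` has no followees, given the types. -/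
def idlePopularity (P : Preferences K) (i j t : ℕ) (θ : ℕ → Fin K) : ℝ≥0∞ :=
  (networkLaw P (fun _ => 1) θ t).expect fun G =>
    if G j = ∅ then (G.indegree i t : ℝ≥0∞) else 0

theorem afterMeeting_some_of_no_followees (hP : ∀ k, P.homophilyIndex k = 1) {j l : ℕ}
    (h0 : G j = ∅) (hθ : θ l = θ j) : afterMeeting P θ G j (some l) = {l} := by
  rw [afterMeeting_some hP (by simp [h0]), if_pos, h0]
  · simp
  · refine ⟨hθ, ?_⟩
    rw [h0]
    exact Preferences.one_le_gregariousness (hP _)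

/-- Agents without followees meet every follower of `i` with probability `1 / t`. -/
theorem le_secondFollowerCount_succ (hP : ∀ k, P.homophilyIndex k = 1) {i : ℕ} (ht : 1 ≤ t)
    {J : Finset ℕ} (hJ : ∀ j ∈ J, j ∈ Finset.Icc 1 (t + 1) ∧ j ≠ i ∧ θ j = θ i) :
    ∑ j ∈ J, idlePopularity P i j t θ * (t : ℝ≥0∞)⁻¹ ≤ secondFollowerCount P i (t + 1) θ := by
  simp only [idlePopularity, ← PMF.expect_mul_const, ← PMF.expect_sum]
  rw [secondFollowerCount, expect_networkLaw_succ]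
  refine PMF.expect_mono fun G hG => ?_
  have h := feasible_of_mem_support hP hG
  set F := (Finset.Icc 1 t).filter fun l => i ∈ G l with hF
  have hFθ : ∀ l ∈ F, θ l = θ i := fun l hl => (h.same l i (Finset.mem_filter.1 hl).2).symm
  -- `c j` is the indicator that `j` meets a current follower of `i`.
  set c : ℕ → Option ℕ → ℝ≥0∞ := fun j x => ∑ l ∈ F, if x = some l then 1 else 0 with hc
  calc ∑ j ∈ J, (if G j = ∅ then (G.indegree i t : ℝ≥0∞) else 0) * (t : ℝ≥0∞)⁻¹
      = ∑ j ∈ J, if G j = ∅ then (G.meetingLaw 1 j (t + 1)).expect (c j) else 0 := by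
        refine Finset.sum_congr rfl fun j hj => ?_
        split_ifs with h0
        · simp only [hc, PMF.expect_sum, PMF.expect_ite_eq, mul_one]
          rw [Finset.sum_congr rfl fun l hl => h.meetingLaw_of_no_followees ht 1 (hJ j hj).1 h0
            (Finset.Icc_subset_Icc_right (by omega) (Finset.mem_filter.1 hl).1) ?_]
          · rw [Finset.sum_const, nsmul_eq_mul]; rfl
          · rintro rfl
            have := (Finset.mem_filter.1 hl).2
            rw [h0] at this
            simp at this
        · simp
    _ = (meetings (fun _ => 1) θ G (t + 1) (t + 1)).expect fun m =>
          ∑ j ∈ J, if G j = ∅ then c j (m j) else 0 := by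
        rw [PMF.expect_sum]
        refine Finset.sum_congr rfl fun j hj => ?_
        split_ifs with h0
        · exact (expect_meetings (γ := fun _ => 1) (θ := θ) (hJ j hj).1 (c j)).symm
        · exact (PMF.expect_const _ 0).symm
    _ ≤ _ := by
        refine PMF.expect_mono fun m _ => ?_
        have hcard : ((secondFollowers i (t + 1) (afterMeetings P θ G m)).card : ℝ≥0∞) =
            ∑ j ∈ Finset.Icc 1 (t + 1),
              if j ∈ secondFollowers i (t + 1) (afterMeetings P θ G m) then 1 else 0 := by
          have hsub : secondFollowers i (t + 1) (afterMeetings P θ G m) ⊆ Finset.Icc 1 (t + 1) :=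
            Finset.filter_subset _ _
          rw [← Finset.sum_filter, Finset.filter_mem_eq_inter, Finset.inter_eq_right.2 hsub]
          simp
        rw [hcard]
        refine le_trans ?_ (Finset.sum_le_sum_of_subset fun j hj => (hJ j hj).1)
        refine Finset.sum_le_sum fun j hj => ?_
        split_ifs with h0 h1
        · simp only [hc]
          cases m j with
          | none => simp
          | some l => simp only [Option.some.injEq, Finset.sum_ite_eq]; split_ifs <;> simp
        -- Meeting a follower `l` of `i` would turn the empty followee set of `j` into `{l}`, and
        -- `l` keeps its link to `i`, so `j` would be a second follower.
        · refine le_of_eq (Finset.sum_eq_zero fun l hl => if_neg fun hm => h1 ?_)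
          obtain ⟨hj1, hj2, hj3⟩ := hJ j hj
          refine mem_secondFollowers.2 ⟨hj1, hj2, l, ?_, ?_⟩
          · change afterMeeting P θ G j (m j) = _
            rw [hm, afterMeeting_some_of_no_followees hP h0 ((hFθ l hl).trans hj3.symm)]
          · exact subset_afterMeeting l (m l) (Finset.mem_filter.1 hl).2
        · exact zero_le
        · exact zero_le

theorem idlePopularity_of_unborn (hP : ∀ k, P.homophilyIndex k = 1) (i : ℕ) :
    idlePopularity P i (t + 1) t θ = popularity P (fun _ => 1) i t θ :=
  PMF.expect_congr fun G hG => if_pos ((feasible_of_mem_support hP hG).unborn _ (by simp))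

/-- The meetings of an agent without followees do not depend on the rest of the network. -/
theorem le_idlePopularity_succ (hP : ∀ k, P.homophilyIndex k = 1) {i j : ℕ} (ht : 1 ≤ t)
    (hj : j ∈ Finset.Icc 1 (t + 1)) :
    idlePopularity P i j t θ * (1 - typeCount θ (θ j) (t + 1) * (t : ℝ≥0∞)⁻¹) ≤
      idlePopularity P i j (t + 1) θ := by
  rw [idlePopularity, idlePopularity, expect_networkLaw_succ, ← PMF.expect_mul_const]
  refine PMF.expect_mono fun G hG => ?_
  have h := feasible_of_mem_support hP hG
  by_cases h0 : G j = ∅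
  · rw [if_pos h0]
    -- The agent ceases to be idle only by meeting one of at most `typeCount` linkable agents, each
    -- with probability `1 / t`; a union bound suffices.
    set stay : Option ℕ → ℝ≥0∞ := fun x => if afterMeeting P θ G j x = ∅ then 1 else 0 with hstay
    have h1 : 1 - typeCount θ (θ j) (t + 1) * (t : ℝ≥0∞)⁻¹ ≤
        (G.meetingLaw 1 j (t + 1)).expect stay := by
      rw [tsub_le_iff_right]
      calc (1 : ℝ≥0∞) = (G.meetingLaw 1 j (t + 1)).expect fun _ => 1 := (PMF.expect_const _ _).symm
        _ ≤ (G.meetingLaw 1 j (t + 1)).expect fun x => stay x +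
              ∑ l ∈ linkable θ G (t + 1) j, if x = some l then 1 else 0 := by
            refine PMF.expect_mono fun x hx => ?_
            have hu : j ∈ unsaturated P θ G (t + 1) := mem_unsaturated.2 ⟨hj, by
              rw [h0]; exact Preferences.one_le_gregariousness (hP _)⟩
            rcases afterMeeting_cases hP h hu hx with ⟨h2, -⟩ | ⟨l, hl, rfl, -⟩
            · simp [hstay, h2, h0]
            · rw [sum_ite_some_eq hl]; exact le_add_self
        _ ≤ _ := by
            rw [PMF.expect_add, PMF.expect_sum]
            refine add_le_add le_rfl ?_
            simp only [PMF.expect_ite_eq, mul_one]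
            rw [Finset.sum_congr rfl fun l hl => h.meetingLaw_of_no_followees ht 1 hj h0
              (mem_linkable.1 hl).1.1 (mem_linkable.1 hl).2.1, Finset.sum_const, nsmul_eq_mul]
            gcongr
            exact card_linkable_le j
    calc _ ≤ (G.indegree i t : ℝ≥0∞) * (G.meetingLaw 1 j (t + 1)).expect stay := by gcongr
      _ = (meetings (fun _ => 1) θ G (t + 1) (t + 1)).expect fun m =>
            (G.indegree i t : ℝ≥0∞) * stay (m j) := by
          rw [PMF.expect_const_mul, ← expect_meetings (γ := fun _ => 1) hj stay]
      _ ≤ _ := by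
          refine PMF.expect_mono fun m _ => ?_
          have : afterMeetings P θ G m j = afterMeeting P θ G j (m j) := rfl
          simp only [hstay, mul_ite, mul_one, mul_zero, this]
          split_ifs
          · exact_mod_cast indegree_mono_afterMeetings i m
          · exact le_rfl
  · rw [if_neg h0, zero_mul]; exact zero_le

/-- Agent `s + 1` is unborn, hence idle, at date `s`, and remains idle at each of the next `m` dates
with conditional probability at least `r`, whatever the network. Popularity meanwhile does not fall.
-/
theorem le_idlePopularity (hP : ∀ k, P.homophilyIndex k = 1) {i s m : ℕ} (hs : 1 ≤ s) {r : ℝ≥0∞}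
    (hr : ∀ u, s ≤ u → u < s + m → r ≤ 1 - typeCount θ (θ (s + 1)) (u + 1) * (u : ℝ≥0∞)⁻¹) :
    popularity P (fun _ => 1) i s θ * r ^ m ≤ idlePopularity P i (s + 1) (s + m) θ := by
  induction m with
  | zero => simp [idlePopularity_of_unborn hP]
  | succ m ih =>
    rw [pow_succ, ← mul_assoc, ← add_assoc]
    refine le_trans ?_ (le_idlePopularity_succ hP (show 1 ≤ s + m by omega) (by simp))
    exact mul_le_mul' (ih fun u h1 h2 => hr u h1 (by omega)) (hr (s + m) (by omega) (by omega))

/-- Popularity grows in proportion to past popularity. -/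
theorem le_popularity_add_two (hP : ∀ k, P.homophilyIndex k = 1)
    {i M : ℕ} (hL : 2 ≤ P.gregariousness (θ i)) (hi : 1 ≤ i) (ht : i + M ≤ t) {r : ℝ≥0∞}
    (hr : ∀ u, t - M ≤ u → u < t → r ≤ 1 - typeCount θ (θ i) (u + 1) * (u : ℝ≥0∞)⁻¹) :
    popularity P (fun _ => 1) i (t + 1) θ + (∑ m ∈ Finset.range M,
      (if θ (t - m + 1) = θ i then popularity P (fun _ => 1) i (t - m) θ else 0) * r ^ m) *
        ((t : ℝ≥0∞)⁻¹ * (P.gregariousness (θ i) : ℝ≥0∞)⁻¹) ≤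
      popularity P (fun _ => 1) i (t + 2) θ := by
  refine le_trans (add_le_add le_rfl ?_)
    (le_popularity_succ_of_secondFollowers hP hL (show 1 ≤ t + 1 by omega))
  rw [← mul_assoc]
  gcongr
  -- The potential second followers are the same-type agents born at `t - m + 1` with `m < M`: each
  -- has survived `m` dates without a link and meets the followers of `i` at date `t + 1`.
  set S := (Finset.range M).filter fun m => θ (t - m + 1) = θ i with hS
  have hinj : Set.InjOn (fun m => t - m + 1) (S : Set ℕ) := by
    intro a ha b hb hab
    simp only [hS, Finset.coe_filter, Finset.mem_range, Set.mem_ofPred_eq] at ha hb hab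
    omega
  refine le_trans ?_ (le_secondFollowerCount_succ hP (i := i) (show 1 ≤ t by omega)
    (J := S.image fun m => t - m + 1) fun j hj => ?_)
  · rw [Finset.sum_image hinj, Finset.sum_mul, hS, Finset.sum_filter]
    refine Finset.sum_le_sum fun m hm => ?_
    rw [Finset.mem_range] at hm
    split_ifs with hθ
    · gcongr
      have := le_idlePopularity (P := P) (θ := θ) (i := i) hP (show 1 ≤ t - m by omega) (m := m)
        (r := r) fun u h1 h2 => by
          rw [hθ]; exact hr u (by omega) (by omega)
      rwa [Nat.sub_add_cancel (by omega)] at this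
    · simp
  · obtain ⟨m, hm, rfl⟩ := Finset.mem_image.1 hj
    simp only [hS, Finset.mem_filter, Finset.mem_range] at hm
    exact ⟨by simp, by omega, hm.2⟩

end Opportunism

/-! ### Delayed recursions and polynomial growth -/

section Growth

/-- A delayed linear recursion forces polynomial growth. -/
theorem exists_const_mul_rpow_le {g : ℕ → ℝ} {β b : ℝ} {M : ℕ} (hb : 0 ≤ b) (hb1 : b ≤ 1)
    (hbβ : 2 * b ≤ β) (hg : ∀ᶠ t in atTop, 1 ≤ g t)
    (hrec : ∀ᶠ t : ℕ in atTop, g (t + 1) + β * g (t - M) / t ≤ g (t + 2)) :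
    ∃ c > 0, ∀ᶠ t : ℕ in atTop, c * (t : ℝ) ^ b ≤ g t := by
  obtain ⟨T₁, hT₁⟩ := eventually_atTop.1 (hg.and hrec)
  -- Beyond `T` the delayed date `t - M` is at least `(t + 1) / 2`. The delay thus costs a factor `2
  -- ^ b ≤ 2`, which is why `2 * b ≤ β` is assumed. The constant `c` below makes `c * n ^ b ≤ 1 ≤ g
  -- n` on the initial stretch.
  set T := T₁ + 2 * M + 1 with hT
  have hpos : 0 < (((T + 1 : ℕ) : ℝ) ^ b) := by positivity
  refine ⟨(((T + 1 : ℕ) : ℝ) ^ b)⁻¹, inv_pos.2 hpos, eventually_atTop.2 ⟨T - M, ?_⟩⟩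
  set c := (((T + 1 : ℕ) : ℝ) ^ b)⁻¹ with hc
  have hc0 : 0 < c := inv_pos.2 hpos
  intro n
  induction n using Nat.strong_induction_on with
  | _ n ih =>
    intro hn
    by_cases hnT : n ≤ T + 1
    · refine le_trans ?_ (hT₁ n (by omega)).1
      rw [hc, inv_mul_le_one₀ hpos]
      gcongr
    · obtain ⟨t, rfl⟩ : ∃ t, n = t + 2 := ⟨n - 2, by omega⟩
      have h1 := ih (t + 1) (by omega) (by omega)
      have h2 := ih (t - M) (by omega) (by omega)
      have ht0 : (0 : ℝ) < t := by exact_mod_cast (by omega : 0 < t)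
      have h3 : ((t : ℝ) + 1) / 2 ≤ ((t - M : ℕ) : ℝ) := by
        rw [div_le_iff₀ two_pos]
        exact_mod_cast (by omega : t + 1 ≤ (t - M) * 2)
      have h4 : ((t : ℝ) + 1) ^ b / 2 ≤ ((t - M : ℕ) : ℝ) ^ b := by
        calc ((t : ℝ) + 1) ^ b / 2 ≤ ((t : ℝ) + 1) ^ b / 2 ^ b := by
              gcongr
              calc (2 : ℝ) ^ b ≤ 2 ^ (1 : ℝ) := Real.rpow_le_rpow_of_exponent_le (by norm_num) hb1
                _ = 2 := Real.rpow_one 2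
          _ = (((t : ℝ) + 1) / 2) ^ b := (Real.div_rpow (by positivity) (by norm_num) b).symm
          _ ≤ _ := by gcongr
      -- Bernoulli's inequality for an exponent in `[0, 1]` bounds the growth of `t ^ b` over one
      -- date.
      have h5 : ((t : ℝ) + 2) ^ b ≤ ((t : ℝ) + 1) ^ b * (1 + b / (t + 1)) := by
        have h6 := rpow_one_add_le_one_add_mul_self (s := 1 / ((t : ℝ) + 1))
          (by have : 0 ≤ 1 / ((t : ℝ) + 1) := by positivity
              linarith) hb hb1
        calc ((t : ℝ) + 2) ^ b = (((t : ℝ) + 1) * (1 + 1 / (t + 1))) ^ b := by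
              congr 1; field_simp; ring
          _ = ((t : ℝ) + 1) ^ b * (1 + 1 / (t + 1)) ^ b :=
              Real.mul_rpow (by positivity) (by positivity)
          _ ≤ ((t : ℝ) + 1) ^ b * (1 + b / (t + 1)) := by
              gcongr
              rwa [mul_one_div] at h6
      have h7 : b * ((t : ℝ) + 1) ^ b / (t + 1) ≤ β * ((t - M : ℕ) : ℝ) ^ b / t := by
        calc b * ((t : ℝ) + 1) ^ b / (t + 1) ≤ b * ((t : ℝ) + 1) ^ b / t := by gcongr; linarith
          _ = (2 * b) * (((t : ℝ) + 1) ^ b / 2) / t := by ring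
          _ ≤ _ := by gcongr; linarith
      have h8 : c * (((t + 2 : ℕ) : ℝ)) ^ b ≤
          c * ((t + 1 : ℕ) : ℝ) ^ b + β * (c * ((t - M : ℕ) : ℝ) ^ b) / t := by
        have h9 := mul_le_mul_of_nonneg_left h5 hc0.le
        have h10 := mul_le_mul_of_nonneg_left h7 hc0.le
        push_cast
        calc c * ((t : ℝ) + 2) ^ b ≤ _ := h9
          _ = c * ((t : ℝ) + 1) ^ b + c * (b * ((t : ℝ) + 1) ^ b / (t + 1)) := by ring
          _ ≤ c * ((t : ℝ) + 1) ^ b + c * (β * ((t - M : ℕ) : ℝ) ^ b / t) := by gcongr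
          _ = _ := by ring
      have hβ : 0 ≤ β := by linarith
      calc _ ≤ _ := h8
        _ ≤ g (t + 1) + β * g (t - M) / t := by gcongr
        _ ≤ _ := (hT₁ t (by omega)).2

theorem eventually_rpow_le_of_const_mul {g : ℕ → ℝ} {b b' c : ℝ} (hc : 0 < c) (hb : b' < b)
    (h : ∀ᶠ t : ℕ in atTop, c * (t : ℝ) ^ b ≤ g t) : ∀ᶠ t : ℕ in atTop, (t : ℝ) ^ b' ≤ g t := by
  have h1 : Tendsto (fun t : ℕ => (t : ℝ) ^ (b - b')) atTop atTop :=
    (tendsto_rpow_atTop (sub_pos.2 hb)).comp tendsto_natCast_atTop_atTop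
  filter_upwards [h, h1.eventually_ge_atTop c⁻¹, eventually_gt_atTop 0] with t h2 h3 h4
  have ht : (0 : ℝ) < t := by exact_mod_cast h4
  refine le_trans ?_ h2
  rw [inv_le_iff_one_le_mul₀ hc] at h3
  calc (t : ℝ) ^ b' = 1 * (t : ℝ) ^ b' := (one_mul _).symm
    _ ≤ ((t : ℝ) ^ (b - b') * c) * (t : ℝ) ^ b' := by gcongr
    _ = c * ((t : ℝ) ^ (b - b') * (t : ℝ) ^ b') := by ring
    _ = c * (t : ℝ) ^ b := by rw [← Real.rpow_add ht, sub_add_cancel]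

/-- The waiting time for a first link compensates for the rarity of a type. -/
theorem exists_quarter_le_mul_geom_sum {q : ℝ} (hq : 0 < q) :
    ∃ M : ℕ, 1 / 4 ≤ q * ∑ m ∈ Finset.range M, (max 0 (1 - 2 * q)) ^ m := by
  set r := max 0 (1 - 2 * q) with hr
  have hr0 : 0 ≤ r := le_max_left _ _
  have hr1 : r < 1 := max_lt one_pos (by linarith)
  obtain ⟨M, hM⟩ := exists_pow_lt_of_lt_one (show (0 : ℝ) < 1 / 2 by norm_num) hr1
  refine ⟨M, ?_⟩
  -- The sum times `1 - r` is `1 - r ^ M > 1/2`, while `1 - r ≤ 2 * q`; hence `q` times the sum is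
  -- at least `1/4`, uniformly in `q`.
  have h1 := geom_sum_mul_neg r M
  have h2 : 1 - r ≤ 2 * q := by linarith [le_max_right 0 (1 - 2 * q)]
  have h3 : 0 ≤ ∑ m ∈ Finset.range M, r ^ m := Finset.sum_nonneg fun m _ => by positivity
  nlinarith

end Growth

/-! ### Averaging over types: polynomial growth under full opportunism -/

section OpportunismAverages

variable {K : ℕ} {P : Preferences K} {p : PMF (Fin K)} {k : Fin K}

variable (P p k) in
/-- Expected popularity under maximal opportunism, as an integral. -/
def meanPopularity (i t : ℕ) : ℝ :=
  ∫ θ, (popularity P (fun _ => 1) i t θ).toReal ∂(condLaw p k i)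

theorem toReal_popularity_le {γ : Fin K → ℝ≥0} {θ : ℕ → Fin K} (i t : ℕ) :
    (popularity P γ i t θ).toReal ≤ t := by
  simpa using ENNReal.toReal_mono (ENNReal.natCast_ne_top t) (popularity_le (P := P) i)

theorem toReal_popularity_mono {γ : Fin K → ℝ≥0} {θ : ℕ → Fin K} (i : ℕ) :
    Monotone fun t => (popularity P γ i t θ).toReal :=
  monotone_nat_of_le_succ fun _ => ENNReal.toReal_mono (popularity_ne_top i) (popularity_mono i)

theorem meanPopularity_mono (hP : ∀ k, P.homophilyIndex k = 1) (hp : p k ≠ 0) (i : ℕ) :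
    Monotone (meanPopularity P p k i) := by
  have := isProbabilityMeasure_condLaw i hp
  exact fun s t hst => integral_mono (integrable_popularity hP _ i s)
    (integrable_popularity hP _ i t) fun θ => toReal_popularity_mono i hst

theorem integrable_type_mul_popularity (hP : ∀ k, P.homophilyIndex k = 1)
    (μ : Measure (ℕ → Fin K)) [IsFiniteMeasure μ] (i j t : ℕ) :
    Integrable (fun θ => (if θ j = k then 1 else 0) *
      (popularity P (fun _ => 1) i t θ).toReal) μ :=
  integrable_of_dependsOn (n := t + j) (fun θ θ' h => by
    have h1 := dependsOn_popularity (P := P) (γ := fun _ => 1) (t := t) hP i fun s hs => h s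
      (Set.Iic_subset_Iic.2 (Nat.le_add_right t j) hs)
    have h2 := h j (Set.mem_Iic.2 (Nat.le_add_left j t))
    simp only [h1, h2]) μ

/-- The newborn has type `k` with probability `p k`, independently of the past, and then meets and
links to `i` with probability `1 / t`. -/
theorem meanPopularity_add_div_le (hP : ∀ k, P.homophilyIndex k = 1) (hp : p k ≠ 0) {i t : ℕ}
    (hi : 1 ≤ i) (hit : i ≤ t) :
    meanPopularity P p k i t + (p k).toReal / t ≤ meanPopularity P p k i (t + 1) := by
  have := isProbabilityMeasure_condLaw i hp
  have h1 : ∫ θ, (if θ (t + 1) = k then (1 : ℝ) else 0) * (t : ℝ)⁻¹ ∂(condLaw p k i) =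
      (p k).toReal / t := by
    rw [integral_condLaw_type_mul (f := fun _ => (t : ℝ)⁻¹) hit (Nat.lt_succ_self t)
      fun _ _ _ => rfl]
    simp [div_eq_mul_inv]
  have hint : Integrable (fun θ : ℕ → Fin K => (if θ (t + 1) = k then (1 : ℝ) else 0) * (t : ℝ)⁻¹)
      (condLaw p k i) :=
    integrable_of_dependsOn (n := t + 1) (fun θ θ' h => by simp only [h (t + 1) (by simp)]) _
  rw [← h1, meanPopularity, ← integral_add (integrable_popularity hP _ i t) hint]
  refine integral_mono_ae ((integrable_popularity hP _ i t).add hint)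
    (integrable_popularity hP _ i (t + 1)) ?_
  filter_upwards [condLaw_type i] with θ hθ
  split_ifs with h2
  · have h3 := ENNReal.toReal_mono (popularity_ne_top i)
      (le_popularity_succ_of_newborn (P := P) (θ := θ) (γ := fun _ => 1) hP hi hit (h2.trans hθ.symm))
    rwa [ENNReal.toReal_add (popularity_ne_top i) (by simp; omega), ENNReal.toReal_inv,
      ENNReal.toReal_natCast, ← one_mul (t : ℝ)⁻¹] at h3
  · rw [zero_mul, add_zero]
    exact toReal_popularity_mono i (Nat.le_succ t)

theorem eventually_one_le_meanPopularity (hP : ∀ k, P.homophilyIndex k = 1) (hp : p k ≠ 0) {i : ℕ}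
    (hi : 1 ≤ i) : ∀ᶠ t in atTop, 1 ≤ meanPopularity P p k i t := by
  have hq := toReal_pos_of_ne_zero hp
  have hi0 : (0 : ℝ) < i := by exact_mod_cast hi
  -- Harmonic divergence carries expected popularity past `1`, via `1 / (i + n) ≥ 1 / (i * (n +
  -- 1))`.
  have h1 : ∀ n : ℕ, (p k).toReal / i * ∑ s ∈ Finset.range n, (1 : ℝ) / (s + 1) ≤
      meanPopularity P p k i (i + n) := by
    intro n
    induction n with
    | zero => simpa [meanPopularity] using integral_nonneg fun _ => ENNReal.toReal_nonneg
    | succ n ih =>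
      rw [Finset.sum_range_succ, mul_add]
      have h2 := meanPopularity_add_div_le (P := P) hP hp hi (Nat.le_add_right i n)
      refine le_trans (add_le_add ih ?_) h2
      rw [div_mul_div_comm, mul_one]
      push_cast
      have : (1 : ℝ) ≤ i := by exact_mod_cast hi
      gcongr
      nlinarith [(Nat.cast_nonneg n : (0 : ℝ) ≤ n)]
  obtain ⟨n, hn⟩ := ((Real.tendsto_sum_range_one_div_nat_succ_atTop.const_mul_atTop
    (div_pos hq hi0)).eventually_ge_atTop 1).exists
  filter_upwards [eventually_ge_atTop (i + n)] with t ht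
  exact hn.trans ((h1 n).trans (meanPopularity_mono hP hp i ht))

/-- For typical types the count is at most `3/2 * q * t`, and `t ≤ 4/3 * u` by the choice of `t`;
the product is `2 * q * u`, so an idle agent survives the date with probability at least `1 - 2 *
q`. -/
theorem typeCount_survival {θ : ℕ → Fin K} {q : ℝ} {M t u : ℕ} (hq : 0 ≤ q)
    (hN : (typeCount θ k t : ℝ) ≤ 3 / 2 * q * t) (hM : 4 * M + 4 ≤ t) (hu : t - M ≤ u)
    (hut : u < t) :
    ENNReal.ofReal (max 0 (1 - 2 * q)) ≤ 1 - typeCount θ k (u + 1) * (u : ℝ≥0∞)⁻¹ := by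
  have hu0 : (0 : ℝ) < u := by exact_mod_cast (by omega : 0 < u)
  have h1 : (typeCount θ k (u + 1) : ℝ) ≤ 2 * q * u := by
    have h2 : (typeCount θ k (u + 1) : ℝ) ≤ typeCount θ k t := by
      exact_mod_cast typeCount_mono k (by omega)
    have h3 : 3 * (t : ℝ) ≤ 4 * u := by exact_mod_cast (by omega : 3 * t ≤ 4 * u)
    have h4 := mul_le_mul_of_nonneg_left h3 hq
    linarith
  have h5 : (typeCount θ k (u + 1) : ℝ≥0∞) * (u : ℝ≥0∞)⁻¹ =
      ENNReal.ofReal (typeCount θ k (u + 1) / u) := by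
    rw [div_eq_mul_inv, ENNReal.ofReal_mul (by positivity), ENNReal.ofReal_inv_of_pos hu0,
      ENNReal.ofReal_natCast, ENNReal.ofReal_natCast]
  rw [h5, ← ENNReal.ofReal_one, ← ENNReal.ofReal_sub _ (by positivity)]
  have h6 : (typeCount θ k (u + 1) : ℝ) / u ≤ 2 * q := by rwa [div_le_iff₀ hu0]
  rcases max_cases 0 (1 - 2 * q) with ⟨h7, -⟩ | ⟨h7, -⟩ <;> rw [h7]
  · simp
  · exact ENNReal.ofReal_le_ofReal (by linarith)

theorem toReal_le_popularity_add_two (hP : ∀ k, P.homophilyIndex k = 1) {θ : ℕ → Fin K}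
    {i M t : ℕ} (hθ : θ i = k) (hL : 2 ≤ P.gregariousness k) (hi : 1 ≤ i)
    (ht : i + 4 * M + 4 ≤ t) :
    (popularity P (fun _ => 1) i (t + 1) θ).toReal + (∑ m ∈ Finset.range M,
      ((if θ (t - m + 1) = k then 1 else 0) * (popularity P (fun _ => 1) i (t - m) θ).toReal -
        t * (deviation p k ((p k).toReal / 2) t).indicator 1 θ) *
          max 0 (1 - 2 * (p k).toReal) ^ m) * ((t : ℝ)⁻¹ * (P.gregariousness k : ℝ)⁻¹) ≤
      (popularity P (fun _ => 1) i (t + 2) θ).toReal := by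
  set q := (p k).toReal with hq
  set r := max 0 (1 - 2 * q) with hr
  have hr0 : 0 ≤ r := le_max_left _ _
  -- On the atypical event the subtracted `t` makes every summand nonpositive, and monotonicity of
  -- popularity is enough.
  by_cases hdev : θ ∈ deviation p k (q / 2) t
  · rw [Set.indicator_of_mem hdev, Pi.one_apply, mul_one]
    have h1 : (popularity P (fun _ => 1) i (t + 1) θ).toReal ≤
      (popularity P (fun _ => 1) i (t + 2) θ).toReal := toReal_popularity_mono i (Nat.le_succ _)
    refine le_trans ?_ h1
    rw [add_le_iff_nonpos_right]
    refine mul_nonpos_of_nonpos_of_nonneg (Finset.sum_nonpos fun m _ =>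
      mul_nonpos_of_nonpos_of_nonneg ?_ (by positivity)) (by positivity)
    have h2 : (popularity P (fun _ => 1) i (t - m) θ).toReal ≤ t :=
      (toReal_popularity_le i (t - m)).trans (by exact_mod_cast Nat.sub_le t m)
    have h3 : (0 : ℝ) ≤ t := by positivity
    split_ifs <;> linarith
  · rw [Set.indicator_of_notMem hdev]
    have hN : (typeCount θ k t : ℝ) ≤ 3 / 2 * q * t := by
      have := (abs_le.1 (notMem_deviation.1 hdev)).2
      linarith
    have h1 := le_popularity_add_two (P := P) (θ := θ) (i := i) (M := M) (t := t)
      (r := ENNReal.ofReal r) hP (by rwa [hθ]) hi (by omega) fun u h1 h2 => by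
        rw [hθ]
        exact typeCount_survival ENNReal.toReal_nonneg hN (by omega) h1 h2
    rw [hθ] at h1
    have hfin : ∀ m ∈ Finset.range M, (if θ (t - m + 1) = k then
        popularity P (fun _ => 1) i (t - m) θ else 0) * ENNReal.ofReal r ^ m ≠ ⊤ := by
      intro m _
      refine ENNReal.mul_ne_top ?_ (ENNReal.pow_ne_top ENNReal.ofReal_ne_top)
      split_ifs
      · exact popularity_ne_top i
      · simp
    have h2 := ENNReal.toReal_mono (popularity_ne_top i) h1
    rw [ENNReal.toReal_add (popularity_ne_top i) (ENNReal.mul_ne_top (ENNReal.sum_ne_top.2 hfin)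
      (ENNReal.mul_ne_top (by simp; omega) (by simp; omega))), ENNReal.toReal_mul,
      ENNReal.toReal_sum hfin, ENNReal.toReal_mul, ENNReal.toReal_inv, ENNReal.toReal_inv,
      ENNReal.toReal_natCast, ENNReal.toReal_natCast] at h2
    refine le_trans (le_of_eq ?_) h2
    congr 2
    refine Finset.sum_congr rfl fun m _ => ?_
    rw [ENNReal.toReal_mul, ENNReal.toReal_pow, ENNReal.toReal_ofReal hr0, mul_zero, sub_zero]
    split_ifs <;> simp

theorem meanPopularity_add_two (hP : ∀ k, P.homophilyIndex k = 1) (hp : p k ≠ 0) {i M t : ℕ}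
    (hL : 2 ≤ P.gregariousness k) (hi : 1 ≤ i) (ht : i + 4 * M + 4 ≤ t) :
    meanPopularity P p k i (t + 1) + (∑ m ∈ Finset.range M,
      ((p k).toReal * meanPopularity P p k i (t - m) -
        t * (condLaw p k i).real (deviation p k ((p k).toReal / 2) t)) *
          max 0 (1 - 2 * (p k).toReal) ^ m) * ((t : ℝ)⁻¹ * (P.gregariousness k : ℝ)⁻¹) ≤
      meanPopularity P p k i (t + 2) := by
  have := isProbabilityMeasure_condLaw i hp
  have hdev := (integrable_indicator_deviation (p := p) (k := k) (condLaw p k i)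
    ((p k).toReal / 2) t).const_mul (t : ℝ)
  have hpop : ∀ m, Integrable (fun θ => (if θ (t - m + 1) = k then 1 else 0) *
      (popularity P (fun _ => 1) i (t - m) θ).toReal) (condLaw p k i) := fun m =>
    integrable_type_mul_popularity hP _ i (t - m + 1) (t - m)
  have hsummand : ∀ m, Integrable (fun θ => ((if θ (t - m + 1) = k then 1 else 0) *
      (popularity P (fun _ => 1) i (t - m) θ).toReal -
        t * (deviation p k ((p k).toReal / 2) t).indicator 1 θ) *
          max 0 (1 - 2 * (p k).toReal) ^ m) (condLaw p k i) := fun m =>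
    ((hpop m).sub hdev).mul_const _
  have hsum := (integrable_finsetSum (Finset.range M) fun m _ => hsummand m).mul_const
    ((t : ℝ)⁻¹ * (P.gregariousness k : ℝ)⁻¹)
  have hmono : ∫ θ, ((popularity P (fun _ => 1) i (t + 1) θ).toReal + (∑ m ∈ Finset.range M,
      ((if θ (t - m + 1) = k then 1 else 0) * (popularity P (fun _ => 1) i (t - m) θ).toReal -
        t * (deviation p k ((p k).toReal / 2) t).indicator 1 θ) *
          max 0 (1 - 2 * (p k).toReal) ^ m) * ((t : ℝ)⁻¹ * (P.gregariousness k : ℝ)⁻¹))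
        ∂(condLaw p k i) ≤ meanPopularity P p k i (t + 2) := by
    refine integral_mono_ae ((integrable_popularity hP _ i (t + 1)).add hsum)
      (integrable_popularity hP _ i (t + 2)) ?_
    filter_upwards [condLaw_type i] with θ hθ
    exact toReal_le_popularity_add_two hP hθ hL hi ht
  rw [integral_add (integrable_popularity hP _ i (t + 1)) hsum, integral_mul_const,
    integral_finsetSum _ fun m _ => hsummand m] at hmono
  refine le_trans (le_of_eq ?_) hmono
  congr 2
  refine Finset.sum_congr rfl fun m hm => ?_
  rw [Finset.mem_range] at hm
  rw [integral_mul_const, integral_sub (hpop m) hdev, integral_const_mul,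
    integral_indicator_one (measurableSet_deviation _ _),
    -- The type of agent `t - m + 1` is independent of popularity at date `t - m`, which yields the
    -- factor `q`.
    integral_condLaw_type_mul (by omega : i ≤ t - m) (Nat.lt_succ_self (t - m))
      (fun θ θ' h => by simp only [dependsOn_popularity hP i h])]
  rfl

theorem eventually_meanPopularity_recursion (hP : ∀ k, P.homophilyIndex k = 1) (hp : p k ≠ 0)
    {i : ℕ} (hL : 2 ≤ P.gregariousness k) (hi : 1 ≤ i) :
    ∃ M : ℕ, ∀ᶠ t : ℕ in atTop, meanPopularity P p k i (t + 1) +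
      1 / (8 * P.gregariousness k) * meanPopularity P p k i (t - M) / t ≤
        meanPopularity P p k i (t + 2) := by
  have hq := toReal_pos_of_ne_zero hp
  obtain ⟨M, hM⟩ := exists_quarter_le_mul_geom_sum hq
  refine ⟨M, ?_⟩
  set q := (p k).toReal with hqdef
  set r := max 0 (1 - 2 * q) with hr
  set S := ∑ m ∈ Finset.range M, r ^ m with hS
  have hr0 : 0 ≤ r := le_max_left _ _
  have hS0 : 0 ≤ S := Finset.sum_nonneg fun m _ => by positivity
  have hlim := ((tendsto_condLaw_deviation (p := p) (k := k) i
    (show 0 < q / 2 by positivity)).mul_const S)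
  rw [zero_mul] at hlim
  have hone := (tendsto_sub_atTop_nat M).eventually (eventually_one_le_meanPopularity (P := P) hP hp hi)
  filter_upwards [hlim.eventually_lt_const (show (0 : ℝ) < 1 / 8 by norm_num), hone,
    eventually_ge_atTop (i + 4 * M + 4)] with t h1 h2 h3
  refine le_trans ?_ (meanPopularity_add_two hP hp hL hi h3)
  set g := meanPopularity P p k i (t - M) with hg
  set δ := (t : ℝ) * (condLaw p k i).real (deviation p k (q / 2) t) with hδ
  have h4 : g / 8 ≤ ∑ m ∈ Finset.range M, (q * meanPopularity P p k i (t - m) - δ) * r ^ m := by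
    -- From `q * S ≥ 1/4`, `δ * S < 1/8` and `g ≥ 1` one gets `g / 4 - 1 / 8 ≥ g / 8`.
    calc g / 8 ≤ g * (q * S) - δ * S := by nlinarith
      _ = ∑ m ∈ Finset.range M, (q * g - δ) * r ^ m := by rw [← Finset.mul_sum]; ring
      _ ≤ _ := by
          refine Finset.sum_le_sum fun m hm => ?_
          rw [Finset.mem_range] at hm
          gcongr
          exact meanPopularity_mono hP hp i (by omega)
  refine add_le_add le_rfl ?_
  calc 1 / (8 * (P.gregariousness k : ℝ)) * g / t =
        g / 8 * ((t : ℝ)⁻¹ * (P.gregariousness k : ℝ)⁻¹) := by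
        rw [one_div, mul_inv, div_eq_mul_inv, div_eq_mul_inv]; ring
    _ ≤ _ := by gcongr

/-- Under maximal opportunism, popularity of a gregarious agent grows polynomially. -/
theorem eventually_rpow_le_expectedPopularity (hP : ∀ k, P.homophilyIndex k = 1) (hp : p k ≠ 0)
    {i : ℕ} (hL : 2 ≤ P.gregariousness k) (hi : 1 ≤ i) {b : ℝ}
    (hb : b < 1 / (16 * P.gregariousness k)) :
    ∀ᶠ t : ℕ in atTop, (t : ℝ) ^ b ≤ expectedPopularity P (fun _ => 1) p k i t := by
  simp only [expectedPopularity_eq_integral hP hp]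
  obtain ⟨M, hM⟩ := eventually_meanPopularity_recursion hP hp hL hi
  have hL' : (2 : ℝ) ≤ P.gregariousness k := by exact_mod_cast hL
  -- Here `β = 1 / (8 * L)` allows the exponent `β / 2`; the strict inequality for `b` then absorbs
  -- the constant `c`.
  obtain ⟨c, hc, h⟩ := exists_const_mul_rpow_le (g := meanPopularity P p k i)
    (b := 1 / (16 * P.gregariousness k)) (by positivity)
    (by rw [div_le_one₀ (by positivity)]; linarith)
    (by rw [mul_one_div, div_le_div_iff₀ (by positivity) (by positivity)]; linarith)
    (eventually_one_le_meanPopularity hP hp hi) hM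
  exact eventually_rpow_le_of_const_mul hc hb h

end OpportunismAverages

end

/-! ### Choice of the exponents -/

theorem theorem4 {K : ℕ} (P : Preferences K) (hP : ∀ k, P.homophilyIndex k = 1) :
    (∀ (p : PMF (Fin K)) (k : Fin K), p k ≠ 0 → ∀ i : ℕ, 1 ≤ i →
      Tendsto (fun t : ℕ => expectedPopularity P (fun _ => 0) p k i t /
        ((P.gregariousness k : ℝ) * Real.log t)) atTop (𝓝 1)) ∧
    (∃ b : Fin K → ℝ,
      (∀ k, 0 ≤ b k ∧ b k < 1) ∧
      (∀ k, 2 ≤ P.gregariousness k → 0 < b k) ∧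
      (∀ k m, P.gregariousness m < P.gregariousness k → b m < b k) ∧
      ∀ (p : PMF (Fin K)) (k : Fin K), p k ≠ 0 → ∀ i : ℕ, 1 ≤ i →
        ∀ᶠ t : ℕ in atTop, (t : ℝ) ^ b k ≤ expectedPopularity P (fun _ => 1) p k i t) := by
  refine ⟨fun p k hp i hi => tendsto_expectedPopularity_div_log hP hp hi, ?_⟩
  -- The attainable exponents `1 / (16 * L)` decrease in `L`, whereas `b` must increase. Dividing by
  -- the total gregariousness puts `1 / D` below all of them, and `1 - 1 / L` restores the order
  -- while vanishing exactly at `L = 1`.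
  set D : ℝ := 16 * ∑ k, (P.gregariousness k : ℝ) with hD
  have hLD : ∀ k, 16 * (P.gregariousness k : ℝ) ≤ D := fun k => by
    rw [hD]
    gcongr
    exact Finset.single_le_sum (f := fun k => (P.gregariousness k : ℝ))
      (fun _ _ => Nat.cast_nonneg _) (Finset.mem_univ k)
  have hL1 : ∀ k, (1 : ℝ) ≤ P.gregariousness k := fun k => by
    exact_mod_cast Preferences.one_le_gregariousness (hP k)
  have hD0 : ∀ _ : Fin K, 16 ≤ D := fun k => by linarith [hLD k, hL1 k]
  have hlt : ∀ k, 1 / D * (1 - 1 / (P.gregariousness k : ℝ)) < 1 / D := fun k => by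
    have h1 : 0 < 1 / D := one_div_pos.2 (by linarith [hD0 k])
    have h2 : 0 < 1 / (P.gregariousness k : ℝ) := one_div_pos.2 (by linarith [hL1 k])
    nlinarith
  refine ⟨fun k => 1 / D * (1 - 1 / P.gregariousness k), fun k => ⟨?_, ?_⟩, fun k hk => ?_,
    fun k m hkm => ?_, fun p k hp i hi => ?_⟩
  · refine mul_nonneg (by linarith [one_div_nonneg.2 ((by norm_num : (0 : ℝ) ≤ 16).trans (hD0 k))])
      (sub_nonneg.2 ?_)
    rw [div_le_one₀ (by linarith [hL1 k])]
    exact hL1 k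
  · refine (hlt k).trans_le ?_
    rw [div_le_one₀ (by linarith [hD0 k])]
    linarith [hD0 k]
  · have hk' : (2 : ℝ) ≤ P.gregariousness k := by exact_mod_cast hk
    refine mul_pos (one_div_pos.2 (by linarith [hD0 k])) (sub_pos.2 ?_)
    rw [div_lt_one (by linarith)]
    linarith
  · have hkm' : (P.gregariousness m : ℝ) < P.gregariousness k := by exact_mod_cast hkm
    refine mul_lt_mul_of_pos_left ?_ (one_div_pos.2 (by linarith [hD0 k]))
    linarith [one_div_lt_one_div_of_lt (by linarith [hL1 m]) hkm']
  -- For `L = 1` the exponent is `0`, and the claim is that expected popularity eventually reaches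
  -- `1`.
  · rcases (Preferences.one_le_gregariousness (hP k)).eq_or_lt with h | h
    · simp only [← h, expectedPopularity_eq_integral hP hp]
      filter_upwards [eventually_one_le_meanPopularity (P := P) hP hp hi] with t ht
      simpa [meanPopularity] using ht
    · refine eventually_rpow_le_expectedPopularity hP hp h hi ((hlt k).trans_le ?_)
      exact one_div_le_one_div_of_le (by linarith [hL1 k]) (hLD k)
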